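/- Let $m,n\ge 1$, let $U\subseteq\mathbb R^m$, $V\subseteq\mathbb R^n$ be open (coordinate domains of manifolds $M$, $N$ with coordinates $x^i$, $\phi^\sigma$), and let ${}^M\nabla$, ${}^N\nabla$ be torsion-free affine connections with smooth components ${}^M\Gamma^k_{ij}(x)$ on $U$ and ${}^N\Gamma^\sigma_{\alpha\lambda}(\phi)$ on $V$. The summation convention is used, $\partial_p=\partial/\partial x^p$ for Latin and $\partial_\lambda=\partial/\partial\phi^\lambda$ for Greek indices, $f_{,p}=\partial_pf$, $d_p$ is the total derivative, and $\omega^\nu=d\phi^\nu-\phi^\nu_i\,dx^i$. For smooth functions $B^{ij}_{\sigma\nu}(x,\phi)$ on $U\times V$ with $B^{ij}_{\sigma\nu}=B^{ji}_{\sigma\nu}$, and for a volume element $\omega_0=\rho(x)\,dx^1\wedge\dots\wedge dx^m$, consider the dynamical form obtained from the equations of geodesic mappings, $$E=E_\nu\,\omega^\nu\wedge\omega_0,\qquad E_\nu=B^{ij}_{\sigma\nu}\big(\phi^\sigma_{ij}-{}^M\Gamma^k_{ij}\phi^\sigma_k+{}^N\Gamma^\sigma_{\alpha\lambda}\phi^\alpha_i\phi^\lambda_j\big).$$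 $E$ is called variational if in a neighbourhood of every point of $U\times V$ it is the Euler–Lagrange form of a smooth Lagrangian of some finite order. **A. General multiplier, $\omega_0=dx^1\wedge\dots\wedge dx^m$.** (Any other volume element is absorbed in $B$.) $E$ is variational if and only if the Helmholtz conditions $$\text{(H1)}\ \tfrac{\partial E_\nu}{\partial\phi^\mu_{lp}}-\tfrac{\partial E_\mu}{\partial\phi^\nu_{lp}}=0,\qquad \text{(H2)}\ \tfrac{\partial E_\nu}{\partial\phi^\mu_l}+\tfrac{\partial E_\mu}{\partial\phi^\nu_l}-2d_p\tfrac{\partial E_\mu}{\partial\phi^\nu_{lp}}=0,$$ $$\text{(H3)}\ \tfrac{\partial E_\nu}{\partial\phi^\mu}-\tfrac{\partial E_\mu}{\partial\phi^\nu}+d_l\tfrac{\partial E_\mu}{\partial\phi^\nu_l}-d_ld_p\tfrac{\partial E_\mu}{\partial\phi^\nu_{lp}}=0$$ hold. Moreover: 1. (H1) holds if and only if (Sym): $B^{ij}_{\sigma\nu}=B^{ij}_{\nu\sigma}$. 2. Given (Sym), (H2) holds if and only if $$\text{(HP21)}\ -B^{ij}_{\mu\nu}\,{}^M\Gamma^l_{ij}=\partial_pB^{lp}_{\mu\nu},\qquad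 \text{(HP22)}\ {}^N\Gamma^\sigma_{\mu\lambda}B^{ij}_{\sigma\nu}+{}^N\Gamma^\sigma_{\nu\lambda}B^{ij}_{\sigma\mu}=\partial_\lambda B^{ij}_{\mu\nu}.$$ 3. (H3) holds if and only if the following four expressions vanish for all values of the free indices: $$\begin{aligned} P^{ij}_{\mu\nu\sigma}&=\partial_\nu B^{ij}_{\sigma\mu}-\partial_\mu B^{ij}_{\sigma\nu}-\partial_\sigma B^{ij}_{\mu\nu}+B^{ij}_{\alpha\nu}{}^N\Gamma^\alpha_{\mu\sigma}+B^{ij}_{\alpha\nu}{}^N\Gamma^\alpha_{\sigma\mu},\\ Q^{ij}_{\mu\nu\alpha\lambda}&=\partial_\nu(B^{ij}_{\sigma\mu}{}^N\Gamma^\sigma_{\alpha\lambda})-\partial_\mu(B^{ij}_{\sigma\nu}{}^N\Gamma^\sigma_{\alpha\lambda})+\partial_\alpha(B^{ij}_{\sigma\nu}{}^N\Gamma^\sigma_{\mu\lambda})+\partial_\lambda(B^{ij}_{\sigma\nu}{}^N\Gamma^\sigma_{\alpha\mu})-\partial_\lambda\partial_\alpha B^{ij}_{\mu\nu},\\ W^{k}_{\mu\nu\sigma}&={}^M\Gamma^k_{ij}(\partial_\mu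 B^{ij}_{\sigma\nu}-\partial_\nu B^{ij}_{\sigma\mu}-\partial_\sigma B^{ij}_{\mu\nu})+2\,\partial_lB^{lk}_{\lambda\nu}{}^N\Gamma^\lambda_{\mu\sigma}-2\,\partial_p\partial_\sigma B^{kp}_{\mu\nu},\\ T_{\mu\nu}&=-\partial_l(B^{ij}_{\mu\nu}{}^M\Gamma^l_{ij})-\partial_l\partial_pB^{lp}_{\mu\nu}. \end{aligned}$$ 4. These conditions bring nothing new. Given (Sym), $P=0$ is equivalent to (HP22). Given (HP21), $W^k_{\mu\nu\sigma}=-{}^M\Gamma^k_{ij}P^{ij}_{\mu\nu\sigma}$ and $T_{\mu\nu}=0$. Given (Sym) and (HP22), $$Q^{ij}_{\mu\nu\alpha\lambda}=B^{ij}_{\beta\mu}R^\beta{}_{\lambda\nu\alpha}-B^{ij}_{\sigma\nu}R^\sigma{}_{\alpha\mu\lambda}=0,$$ where $R^\beta{}_{\lambda\nu\alpha}=\partial_\nu{}^N\Gamma^\beta_{\alpha\lambda}-\partial_\alpha{}^N\Gamma^\beta_{\nu\lambda}+{}^N\Gamma^\beta_{\nu\kappa}{}^N\Gamma^\kappa_{\alpha\lambda}-{}^N\Gamma^\beta_{\alpha\kappa}{}^N\Gamma^\kappa_{\nu\lambda}$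 is the curvature tensor of ${}^N\nabla$ (pair symmetry of the curvature). 5. Consequently $E$ is variational if and only if (Sym), (HP21) and (HP22) hold. **B. Separated multiplier.** Let $B^{ij}_{\sigma\nu}=g^{ij}(x)\,h_{\sigma\nu}(x,\phi)$, where $g^{ij}$ is smooth, symmetric and regular on $U$, and $h_{\sigma\nu}$ is smooth and regular on $U\times V$. Say that (I) holds if for every $x\in U$ the matrix $h(x,\cdot)$ is symmetric and ${}^N\nabla$ is the Levi-Civita connection of the metric $h(x,\cdot)$ on $V$. (I) implies $h_{\beta\mu}R^\beta{}_{\lambda\nu\alpha}=h_{\sigma\nu}R^\sigma{}_{\alpha\mu\lambda}$, i.e. $R_{\mu\lambda\nu\alpha}=R_{\nu\alpha\mu\lambda}$. * For $\omega_0=dx^1\wedge\dots\wedge dx^m$, $E$ is variational if and only if (I) holds and $$h_{\mu\nu}\big(g^{ij}\,{}^M\Gamma^l_{ij}+g^{lp}{}_{,p}\big)=-h_{\mu\nu,p}\,g^{lp}.$$ * For $\omega_0=\sqrt{|\det(g_{ij})|}\,dx^1\wedge\dots\wedge dx^m$, the volume element of $g$, $E$ is variational if and only if (I) holds and ${}^M\Gamma^l_{ij}={}^M\bar\Gamma^l_{ij}+S^l_{ij}$,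 where ${}^M\bar\Gamma$ are the components of the Levi-Civita connection of $g$ and the tensor $S$ satisfies $$h_{\mu\nu}\,g^{ij}S^l_{ij}=-h_{\mu\nu,p}\,g^{lp}\quad\text{for all }\mu,\nu,l,$$ and hence also, by contraction, $$g^{ij}S^l_{ij}=-\tfrac1n\,h^{\mu\nu}h_{\mu\nu,p}\,g^{lp}.$$ -/

import Mathlib

open scoped ContDiff

noncomputable section

namespace GeodesicInverse

/-- Points of a coordinate space `ℝᵏ`. -/
abbrev Coord (k : ℕ) : Type := Fin k → ℝ

/-- The partial derivative `∂f/∂xⁱ`. -/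
def pd {k : ℕ} (i : Fin k) (f : Coord k → ℝ) (x : Coord k) : ℝ :=
  fderiv ℝ f x (Pi.single i 1)

/-- The iterated partial derivative `∂ᵏf/∂x^{p₁}⋯∂x^{p_k}`. -/
def iteratedPd {m k : ℕ} {F : Type} [NormedAddCommGroup F] [NormedSpace ℝ F]
    (p : Fin k → Fin m) (f : Coord m → F) (x : Coord m) : F :=
  iteratedFDeriv ℝ k f x (fun a => Pi.single (p a) 1)

/-- Components `Γ x l i j = Γˡᵢⱼ(x)` of an affine connection in a chart. -/
abbrev Connection (k : ℕ) : Type := Coord k → Fin k → Fin k → Fin k → ℝ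

/-- Smooth components on `U`, symmetric in the lower indices (no torsion). -/
def Connection.IsSmoothSymmetric {k : ℕ} (Γ : Connection k) (U : Set (Coord k)) : Prop :=
  (∀ l i j, ContDiffOn ℝ ∞ (fun x => Γ x l i j) U) ∧ ∀ x ∈ U, ∀ l i j, Γ x l i j = Γ x l j i

/-- The Christoffel symbols of the Levi-Civita connection of the metric with covariant
components `h`: `Γˡᵢⱼ = ½ hˡᵖ (∂ᵢ hₚⱼ + ∂ⱼ hₚᵢ - ∂ₚ hᵢⱼ)`. -/
def leviCivita {k : ℕ} (h : Coord k → Matrix (Fin k) (Fin k) ℝ) : Connection k :=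
  fun x l i j => (1 / 2) * ∑ p, (h x)⁻¹ l p *
    (pd i (fun x' => h x' p j) x + pd j (fun x' => h x' p i) x - pd p (fun x' => h x' i j) x)

/-- The curvature `R^β_{λνα} = ∂_ν Γ^β_{αλ} - ∂_α Γ^β_{νλ} + Γ^β_{νκ} Γ^κ_{αλ} - Γ^β_{ακ} Γ^κ_{νλ}`,
written `curvature Γ y β lam ν α`. -/
def curvature {k : ℕ} (Γ : Connection k) (y : Coord k) (β lam ν α : Fin k) : ℝ :=
  pd ν (fun y' => Γ y' β α lam) y - pd α (fun y' => Γ y' β ν lam) y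
    + ∑ κ, (Γ y β ν κ * Γ y κ α lam - Γ y β α κ * Γ y κ ν lam)

/-! ### Jets of local sections of `U × V → U` -/

/-- `φ` is (the fibre part of) a smooth local section over the open set `Ω` with graph in `W`. -/
def IsSection {m n : ℕ} (W : Set (Coord m × Coord n)) (Ω : Set (Coord m))
    (φ : Coord m → Coord n) : Prop :=
  IsOpen Ω ∧ ContDiffOn ℝ ∞ φ Ω ∧ ∀ x ∈ Ω, (x, φ x) ∈ W

/-- Real functions of the second-order jet coordinates `(xⁱ, φ^σ, φ^σ_i, φ^σ_{ij})`. -/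
abbrev JetFun (m n : ℕ) : Type :=
  Coord m → Coord n → (Fin n → Fin m → ℝ) → (Fin n → Fin m → Fin m → ℝ) → ℝ

/-- The composite of `F` with the second jet prolongation of `φ`. -/
def JetFun.along {m n : ℕ} (F : JetFun m n) (φ : Coord m → Coord n) (x : Coord m) : ℝ :=
  F x (φ x) (fun σ i => pd i (fun x' => φ x' σ) x)
    (fun σ i j => pd j (pd i (fun x' => φ x' σ)) x)

/-- `∂F/∂φ^μ`. -/
def JetFun.dY {m n : ℕ} (μ : Fin n) (F : JetFun m n) : JetFun m n :=
  fun x y z w => pd μ (fun y' => F x y' z w) y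

/-- `∂F/∂φ^μ_l`. -/
def JetFun.dZ {m n : ℕ} (μ : Fin n) (l : Fin m) (F : JetFun m n) : JetFun m n :=
  fun x y z w => fderiv ℝ (fun z' => F x y z' w) z (Pi.single μ (Pi.single l 1))

/-- `∂F/∂φ^μ_{lp}`, with the usual convention for the symmetric coordinates `φ^μ_{lp} = φ^μ_{pl}`,
`∂φ^σ_{ij}/∂φ^μ_{lp} = ½ δ^σ_μ (δ^l_i δ^p_j + δ^p_i δ^l_j)`. -/
def JetFun.dW {m n : ℕ} (μ : Fin n) (l p : Fin m) (F : JetFun m n) : JetFun m n :=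
  fun x y z w => fderiv ℝ (fun w' => F x y z w') w
    (Pi.single μ ((1 / 2 : ℝ) • (Pi.single l (Pi.single p 1) + Pi.single p (Pi.single l 1))))

/-- The components `ε_ν` of a second-order dynamical form
`ε_ν ω^ν ∧ dx¹ ∧ ⋯ ∧ dxᵐ`, where `ω^ν = dφ^ν - φ^ν_i dxⁱ`. -/
abbrev DynForm (m n : ℕ) : Type := Fin n → JetFun m n

/-! ### Helmholtz conditions

The total derivative `d_p F` is characterised by `(d_p F) ∘ jφ = ∂_p (F ∘ jφ)` for all sections
`φ`; every jet is the jet of a section, so the identities are written along sections. -/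

/-- `∂ε_ν/∂φ^μ_{lp} - ∂ε_μ/∂φ^ν_{lp} = 0`. -/
def Helmholtz1 {m n : ℕ} (W : Set (Coord m × Coord n)) (ε : DynForm m n) : Prop :=
  ∀ Ω φ, IsSection W Ω φ → ∀ x ∈ Ω, ∀ (μ ν : Fin n) (l p : Fin m),
    ((ε ν).dW μ l p).along φ x - ((ε μ).dW ν l p).along φ x = 0

/-- `∂ε_ν/∂φ^μ_l + ∂ε_μ/∂φ^ν_l - 2 d_p ∂ε_μ/∂φ^ν_{lp} = 0`. -/
def Helmholtz2 {m n : ℕ} (W : Set (Coord m × Coord n)) (ε : DynForm m n) : Prop :=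
  ∀ Ω φ, IsSection W Ω φ → ∀ x ∈ Ω, ∀ (μ ν : Fin n) (l : Fin m),
    ((ε ν).dZ μ l).along φ x + ((ε μ).dZ ν l).along φ x
      - 2 * ∑ p, pd p (((ε μ).dW ν l p).along φ) x = 0

/-- `∂ε_ν/∂φ^μ - ∂ε_μ/∂φ^ν + d_l ∂ε_μ/∂φ^ν_l - d_l d_p ∂ε_μ/∂φ^ν_{lp} = 0`. -/
def Helmholtz3 {m n : ℕ} (W : Set (Coord m × Coord n)) (ε : DynForm m n) : Prop :=
  ∀ Ω φ, IsSection W Ω φ → ∀ x ∈ Ω, ∀ (μ ν : Fin n),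
    ((ε ν).dY μ).along φ x - ((ε μ).dY ν).along φ x
      + ∑ l, pd l (((ε μ).dZ ν l).along φ) x
      - ∑ l, ∑ p, pd l (pd p (((ε μ).dW ν l p).along φ)) x = 0

/-! ### Variational forms -/

/-- Fibre coordinates `φ^σ_{p₁…p_k}`, `0 ≤ k ≤ r`, of jets of order `r`. -/
abbrev JetFibre (r m n : ℕ) : Type := ∀ k : Fin (r + 1), (Fin (k : ℕ) → Fin m) → Coord n

/-- The `r`-jet of `φ` at `x`. -/
def jet {m n : ℕ} (r : ℕ) (φ : Coord m → Coord n) (x : Coord m) : JetFibre r m n :=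
  fun k p => iteratedPd p φ x

/-- The Euler-Lagrange expression
`∑_{k ≤ r} (-1)ᵏ ∑_{p₁,…,p_k} d_{p₁}⋯d_{p_k} (∂L/∂φ^ν_{p₁…p_k})` of the Lagrangian
`L dx¹ ∧ ⋯ ∧ dxᵐ` of order `r`, along `φ`. The coordinates with permuted indices are treated as
independent; as the sum runs over all ordered tuples, only the restriction of `L` to symmetric
jets matters. -/
def eulerLagrange {m n r : ℕ} (L : Coord m → JetFibre r m n → ℝ) (φ : Coord m → Coord n)
    (ν : Fin n) (x : Coord m) : ℝ :=
  ∑ k : Fin (r + 1), (-1 : ℝ) ^ (k : ℕ) * ∑ p : Fin k → Fin m,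
    iteratedPd p (fun x' => fderiv ℝ (L x') (jet r φ x')
      (Pi.single k (Pi.single p (Pi.single ν 1)))) x

/-- `ε` is variational over the open set `W₀`: in a neighbourhood `W` of every point it is the
Euler-Lagrange form of a smooth Lagrangian of some finite order. -/
def IsVariational {m n : ℕ} (W₀ : Set (Coord m × Coord n)) (ε : DynForm m n) : Prop :=
  ∀ w ∈ W₀, ∃ W : Set (Coord m × Coord n), IsOpen W ∧ w ∈ W ∧ W ⊆ W₀ ∧
    ∃ (r : ℕ) (L : Coord m → JetFibre r m n → ℝ),
      ContDiffOn ℝ ∞ (fun q : Coord m × JetFibre r m n => L q.1 q.2)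
        {q | (q.1, q.2 0 (fun a => Fin.elim0 a)) ∈ W} ∧
      ∀ Ω φ, IsSection W Ω φ → ∀ x ∈ Ω, ∀ ν, (ε ν).along φ x = eulerLagrange L φ ν x

/-! ### The equations of geodesic mappings and multipliers -/

/-- `φ^σ_{ij} - ᴹΓᵏᵢⱼ φ^σ_k + ᴺΓ^σ_{αλ} φ^α_i φ^λ_j`, the left-hand side of the equations of
geodesic mappings. -/
def geodesicExpr {m n : ℕ} (ΓM : Connection m) (ΓN : Connection n) (σ : Fin n) (i j : Fin m) :
    JetFun m n :=
  fun x y z w => w σ i j - ∑ k, ΓM x k i j * z σ k + ∑ α, ∑ lam, ΓN y σ α lam * z α i * z lam j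

/-- Multipliers `B x y i j σ ν = B^{ij}_{σν}(x, φ)`. -/
abbrev Multiplier (m n : ℕ) : Type :=
  Coord m → Coord n → Fin m → Fin m → Fin n → Fin n → ℝ

/-- The components, with respect to `ω^ν ∧ dx¹ ∧ ⋯ ∧ dxᵐ`, of the dynamical form
`E_ν ω^ν ∧ ω₀`, `E_ν = B^{ij}_{σν} (φ^σ_{ij} - ᴹΓᵏᵢⱼ φ^σ_k + ᴺΓ^σ_{αλ} φ^α_i φ^λ_j)`, for the
volume element `ω₀ = ρ dx¹ ∧ ⋯ ∧ dxᵐ`. -/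
def dynForm {m n : ℕ} (ρ : Coord m → ℝ) (B : Multiplier m n) (ΓM : Connection m)
    (ΓN : Connection n) : DynForm m n :=
  fun ν x y z w => ρ x * ∑ i, ∑ j, ∑ σ, B x y i j σ ν * geodesicExpr ΓM ΓN σ i j x y z w

/-- Smooth on `U × V`, symmetric in the upper indices. -/
def Multiplier.IsAdmissible {m n : ℕ} (B : Multiplier m n) (U : Set (Coord m))
    (V : Set (Coord n)) : Prop :=
  (∀ i j σ ν, ContDiffOn ℝ ∞ (fun q : Coord m × Coord n => B q.1 q.2 i j σ ν) (U ×ˢ V)) ∧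
  ∀ x ∈ U, ∀ y ∈ V, ∀ i j σ ν, B x y i j σ ν = B x y j i σ ν

/-- `B^{ij}_{σν} = B^{ij}_{νσ}`. -/
def Multiplier.LowerSymm {m n : ℕ} (B : Multiplier m n) (U : Set (Coord m))
    (V : Set (Coord n)) : Prop :=
  ∀ x ∈ U, ∀ y ∈ V, ∀ i j σ ν, B x y i j σ ν = B x y i j ν σ

/-- `∂B^{ij}_{σν}/∂xᵖ`. -/
def Multiplier.dx {m n : ℕ} (p : Fin m) (B : Multiplier m n) : Multiplier m n :=
  fun x y i j σ ν => pd p (fun x' => B x' y i j σ ν) x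

/-- `∂B^{ij}_{σν}/∂φ^λ`. -/
def Multiplier.dφ {m n : ℕ} (lam : Fin n) (B : Multiplier m n) : Multiplier m n :=
  fun x y i j σ ν => pd lam (fun y' => B x y' i j σ ν) y

/-- `-B^{ij}_{μν} ᴹΓˡᵢⱼ = ∂B^{lp}_{μν}/∂xᵖ`. -/
def HP21 {m n : ℕ} (U : Set (Coord m)) (V : Set (Coord n)) (B : Multiplier m n)
    (ΓM : Connection m) : Prop :=
  ∀ x ∈ U, ∀ y ∈ V, ∀ (μ ν : Fin n) (l : Fin m),
    -∑ i, ∑ j, B x y i j μ ν * ΓM x l i j = ∑ p, B.dx p x y l p μ ν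

/-- `ᴺΓ^σ_{μλ} B^{ij}_{σν} + ᴺΓ^σ_{νλ} B^{ij}_{σμ} = ∂B^{ij}_{μν}/∂φ^λ`. -/
def HP22 {m n : ℕ} (U : Set (Coord m)) (V : Set (Coord n)) (B : Multiplier m n)
    (ΓN : Connection n) : Prop :=
  ∀ x ∈ U, ∀ y ∈ V, ∀ (i j : Fin m) (μ ν lam : Fin n),
    ∑ σ, ΓN y σ μ lam * B x y i j σ ν + ∑ σ, ΓN y σ ν lam * B x y i j σ μ = B.dφ lam x y i j μ ν

/-- `∂_ν B^{ij}_{σμ} - ∂_μ B^{ij}_{σν} - ∂_σ B^{ij}_{μν} + B^{ij}_{αν} ᴺΓ^α_{μσ}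
+ B^{ij}_{αν} ᴺΓ^α_{σμ}`. -/
def coeff31 {m n : ℕ} (B : Multiplier m n) (ΓN : Connection n) (x : Coord m) (y : Coord n)
    (i j : Fin m) (μ ν σ : Fin n) : ℝ :=
  B.dφ ν x y i j σ μ - B.dφ μ x y i j σ ν - B.dφ σ x y i j μ ν
    + ∑ α, B x y i j α ν * ΓN y α μ σ + ∑ α, B x y i j α ν * ΓN y α σ μ

/-- `∂_ν(B^{ij}_{σμ}) Γ^σ_{αλ} + B^{ij}_{σμ} ∂_ν Γ^σ_{αλ} - ∂_μ(B^{ij}_{σν}) Γ^σ_{αλ}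
- B^{ij}_{σν} ∂_μ Γ^σ_{αλ} + ∂_α(B^{ij}_{σν}) Γ^σ_{μλ} + B^{ij}_{σν} ∂_α Γ^σ_{μλ}
+ ∂_λ(B^{ij}_{σν}) Γ^σ_{αμ} + B^{ij}_{σν} ∂_λ Γ^σ_{αμ} - ∂_λ ∂_α B^{ij}_{μν}`, with `Γ = ᴺΓ`. -/
def coeff32 {m n : ℕ} (B : Multiplier m n) (ΓN : Connection n) (x : Coord m) (y : Coord n)
    (i j : Fin m) (μ ν α lam : Fin n) : ℝ :=
  ∑ σ, (B.dφ ν x y i j σ μ * ΓN y σ α lam + B x y i j σ μ * pd ν (fun y' => ΓN y' σ α lam) y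
      - B.dφ μ x y i j σ ν * ΓN y σ α lam - B x y i j σ ν * pd μ (fun y' => ΓN y' σ α lam) y
      + B.dφ α x y i j σ ν * ΓN y σ μ lam + B x y i j σ ν * pd α (fun y' => ΓN y' σ μ lam) y
      + B.dφ lam x y i j σ ν * ΓN y σ α μ + B x y i j σ ν * pd lam (fun y' => ΓN y' σ α μ) y)
    - (B.dφ α).dφ lam x y i j μ ν

/-- `ᴹΓᵏᵢⱼ (∂_μ B^{ij}_{σν} - ∂_ν B^{ij}_{σμ} - ∂_σ B^{ij}_{μν}) + 2 ∂_l(B^{lk}_{λν}) ᴺΓ^λ_{μσ}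
- 2 ∂_p ∂_σ B^{kp}_{μν}`. -/
def coeff33 {m n : ℕ} (B : Multiplier m n) (ΓM : Connection m) (ΓN : Connection n)
    (x : Coord m) (y : Coord n) (k : Fin m) (μ ν σ : Fin n) : ℝ :=
  ∑ i, ∑ j, ΓM x k i j *
      (B.dφ μ x y i j σ ν - B.dφ ν x y i j σ μ - B.dφ σ x y i j μ ν)
    + 2 * ∑ l, ∑ lam, B.dx l x y l k lam ν * ΓN y lam μ σ
    - 2 * ∑ p, (B.dφ σ).dx p x y k p μ ν

/-- `-∂_l(B^{ij}_{μν}) ᴹΓˡᵢⱼ - B^{ij}_{μν} ∂_l ᴹΓˡᵢⱼ - ∂_l ∂_p B^{lp}_{μν}`. -/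
def coeff34 {m n : ℕ} (B : Multiplier m n) (ΓM : Connection m)
    (x : Coord m) (y : Coord n) (μ ν : Fin n) : ℝ :=
  -∑ l, ∑ i, ∑ j, B.dx l x y i j μ ν * ΓM x l i j
    - ∑ l, ∑ i, ∑ j, B x y i j μ ν * pd l (fun x' => ΓM x' l i j) x
    - ∑ l, ∑ p, (B.dx p).dx l x y l p μ ν

/-! ### Separated multipliers -/

/-- The multiplier `g ⊗ h`, `B^{ij}_{σν} = g^{ij}(x) h_{σν}(x, φ)`; `g` is given by its
contravariant components, `h` by its covariant ones. -/
def tensorMult {m n : ℕ} (g : Coord m → Matrix (Fin m) (Fin m) ℝ)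
    (h : Coord m → Coord n → Matrix (Fin n) (Fin n) ℝ) : Multiplier m n :=
  fun x y i j σ ν => g x i j * h x y σ ν

/-- `√|det (g_{ij})|`, the density of the volume element of the metric with contravariant
components `g`. -/
def volDensity {m : ℕ} (g : Coord m → Matrix (Fin m) (Fin m) ℝ) (x : Coord m) : ℝ :=
  √|((g x)⁻¹).det|

/-- `ᴺ∇` is fibrewise induced by `h`: on every fibre `{x} × V`, `h(x, ·)` is symmetric (hence, being
regular, a metric) and `ᴺ∇` is its Levi-Civita connection. -/
def FibrewiseInduced {m n : ℕ} (U : Set (Coord m)) (V : Set (Coord n))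
    (h : Coord m → Coord n → Matrix (Fin n) (Fin n) ℝ) (ΓN : Connection n) : Prop :=
  ∀ x ∈ U, ∀ y ∈ V, (∀ μ ν, h x y μ ν = h x y ν μ) ∧
    ∀ σ α lam, ΓN y σ α lam = leviCivita (h x) y σ α lam

end GeodesicInverse

end

noncomputable section

namespace GeodesicInverse

open Filter Topology Set MeasureTheory


/-! ### Calculus of partial derivatives -/

/-! Necessity rests on the symmetry of the second variation. If `ε` consists of the Euler–Lagrange
expressions of `L`, then by repeated integration by parts the integral of `ε_ν(φ) ζ^ν` is the first
variation of the action in the direction of a compactly supported `ζ`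
(`integral_eulerLagrange_mul`). Differentiating once more along `φ + sη` produces the second
derivative of `L`, which does not distinguish `η` from `ζ`. Hence the linearization of `ε` along
every section is formally self-adjoint (`integral_lin_comm`). Comparing the second- and first-order
coefficients of this operator with those of its adjoint gives the first two Helmholtz conditions,
whatever the order of `L` (`coeff_eq_of_adjoint`, `IsVariational.helmholtz`).

For the geodesic form these conditions are polynomial in the jet coordinates. Every symmetric
second-order jet over `U × V` is the jet of a quadratic polynomial section (`exists_isSection_jet`),
so the coefficients vanish separately. The first condition becomes the lower symmetry of `B`; the
constant and linear parts of the second become `HP21` and `HP22`.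

Sufficiency needs no homotopy construction: under these three conditions the quadratic first-order
Lagrangian `-½ B^{ij}_{στ} φ^σ_i φ^τ_j` has the given form as its Euler–Lagrange form
(`isVariational_of_symm_of_HP`). `HP21` matches the terms linear in the velocities. For the
quadratic terms, `HP22` says that for fixed `x`, `i`, `j` the symmetric tensor `B^{ij}` is parallel
for the connection on `V`, and the Koszul formula expresses `B^{ij}_{σν} Γ^σ_{αλ}` by derivatives of
`B`. The Koszul formula holds for degenerate `B` too.

The third Helmholtz condition is therefore a consequence. Its coefficient `P` is the Koszul formula
again. `T` is a divergence of `HP21`, and `W` combines `HP21` with its fibre derivative. `Q` is the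
defect of pair symmetry of the curvature lowered by the parallel tensor `B^{ij}`, and this vanishes
as in Riemannian geometry (`sum_mul_curvature_symm`).

For `B = g ⊗ h`, some entry of `g` is nonzero, so `h` itself is symmetric and parallel; being
regular, it determines the connection as its Levi-Civita connection. The volume density `ρ` of `g`
is absorbed into `g`, and the classical identity `∂_p(ρ g^{lp}) = -ρ g^{ij} Γ̄^l_{ij}`
(`sum_pd_volDensity_mul`) turns the divergence condition into the one on the difference tensor `S`.
-/

theorem _root_.ContDiffOn.differentiableAt_of_isOpen {E F : Type*} [NormedAddCommGroup E]
    [NormedSpace ℝ E] [NormedAddCommGroup F] [NormedSpace ℝ F] {f : E → F} {s : Set E}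
    (hf : ContDiffOn ℝ ∞ f s) (hs : IsOpen s) {x : E} (hx : x ∈ s) : DifferentiableAt ℝ f x :=
  (hf.contDiffAt (hs.mem_nhds hx)).differentiableAt (by simp)

section pd

variable {k : ℕ} {f g : Coord k → ℝ} {x : Coord k} {s : Set (Coord k)} (i j : Fin k)

theorem pd_congr (h : f =ᶠ[𝓝 x] g) : pd i f x = pd i g x := by
  simp only [pd, h.fderiv_eq]

theorem pd_congr_of_eqOn (hs : IsOpen s) (hx : x ∈ s) (h : EqOn f g s) : pd i f x = pd i g x :=
  pd_congr i (h.eventuallyEq_of_mem (hs.mem_nhds hx))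

theorem pd_const (c : ℝ) : pd i (fun _ => c) x = 0 := by
  simp [pd]

theorem pd_add (hf : DifferentiableAt ℝ f x) (hg : DifferentiableAt ℝ g x) :
    pd i (fun x => f x + g x) x = pd i f x + pd i g x := by
  simp [pd, fderiv_fun_add hf hg]

theorem pd_sub (hf : DifferentiableAt ℝ f x) (hg : DifferentiableAt ℝ g x) :
    pd i (fun x => f x - g x) x = pd i f x - pd i g x := by
  simp [pd, fderiv_fun_sub hf hg]

theorem pd_neg : pd i (fun x => -f x) x = -pd i f x := by
  simp [pd, fderiv_fun_neg]

theorem pd_mul (hf : DifferentiableAt ℝ f x) (hg : DifferentiableAt ℝ g x) :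
    pd i (fun x => f x * g x) x = pd i f x * g x + f x * pd i g x := by
  simp [pd, fderiv_fun_mul hf hg]; ring

theorem pd_const_mul (c : ℝ) (hf : DifferentiableAt ℝ f x) :
    pd i (fun x => c * f x) x = c * pd i f x := by
  rw [pd_mul i (differentiableAt_const c) hf, pd_const]; ring

theorem pd_sum {ι : Type*} {u : Finset ι} {f : ι → Coord k → ℝ}
    (hf : ∀ a ∈ u, DifferentiableAt ℝ (f a) x) :
    pd i (fun x => ∑ a ∈ u, f a x) x = ∑ a ∈ u, pd i (f a) x := by
  simp [pd, fderiv_fun_sum hf]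

theorem _root_.ContDiffOn.pd (hf : ContDiffOn ℝ ∞ f s) (hs : IsOpen s) :
    ContDiffOn ℝ ∞ (pd i f) s :=
  (hf.fderiv_of_isOpen hs (m := ∞) (by simp)).clm_apply contDiffOn_const

theorem pd_comm (hf : ContDiffAt ℝ ∞ f x) : pd i (pd j f) x = pd j (pd i f) x := by
  have h := hf.isSymmSndFDerivAt (by simp; exact ENat.LEInfty.out)
  have hd : DifferentiableAt ℝ (fderiv ℝ f) x :=
    (hf.fderiv_right (m := ∞) (by simp)).differentiableAt (by simp)
  have key : ∀ v w : Coord k,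
      fderiv ℝ (fun y => fderiv ℝ f y v) x w = fderiv ℝ (fderiv ℝ f) x w v := by
    intro v w
    rw [fderiv_clm_apply hd (differentiableAt_const v)]
    simp
  unfold pd
  rw [key, key]
  exact h _ _

theorem pd_coord (a : Fin k) : pd i (fun x : Coord k => x a) x = if a = i then 1 else 0 := by
  have : HasFDerivAt (fun x : Coord k => x a) (ContinuousLinearMap.proj (R := ℝ) (φ := fun _ : Fin k => ℝ) a) x :=
    (ContinuousLinearMap.proj (R := ℝ) (φ := fun _ : Fin k => ℝ) a).hasFDerivAt
  simp [pd, this.fderiv, Pi.single_apply]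

/-- Chain rule for the restriction of a function on `ℝᵏ × ℝⁿ` to a graph. -/
theorem pd_comp_graph {n : ℕ} {F : Coord k × Coord n → ℝ} {φ : Coord k → Coord n}
    (hF : DifferentiableAt ℝ F (x, φ x)) (hφ : DifferentiableAt ℝ φ x) :
    pd i (fun x' => F (x', φ x')) x =
      pd i (fun x' => F (x', φ x)) x +
        ∑ a, pd a (fun y => F (x, y)) (φ x) * pd i (fun x' => φ x' a) x := by
  have h1 : HasFDerivAt (fun x' => F (x', φ x'))
      ((fderiv ℝ F (x, φ x)).comp ((ContinuousLinearMap.id ℝ _).prod (fderiv ℝ φ x))) x :=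
    hF.hasFDerivAt.comp x ((hasFDerivAt_id x).prodMk hφ.hasFDerivAt)
  have h2 : HasFDerivAt (fun x' => F (x', φ x))
      ((fderiv ℝ F (x, φ x)).comp ((ContinuousLinearMap.id ℝ _).prod 0)) x :=
    HasFDerivAt.comp (g := F) (f := fun x' => (x', φ x)) x hF.hasFDerivAt
      ((hasFDerivAt_id x).prodMk (hasFDerivAt_const (φ x) x))
  have h3 : HasFDerivAt (fun y => F (x, y))
      ((fderiv ℝ F (x, φ x)).comp ((0 : Coord n →L[ℝ] Coord k).prod
        (ContinuousLinearMap.id ℝ _))) (φ x) :=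
    HasFDerivAt.comp (g := F) (f := fun y => (x, y)) (φ x) hF.hasFDerivAt
      ((hasFDerivAt_const x (φ x)).prodMk (hasFDerivAt_id (φ x)))
  have h4 : ∀ a, pd i (fun x' => φ x' a) x = fderiv ℝ φ x (Pi.single i 1) a := by
    intro a
    have := hasFDerivAt_pi'.1 hφ.hasFDerivAt a
    simp [pd, this.fderiv]
  simp only [h4]
  simp only [pd, h1.fderiv, h2.fderiv, h3.fderiv]
  simp only [ContinuousLinearMap.comp_apply, ContinuousLinearMap.prod_apply,
    ContinuousLinearMap.id_apply, _root_.zero_apply]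
  set v := fderiv ℝ φ x (Pi.single i 1)
  -- The tangent vector of the graph splits into a base direction and a combination of fibre
  -- directions.
  have hv : (Pi.single i (1 : ℝ), v) =
      ((Pi.single i (1 : ℝ), 0) : Coord k × Coord n) +
        ∑ a, v a • ((0 : Coord k), (Pi.single a (1 : ℝ) : Coord n)) := by
    ext b
    · simp [Prod.fst_sum]
    · simp [Prod.snd_sum, Pi.single_apply]
  rw [hv, map_add, map_sum]
  simp only [map_smul, smul_eq_mul, mul_comm]

end pd

/-! ### Iterated partial derivatives -/

section iteratedPd

variable {m : ℕ} {Ω : Set (Coord m)}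

theorem iteratedPd_zero {F : Type} [NormedAddCommGroup F] [NormedSpace ℝ F]
    (p : Fin 0 → Fin m) (f : Coord m → F) (x : Coord m) : iteratedPd p f x = f x := by
  simp [iteratedPd]

theorem _root_.ContDiffOn.iteratedPd {F : Type} [NormedAddCommGroup F] [NormedSpace ℝ F]
    {f : Coord m → F} (hf : ContDiffOn ℝ ∞ f Ω) (hΩ : IsOpen Ω)
    {k : ℕ} (p : Fin k → Fin m) : ContDiffOn ℝ ∞ (iteratedPd p f) Ω := by
  have h : ContDiffOn ℝ ∞ (iteratedFDeriv ℝ k f) Ω := by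
    intro x hx
    refine (ContDiffAt.iteratedFDeriv_right (m := ∞) (i := k)
      (hf.contDiffAt (hΩ.mem_nhds hx)) ?_).contDiffWithinAt
    exact_mod_cast le_top
  intro x hx
  exact ((ContinuousMultilinearMap.apply ℝ (fun _ : Fin k => Coord m) F
    (fun a => Pi.single (p a) 1)).contDiff.comp_contDiffWithinAt (h x hx))

theorem iteratedPd_succ {f : Coord m → ℝ} (hf : ContDiffOn ℝ ∞ f Ω) (hΩ : IsOpen Ω)
    {k : ℕ} (p : Fin (k + 1) → Fin m) {x : Coord m} (hx : x ∈ Ω) :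
    iteratedPd p f x = pd (p 0) (iteratedPd (Fin.tail p) f) x := by
  have h : DifferentiableAt ℝ (iteratedFDeriv ℝ k f) x :=
    (ContDiffAt.iteratedFDeriv_right (m := ∞) (i := k)
      (hf.contDiffAt (hΩ.mem_nhds hx)) (by exact_mod_cast le_top)).differentiableAt (by simp)
  exact h.iteratedFDeriv_succ_apply_left'

theorem iteratedPd_congr {F : Type} [NormedAddCommGroup F] [NormedSpace ℝ F]
    {f g : Coord m → F} {x : Coord m} (h : f =ᶠ[𝓝 x] g) {k : ℕ} (p : Fin k → Fin m) :
    iteratedPd p f x = iteratedPd p g x := by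
  simp only [iteratedPd, (h.iteratedFDeriv ℝ k).eq_of_nhds]

/-- Schwarz's theorem, applied one index at a time. It is needed because integration by parts
removes the outermost derivative of one factor and attaches it as the innermost derivative of the
other. -/
theorem iteratedPd_pd {f : Coord m → ℝ} (hf : ContDiffOn ℝ ∞ f Ω) (hΩ : IsOpen Ω)
    (i : Fin m) {k : ℕ} (p : Fin k → Fin m) {x : Coord m} (hx : x ∈ Ω) :
    iteratedPd p (pd i f) x = pd i (iteratedPd p f) x := by
  induction k generalizing x with
  | zero =>
    rw [iteratedPd_zero]
    exact pd_congr i (Eventually.of_forall fun y => (iteratedPd_zero p f y).symm)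
  | succ k ih =>
    rw [iteratedPd_succ (hf.pd i hΩ) hΩ p hx,
      pd_congr_of_eqOn (p 0) hΩ hx (fun y hy => ih (Fin.tail p) hy),
      pd_comm _ _ ((hf.iteratedPd hΩ _).contDiffAt (hΩ.mem_nhds hx))]
    exact pd_congr_of_eqOn i hΩ hx (fun y hy => (iteratedPd_succ hf hΩ p hy).symm)

theorem iteratedPd_apply {n : ℕ} {φ : Coord m → Coord n} (hφ : ContDiffOn ℝ ∞ φ Ω)
    (hΩ : IsOpen Ω) {k : ℕ} (p : Fin k → Fin m) {x : Coord m} (hx : x ∈ Ω) (ν : Fin n) :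
    iteratedPd p φ x ν = iteratedPd p (fun x => φ x ν) x := by
  have := (ContinuousLinearMap.proj (R := ℝ) (φ := fun _ : Fin n => ℝ) ν).iteratedFDeriv_comp_left
    (hφ.contDiffAt (hΩ.mem_nhds hx)) (i := k) (by exact_mod_cast le_top)
  have h2 := congrArg (fun M => M (fun a => Pi.single (p a) 1)) this
  exact h2.symm

theorem iteratedPd_add_const_mul {n : ℕ} {φ η : Coord m → Coord n} (hφ : ContDiffOn ℝ ∞ φ Ω)
    (hη : ContDiff ℝ ∞ η) (hΩ : IsOpen Ω) (s : ℝ) {k : ℕ} (p : Fin k → Fin m)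
    {x : Coord m} (hx : x ∈ Ω) :
    iteratedPd p (fun x => φ x + s • η x) x = iteratedPd p φ x + s • iteratedPd p η x := by
  have h1 : ContDiffAt ℝ k φ x :=
    (hφ.contDiffAt (hΩ.mem_nhds hx)).of_le (by exact_mod_cast le_top)
  have h2 : ContDiffAt ℝ k η x := hη.contDiffAt.of_le (by exact_mod_cast le_top)
  have := iteratedFDeriv_add_apply (f := φ) (g := s • η) h1 (h2.const_smul s)
  rw [iteratedFDeriv_const_smul_apply h2] at this
  have h2 := congrArg (fun M => M (fun a => Pi.single (p a) 1)) this
  exact h2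

end iteratedPd


/-! ### Integrals of compactly supported functions -/

/-- Off the support of `ζ` the product vanishes, so the uncontrolled values of `F` outside `Ω` do no
harm. All integrals can thus be taken over the whole coordinate space. -/
theorem continuous_mul_of_tsupport_subset {E : Type*} [TopologicalSpace E] {Ω : Set E}
    (hΩ : IsOpen Ω) {F ζ : E → ℝ} (hF : ContinuousOn F Ω) (hζ : Continuous ζ)
    (hsub : tsupport ζ ⊆ Ω) : Continuous fun x => F x * ζ x := by
  refine continuous_of_tsupport fun x hx => ?_
  have : x ∈ tsupport ζ := closure_mono (Function.support_mul_subset_right F ζ) hx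
  exact (hF.continuousAt (hΩ.mem_nhds (hsub this))).mul hζ.continuousAt

theorem integrable_mul_of_tsupport_subset {m : ℕ} {Ω : Set (Coord m)}
    (hΩ : IsOpen Ω) {F ζ : Coord m → ℝ} (hF : ContinuousOn F Ω) (hζ : Continuous ζ)
    (hc : HasCompactSupport ζ) (hsub : tsupport ζ ⊆ Ω) : Integrable fun x => F x * ζ x :=
  (continuous_mul_of_tsupport_subset hΩ hF hζ hsub).integrable_of_hasCompactSupport hc.mul_left

section IntegrationByParts

variable {m : ℕ} {Ω : Set (Coord m)}

theorem tsupport_pd_subset (i : Fin m) (ζ : Coord m → ℝ) : tsupport (pd i ζ) ⊆ tsupport ζ :=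
  (tsupport_fderiv_apply_subset ℝ (Pi.single i 1))

theorem _root_.ContDiff.pd {ζ : Coord m → ℝ} (hζ : ContDiff ℝ ∞ ζ) (i : Fin m) :
    ContDiff ℝ ∞ (pd i ζ) :=
  contDiffOn_univ.1 (hζ.contDiffOn.pd i isOpen_univ)

theorem _root_.HasCompactSupport.pd {ζ : Coord m → ℝ} (hc : HasCompactSupport ζ) (i : Fin m) :
    HasCompactSupport (pd i ζ) :=
  hc.of_isClosed_subset (isClosed_tsupport _) (tsupport_pd_subset i ζ)

theorem integral_pd_mul (hΩ : IsOpen Ω) {F ζ : Coord m → ℝ} (hF : ContDiffOn ℝ ∞ F Ω)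
    (hζ : ContDiff ℝ ∞ ζ) (hc : HasCompactSupport ζ) (hsub : tsupport ζ ⊆ Ω) (i : Fin m) :
    ∫ x, pd i F x * ζ x = -∫ x, F x * pd i ζ x := by
  have := integral_mul_fderiv_eq_neg_fderiv_mul_of_integrable (μ := volume)
    (f := F) (g := ζ) (v := Pi.single i 1)
    (integrable_mul_of_tsupport_subset hΩ (hF.pd i hΩ).continuousOn hζ.continuous hc hsub)
    (integrable_mul_of_tsupport_subset hΩ hF.continuousOn (hζ.pd i).continuous (hc.pd i)
      ((tsupport_pd_subset i ζ).trans hsub))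
    (integrable_mul_of_tsupport_subset hΩ hF.continuousOn hζ.continuous hc hsub)
    (fun x hx => hF.differentiableAt_of_isOpen hΩ (hsub hx))
    (fun x _ => hζ.contDiffAt.differentiableAt (by simp))
  simp only [pd] at this ⊢
  rw [this, neg_neg]

theorem integral_iteratedPd_mul (hΩ : IsOpen Ω) {F ζ : Coord m → ℝ} (hF : ContDiffOn ℝ ∞ F Ω)
    (hζ : ContDiff ℝ ∞ ζ) (hc : HasCompactSupport ζ) (hsub : tsupport ζ ⊆ Ω)
    {k : ℕ} (p : Fin k → Fin m) :
    ∫ x, iteratedPd p F x * ζ x = (-1) ^ k * ∫ x, F x * iteratedPd p ζ x := by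
  induction k generalizing ζ with
  | zero => simp [iteratedPd_zero]
  | succ k ih =>
    have h1 : ∀ x, iteratedPd p F x * ζ x = pd (p 0) (iteratedPd (Fin.tail p) F) x * ζ x := by
      intro x
      by_cases hx : x ∈ Ω
      · rw [iteratedPd_succ hF hΩ p hx]
      · rw [image_eq_zero_of_notMem_tsupport fun h => hx (hsub h), mul_zero, mul_zero]
    have h2 : ∀ x, iteratedPd p ζ x = iteratedPd (Fin.tail p) (pd (p 0) ζ) x := by
      intro x
      rw [iteratedPd_succ hζ.contDiffOn isOpen_univ p (mem_univ x),
        iteratedPd_pd hζ.contDiffOn isOpen_univ _ _ (mem_univ x)]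
    simp only [h1, h2]
    rw [integral_pd_mul hΩ (hF.iteratedPd hΩ _) hζ hc hsub,
      ih (hζ.pd _) (hc.pd _) ((tsupport_pd_subset _ ζ).trans hsub)]
    ring

/-- The fundamental lemma of the calculus of variations: testing gives vanishing almost everywhere,
and continuity on the open set upgrades this to every point. -/
theorem eq_zero_of_integral_mul_eq_zero (hΩ : IsOpen Ω) {X : Coord m → ℝ}
    (hX : ContinuousOn X Ω)
    (h : ∀ g : Coord m → ℝ, ContDiff ℝ ∞ g → HasCompactSupport g → tsupport g ⊆ Ω →
      ∫ x, X x * g x = 0) {x : Coord m} (hx : x ∈ Ω) : X x = 0 := by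
  have hae := hΩ.ae_eq_zero_of_integral_contDiff_smul_eq_zero (μ := volume) (f := X)
    (hX.locallyIntegrableOn hΩ.measurableSet) (fun g h1 h2 h3 => by
      simpa only [smul_eq_mul, mul_comm] using h g h1 h2 h3)
  have h0 : X =ᵐ[volume.restrict Ω] fun _ => 0 := by
    rw [EventuallyEq, ae_restrict_iff' hΩ.measurableSet]
    exact hae
  exact Measure.eqOn_open_of_ae_eq h0 hΩ hX continuousOn_const hx

end IntegrationByParts

/-! ### Differentiation under the integral sign -/

section ParametricIntegral

variable {m : ℕ}

theorem integrable_of_continuousOn_of_eq_zero {K : Set (Coord m)} (hK : IsCompact K)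
    {F : Coord m → ℝ} (hF : ContinuousOn F K) (h0 : ∀ x, x ∉ K → F x = 0) : Integrable F := by
  have : K.indicator F = F := by
    ext x
    by_cases hx : x ∈ K <;> simp [hx, h0]
  rw [← this, integrable_indicator_iff hK.measurableSet]
  exact hF.integrableOn_compact hK

/-- Dominated convergence: everything happens on the compact `K`, where the parameter derivative is
bounded uniformly for small `s`. -/
theorem hasDerivAt_integral_of_contDiffOn {K : Set (Coord m)} (hK : IsCompact K)
    {D : Set (ℝ × Coord m)} (hD : IsOpen D) (hKD : ∀ x ∈ K, ((0 : ℝ), x) ∈ D)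
    {G : ℝ × Coord m → ℝ} (hG : ContDiffOn ℝ ∞ G D) (h0 : ∀ s x, x ∉ K → G (s, x) = 0) :
    HasDerivAt (fun s => ∫ x, G (s, x)) (∫ x, deriv (fun s => G (s, x)) 0) 0 := by
  -- The tube lemma supplies one interval of parameters that serves all points of `K` at once.
  obtain ⟨u, v, hu, -, h0u, hKv, huv⟩ := generalized_tube_lemma (isCompact_singleton (x := (0 : ℝ)))
    hK hD (by rintro ⟨s, x⟩ ⟨rfl, hx⟩; exact hKD x hx)
  obtain ⟨r, hr, hru⟩ := Metric.nhds_basis_closedBall.mem_iff.1 (hu.mem_nhds (h0u rfl))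
  have hder : ∀ s ∈ u, ∀ x ∈ K, HasDerivAt (fun s => G (s, x)) (fderiv ℝ G (s, x) (1, 0)) s := by
    intro s hs x hx
    have h1 := (hG.differentiableAt_of_isOpen hD (x := (s, x)) (huv ⟨hs, hKv hx⟩)).hasFDerivAt
    have h2 : HasDerivAt (fun s : ℝ => (s, x)) ((1 : ℝ), (0 : Coord m)) s :=
      (hasDerivAt_id s).prodMk (hasDerivAt_const s x)
    exact h1.comp_hasDerivAt s h2
  have hcont : ContinuousOn (fun q : ℝ × Coord m => fderiv ℝ G q (1, 0)) D :=
    ((hG.fderiv_of_isOpen hD (m := ∞) (by simp)).clm_apply contDiffOn_const).continuousOn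
  have hcK : ∀ s ∈ u, ContinuousOn (fun x => G (s, x)) K := fun s hs =>
    hG.continuousOn.comp (f := fun x : Coord m => (s, x)) (by fun_prop)
      fun x hx => huv ⟨hs, hKv hx⟩
  have hderiv : ∀ s ∈ u, ∀ x ∈ K, deriv (fun s => G (s, x)) s = fderiv ℝ G (s, x) (1, 0) :=
    fun s hs x hx => (hder s hs x hx).deriv
  have hderiv0 : ∀ s, ∀ x, x ∉ K → deriv (fun s => G (s, x)) s = 0 := by
    intro s x hx
    have : (fun s => G (s, x)) = fun _ => 0 := funext fun s => h0 s x hx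
    rw [this, deriv_const]
  obtain ⟨C, hC⟩ := ((isCompact_closedBall (0 : ℝ) r).prod hK).exists_bound_of_continuousOn
    (hcont.mono fun q hq => huv ⟨hru hq.1, hKv hq.2⟩)
  have h0u' : (0 : ℝ) ∈ u := h0u rfl
  refine (hasDerivAt_integral_of_dominated_loc_of_deriv_le (μ := volume)
    (F := fun s x => G (s, x)) (F' := fun s x => deriv (fun s => G (s, x)) s)
    (bound := K.indicator fun _ => C) (Metric.closedBall_mem_nhds (0 : ℝ) hr)
    ?_ ?_ ?_ ?_ ?_ ?_).2
  · filter_upwards [hu.mem_nhds h0u'] with s hs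
    exact (integrable_of_continuousOn_of_eq_zero hK (hcK s hs) (h0 s)).aestronglyMeasurable
  · exact integrable_of_continuousOn_of_eq_zero hK (hcK 0 h0u') (h0 0)
  · refine (integrable_of_continuousOn_of_eq_zero hK ?_ (hderiv0 0)).aestronglyMeasurable
    exact (hcont.comp (f := fun x : Coord m => ((0 : ℝ), x)) (by fun_prop)
      fun x hx => huv ⟨h0u', hKv hx⟩).congr
      fun x hx => hderiv 0 h0u' x hx
  · refine Eventually.of_forall fun x s hs => ?_
    by_cases hx : x ∈ K
    · rw [hderiv s (hru hs) x hx, indicator_of_mem hx]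
      exact hC (s, x) ⟨hs, hx⟩
    · rw [hderiv0 s x hx, indicator_of_notMem hx, norm_zero]
  · rw [integrable_indicator_iff hK.measurableSet]
    exact integrableOn_const hK.measure_lt_top.ne
  · refine Eventually.of_forall fun x s hs => ?_
    by_cases hx : x ∈ K
    · exact hderiv s (hru hs) x hx ▸ hder s (hru hs) x hx
    · have : (fun s => G (s, x)) = fun _ => 0 := funext fun s => h0 s x hx
      rw [this, deriv_const]
      exact hasDerivAt_const s 0

/-- Differentiation of `∫ H(x, j(x) + s k(x)) dx` at `s = 0`. -/
theorem hasDerivAt_integral_comp_add_smul {P : Type*} [NormedAddCommGroup P] [NormedSpace ℝ P]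
    {K Ω : Set (Coord m)} (hK : IsCompact K) (hΩ : IsOpen Ω) (hKΩ : K ⊆ Ω)
    {D : Set (Coord m × P)} (hD : IsOpen D) {H : Coord m → P → ℝ}
    (hH : ContDiffOn ℝ ∞ (fun q : Coord m × P => H q.1 q.2) D) (h0 : ∀ x q, x ∉ K → H x q = 0)
    {j k : Coord m → P} (hj : ContDiffOn ℝ ∞ j Ω) (hk : ContDiffOn ℝ ∞ k Ω)
    (hjD : ∀ x ∈ Ω, (x, j x) ∈ D) :
    HasDerivAt (fun s : ℝ => ∫ x, H x (j x + s • k x)) (∫ x, fderiv ℝ (H x) (j x) (k x)) 0 := by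
  have hmap : ContDiffOn ℝ ∞ (fun q : ℝ × Coord m => (q.2, j q.2 + q.1 • k q.2))
      (univ ×ˢ Ω) :=
    contDiffOn_snd.prodMk ((hj.comp contDiffOn_snd fun q hq => hq.2).add
      (contDiffOn_fst.smul (hk.comp contDiffOn_snd fun q hq => hq.2)))
  have hDo : IsOpen ((univ ×ˢ Ω) ∩
      (fun q : ℝ × Coord m => (q.2, j q.2 + q.1 • k q.2)) ⁻¹' D) :=
    hmap.continuousOn.isOpen_inter_preimage (isOpen_univ.prod hΩ) hD
  have := hasDerivAt_integral_of_contDiffOn hK hDo (G := fun q => H q.2 (j q.2 + q.1 • k q.2))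
    (fun x hx => ⟨⟨mem_univ _, hKΩ hx⟩, by simpa using hjD x (hKΩ hx)⟩)
    (hH.comp (hmap.mono inter_subset_left) fun q hq => hq.2) (fun s x hx => h0 x _ hx)
  convert this using 2
  ext x
  by_cases hx : x ∈ K
  · have h1 : DifferentiableAt ℝ (H x) (j x + (0 : ℝ) • k x) := by
      rw [zero_smul, add_zero]
      exact (hH.differentiableAt_of_isOpen hD (hjD x (hKΩ hx))).comp (f := fun q => (x, q)) (j x)
        (by fun_prop)
    have h2 : HasDerivAt (fun s : ℝ => j x + s • k x) (k x) 0 := by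
      simpa using ((hasDerivAt_id (0 : ℝ)).smul_const (k x)).const_add (j x)
    have h3 := h1.hasFDerivAt.comp_hasDerivAt (0 : ℝ) h2
    have h4 := h3.deriv
    simp only [zero_smul, add_zero] at h4
    exact h4.symm
  · have e1 : H x = fun _ => 0 := funext fun q => h0 x q hx
    simp [e1]

end ParametricIntegral


/-! ### Jets and dynamical forms -/

section Jets

variable {m n : ℕ} {W : Set (Coord m × Coord n)} {Ω : Set (Coord m)}

theorem contDiffOn_apply {φ : Coord m → Coord n} (hφ : ContDiffOn ℝ ∞ φ Ω) (σ : Fin n) :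
    ContDiffOn ℝ ∞ (fun x => φ x σ) Ω :=
  contDiffOn_pi.1 hφ σ

/-- Fibre coordinates of second-order jets. -/
abbrev JetFibre₂ (m n : ℕ) : Type :=
  Coord n × (Fin n → Fin m → ℝ) × (Fin n → Fin m → Fin m → ℝ)

/-- The second-order jet of `φ` at `x`. -/
def jet₂ (φ : Coord m → Coord n) (x : Coord m) : JetFibre₂ m n :=
  (φ x, fun σ i => pd i (fun x' => φ x' σ) x, fun σ i j => pd j (pd i (fun x' => φ x' σ)) x)

/-- `F` as a function on the fibres of the second jet bundle. -/
def JetFun.onFibre (F : JetFun m n) (x : Coord m) (q : JetFibre₂ m n) : ℝ :=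
  F x q.1 q.2.1 q.2.2

/-- Smoothness on the part of the second jet bundle over `W`. -/
def JetFun.IsSmoothOver (W : Set (Coord m × Coord n)) (F : JetFun m n) : Prop :=
  ContDiffOn ℝ ∞ (fun q : Coord m × JetFibre₂ m n => F.onFibre q.1 q.2)
    {q | (q.1, q.2.1) ∈ W}

/-- The linearization of `F` along the jet prolongation of `φ`. -/
def JetFun.lin (F : JetFun m n) (φ η : Coord m → Coord n) (x : Coord m) : ℝ :=
  fderiv ℝ (F.onFibre x) (jet₂ φ x) (jet₂ η x)

theorem contDiffOn_jet₂ {φ : Coord m → Coord n} (hφ : ContDiffOn ℝ ∞ φ Ω) (hΩ : IsOpen Ω) :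
    ContDiffOn ℝ ∞ (jet₂ φ) Ω := by
  refine hφ.prodMk (ContDiffOn.prodMk ?_ ?_)
  · exact contDiffOn_pi.2 fun σ => contDiffOn_pi.2 fun i => (contDiffOn_apply hφ σ).pd i hΩ
  · exact contDiffOn_pi.2 fun σ => contDiffOn_pi.2 fun i => contDiffOn_pi.2 fun j =>
      ((contDiffOn_apply hφ σ).pd i hΩ).pd j hΩ

theorem jet₂_add_smul {φ η : Coord m → Coord n} (hφ : ContDiffOn ℝ ∞ φ Ω)
    (hη : ContDiff ℝ ∞ η) (hΩ : IsOpen Ω) (s : ℝ) {x : Coord m} (hx : x ∈ Ω) :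
    jet₂ (fun x => φ x + s • η x) x = jet₂ φ x + s • jet₂ η x := by
  have h1 : ∀ σ i, ∀ x ∈ Ω, pd i (fun x' => φ x' σ + s * η x' σ) x =
      pd i (fun x' => φ x' σ) x + s * pd i (fun x' => η x' σ) x := by
    intro σ i x hx
    have hd := (contDiffOn_apply hη.contDiffOn σ).differentiableAt_of_isOpen isOpen_univ
      (mem_univ x)
    rw [pd_add i ((contDiffOn_apply hφ σ).differentiableAt_of_isOpen hΩ hx) (hd.const_mul s),
      pd_const_mul i s hd]
  refine Prod.ext rfl (Prod.ext ?_ ?_)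
  · funext σ i
    exact h1 σ i x hx
  · funext σ i j
    have hd := ((contDiffOn_apply hη.contDiffOn σ).pd i isOpen_univ).differentiableAt_of_isOpen
      isOpen_univ (mem_univ x)
    refine (pd_congr_of_eqOn j hΩ hx (h1 σ i)).trans ?_
    rw [pd_add j (((contDiffOn_apply hφ σ).pd i hΩ).differentiableAt_of_isOpen hΩ hx)
      (hd.const_mul s), pd_const_mul j s hd]
    rfl

theorem isOpen_jetRegion {P : Type*} [TopologicalSpace P] {π : P → Coord n} (hπ : Continuous π)
    (hW : IsOpen W) : IsOpen {q : Coord m × P | (q.1, π q.2) ∈ W} :=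
  hW.preimage (by fun_prop)

theorem contDiffOn_jet {r : ℕ} {φ : Coord m → Coord n} (hφ : ContDiffOn ℝ ∞ φ Ω)
    (hΩ : IsOpen Ω) : ContDiffOn ℝ ∞ (jet r φ) Ω :=
  contDiffOn_pi.2 fun _ => contDiffOn_pi.2 fun p => hφ.iteratedPd hΩ p

theorem jet_add_smul {r : ℕ} {φ η : Coord m → Coord n} (hφ : ContDiffOn ℝ ∞ φ Ω)
    (hη : ContDiff ℝ ∞ η) (hΩ : IsOpen Ω) (s : ℝ) {x : Coord m} (hx : x ∈ Ω) :
    jet r (fun x => φ x + s • η x) x = jet r φ x + s • jet r η x := by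
  funext k p
  exact iteratedPd_add_const_mul hφ hη hΩ s p hx

theorem jet_zero_apply {r : ℕ} (φ : Coord m → Coord n) (x : Coord m) :
    jet r φ x 0 (fun a => Fin.elim0 a) = φ x :=
  iteratedPd_zero _ _ _

theorem jet_eq_zero {r : ℕ} {η : Coord m → Coord n} {x : Coord m} (hx : x ∉ tsupport η) :
    jet r η x = 0 := by
  have h : η =ᶠ[𝓝 x] fun _ => 0 := notMem_tsupport_iff_eventuallyEq.1 hx
  funext k p
  rw [jet, iteratedPd_congr h, iteratedPd]
  have : iteratedFDeriv ℝ (k : ℕ) (fun _ : Coord m => (0 : Coord n)) x = 0 := by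
    rw [iteratedFDeriv_fun_zero]; rfl
  rw [this]; rfl

theorem fderiv_apply_eq_fderiv_uncurry {X P : Type*} [NormedAddCommGroup X] [NormedSpace ℝ X]
    [NormedAddCommGroup P] [NormedSpace ℝ P] {L : X → P → ℝ} {x : X} {q : P}
    (h : DifferentiableAt ℝ (fun q : X × P => L q.1 q.2) (x, q)) (v : P) :
    fderiv ℝ (L x) q v = fderiv ℝ (fun q : X × P => L q.1 q.2) (x, q) (0, v) := by
  have h1 : HasFDerivAt (fun q : P => (x, q)) (ContinuousLinearMap.inr ℝ X P) q :=
    hasFDerivAt_prodMk_right x q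
  have h2 := h.hasFDerivAt.comp q h1
  have h3 : fderiv ℝ (L x) q = _ := h2.fderiv
  rw [h3]
  simp

/-- A fibre derivative is the full derivative in a vertical direction. The direction may vary with
the base point, since in the second variation it is the jet of a test section. -/
theorem contDiffOn_fderiv_fibre {X P : Type*} [NormedAddCommGroup X] [NormedSpace ℝ X]
    [NormedAddCommGroup P] [NormedSpace ℝ P] {L : X → P → ℝ} {D : Set (X × P)} (hD : IsOpen D)
    (hL : ContDiffOn ℝ ∞ (fun q : X × P => L q.1 q.2) D) {s : Set X} {v : X → P}
    (hv : ContDiffOn ℝ ∞ v s) :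
    ContDiffOn ℝ ∞ (fun q : X × P => fderiv ℝ (L q.1) q.2 (v q.1)) (D ∩ {q | q.1 ∈ s}) := by
  have h1 : ContDiffOn ℝ ∞ (fun q : X × P => fderiv ℝ (fun q : X × P => L q.1 q.2) q (0, v q.1))
      (D ∩ {q | q.1 ∈ s}) :=
    ((hL.fderiv_of_isOpen hD (m := ∞) (by simp)).mono inter_subset_left).clm_apply
      (contDiffOn_const.prodMk (hv.comp contDiffOn_fst fun q hq => hq.2))
  exact h1.congr fun q hq =>
    fderiv_apply_eq_fderiv_uncurry (hL.differentiableAt_of_isOpen hD hq.1) _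

/-- Expansion in the basis indexed by all ordered index tuples, the same redundant coordinates over
which `eulerLagrange` sums; no symmetrization factors appear. -/
theorem map_jetFibre {r : ℕ} (ℓ : JetFibre r m n →L[ℝ] ℝ) (v : JetFibre r m n) :
    ℓ v = ∑ ν, ∑ k : Fin (r + 1), ∑ p : Fin k → Fin m,
      ℓ (Pi.single k (Pi.single p (Pi.single ν 1))) * v k p ν := by
  have h3 : ∀ (k : Fin (r + 1)) (p : Fin k → Fin m) (y : Coord n),
      ℓ (Pi.single k (Pi.single p y)) =
        ∑ ν, ℓ (Pi.single k (Pi.single p (Pi.single ν 1))) * y ν := by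
    intro k p y
    have := LinearMap.pi_apply_eq_sum_univ
      (ℓ.toLinearMap ∘ₗ LinearMap.single ℝ (fun k : Fin (r + 1) => (Fin k → Fin m) → Coord n) k ∘ₗ
        LinearMap.single ℝ (fun _ : Fin k → Fin m => Coord n) p) y
    have hs : ∀ ν : Fin n, (fun j => if ν = j then (1 : ℝ) else 0) = Pi.single ν 1 := by
      intro ν
      funext j
      simp [Pi.single_apply, eq_comm]
    simp only [hs] at this
    simpa [mul_comm] using this
  calc ℓ v = ℓ (∑ k, Pi.single k (v k)) := by rw [Finset.univ_sum_single v]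
    _ = ∑ k, ℓ (Pi.single k (v k)) := map_sum _ _ _
    _ = ∑ k : Fin (r + 1), ∑ p : Fin k → Fin m, ℓ (Pi.single k (Pi.single p (v k p))) := by
      refine Finset.sum_congr rfl fun k _ => ?_
      conv_lhs => rw [← Finset.univ_sum_single (v k)]
      exact map_sum (ℓ.toLinearMap ∘ₗ
        LinearMap.single ℝ (fun k : Fin (r + 1) => (Fin k → Fin m) → Coord n) k) _ _
    _ = ∑ k : Fin (r + 1), ∑ p : Fin k → Fin m, ∑ ν,
        ℓ (Pi.single k (Pi.single p (Pi.single ν 1))) * v k p ν := by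
      simp only [← h3]
    _ = _ := by
      rw [Finset.sum_comm]
      refine Finset.sum_congr rfl fun k _ => ?_
      exact Finset.sum_comm

end Jets


/-! ### Self-adjointness of the linearized Euler-Lagrange expressions -/

section SelfAdjoint

variable {m n : ℕ} {W : Set (Coord m × Coord n)} {Ω : Set (Coord m)}

/-- The first variation formula. -/
theorem integral_eulerLagrange_mul {r : ℕ} {L : Coord m → JetFibre r m n → ℝ} (hW : IsOpen W)
    (hL : ContDiffOn ℝ ∞ (fun q : Coord m × JetFibre r m n => L q.1 q.2)
      {q | (q.1, q.2 0 (fun a => Fin.elim0 a)) ∈ W})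
    {φ ζ : Coord m → Coord n} (hφ : IsSection W Ω φ) (hζ : ContDiff ℝ ∞ ζ)
    (hc : HasCompactSupport ζ) (hsub : tsupport ζ ⊆ Ω) :
    ∫ x, ∑ ν, eulerLagrange L φ ν x * ζ x ν = ∫ x, fderiv ℝ (L x) (jet r φ x) (jet r ζ x) := by
  obtain ⟨hΩ, hφs, hφW⟩ := hφ
  have hD : IsOpen {q : Coord m × JetFibre r m n | (q.1, q.2 0 (fun a => Fin.elim0 a)) ∈ W} :=
    isOpen_jetRegion (π := fun q : JetFibre r m n => q 0 (fun a => Fin.elim0 a)) (by fun_prop) hW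
  set F : Fin n → ∀ k : Fin (r + 1), (Fin k → Fin m) → Coord m → ℝ := fun ν k p x =>
    fderiv ℝ (L x) (jet r φ x) (Pi.single k (Pi.single p (Pi.single ν 1))) with hFdef
  have hF : ∀ ν k p, ContDiffOn ℝ ∞ (F ν k p) Ω := by
    intro ν k p
    have h1 := contDiffOn_fderiv_fibre hD hL (s := Ω)
      (v := fun _ => Pi.single k (Pi.single p (Pi.single ν 1))) contDiffOn_const
    exact h1.comp (f := fun x => (x, jet r φ x)) (contDiffOn_id.prodMk (contDiffOn_jet hφs hΩ))
      fun x hx => ⟨by simpa only [mem_ofPred_eq, jet_zero_apply] using hφW x hx, hx⟩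
  have hζν : ∀ ν, ContDiff ℝ ∞ (fun x => ζ x ν) := fun ν => contDiff_pi.1 hζ ν
  have hsν : ∀ ν, tsupport (fun x => ζ x ν) ⊆ tsupport ζ := fun ν =>
    closure_mono fun x hx h => hx (by simp [h])
  have hcν : ∀ ν, HasCompactSupport (fun x => ζ x ν) := fun ν =>
    hc.of_isClosed_subset (isClosed_tsupport _) (hsν ν)
  have hiζ : ∀ ν (k : Fin (r + 1)) (p : Fin k → Fin m),
      ContDiff ℝ ∞ (iteratedPd p (fun x => ζ x ν)) := fun ν k p =>
    contDiffOn_univ.1 ((hζν ν).contDiffOn.iteratedPd isOpen_univ p)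
  have hisub : ∀ ν (k : Fin (r + 1)) (p : Fin k → Fin m),
      tsupport (iteratedPd p (fun x => ζ x ν)) ⊆ tsupport (fun x => ζ x ν) := by
    intro ν k p
    have hs : Function.support (iteratedPd p (fun x => ζ x ν)) ⊆
        Function.support (iteratedFDeriv ℝ (k : ℕ) fun x => ζ x ν) :=
      fun x hx h => hx (by simp [iteratedPd, h])
    exact (closure_mono hs).trans (tsupport_iteratedFDeriv_subset _)
  have hint1 : ∀ ν (k : Fin (r + 1)) (p : Fin k → Fin m),
      Integrable fun x => iteratedPd p (F ν k p) x * ζ x ν := fun ν k p =>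
    integrable_mul_of_tsupport_subset hΩ ((hF ν k p).iteratedPd hΩ p).continuousOn
      (hζν ν).continuous (hcν ν) ((hsν ν).trans hsub)
  have hint2 : ∀ ν (k : Fin (r + 1)) (p : Fin k → Fin m),
      Integrable fun x => F ν k p x * iteratedPd p (fun x => ζ x ν) x := fun ν k p =>
    integrable_mul_of_tsupport_subset hΩ (hF ν k p).continuousOn (hiζ ν k p).continuous
      ((hcν ν).of_isClosed_subset (isClosed_tsupport _) (hisub ν k p))
      ((hisub ν k p).trans ((hsν ν).trans hsub))
  have hl : ∀ x, ∑ ν, eulerLagrange L φ ν x * ζ x ν = ∑ ν, ∑ k : Fin (r + 1),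
      ∑ p : Fin k → Fin m, (-1 : ℝ) ^ (k : ℕ) * (iteratedPd p (F ν k p) x * ζ x ν) := by
    intro x
    simp only [eulerLagrange, Finset.sum_mul, Finset.mul_sum, hFdef, mul_assoc]
  have hr : ∀ x, fderiv ℝ (L x) (jet r φ x) (jet r ζ x) = ∑ ν, ∑ k : Fin (r + 1),
      ∑ p : Fin k → Fin m, F ν k p x * iteratedPd p (fun x => ζ x ν) x := by
    intro x
    rw [map_jetFibre]
    simp only [jet, hFdef, iteratedPd_apply hζ.contDiffOn isOpen_univ _ (mem_univ x)]
  simp only [hl, hr]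
  rw [integral_finsetSum _ fun ν _ => integrable_finsetSum _ fun k _ => integrable_finsetSum _
      fun p _ => (hint1 ν k p).const_mul _,
    integral_finsetSum _ fun ν _ => integrable_finsetSum _ fun k _ => integrable_finsetSum _
      fun p _ => hint2 ν k p]
  refine Finset.sum_congr rfl fun ν _ => ?_
  rw [integral_finsetSum _ fun k _ => integrable_finsetSum _ fun p _ => (hint1 ν k p).const_mul _,
    integral_finsetSum _ fun k _ => integrable_finsetSum _ fun p _ => hint2 ν k p]
  refine Finset.sum_congr rfl fun k _ => ?_
  rw [integral_finsetSum _ fun p _ => (hint1 ν k p).const_mul _,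
    integral_finsetSum _ fun p _ => hint2 ν k p]
  refine Finset.sum_congr rfl fun p _ => ?_
  -- The sign from `k` integrations by parts cancels the sign in the Euler–Lagrange expression.
  rw [integral_const_mul, integral_iteratedPd_mul hΩ (hF ν k p) (hζν ν) (hcν ν)
    ((hsν ν).trans hsub), ← mul_assoc, ← mul_pow]
  simp

/-- The linearization of the Euler-Lagrange expressions of a Lagrangian is self-adjoint. -/
theorem integral_lin_comm {ε : DynForm m n} (hε : ∀ ν, (ε ν).IsSmoothOver W) {r : ℕ}
    {L : Coord m → JetFibre r m n → ℝ} (hW : IsOpen W)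
    (hL : ContDiffOn ℝ ∞ (fun q : Coord m × JetFibre r m n => L q.1 q.2)
      {q | (q.1, q.2 0 (fun a => Fin.elim0 a)) ∈ W})
    (hEL : ∀ Ω φ, IsSection W Ω φ → ∀ x ∈ Ω, ∀ ν, (ε ν).along φ x = eulerLagrange L φ ν x)
    {φ : Coord m → Coord n} (hφ : IsSection W Ω φ)
    {η ζ : Coord m → Coord n} (hη : ContDiff ℝ ∞ η) (hζ : ContDiff ℝ ∞ ζ)
    (hηc : HasCompactSupport η) (hζc : HasCompactSupport ζ)
    (hηs : tsupport η ⊆ Ω) (hζs : tsupport ζ ⊆ Ω) :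
    ∫ x, ∑ ν, (ε ν).lin φ η x * ζ x ν = ∫ x, ∑ ν, (ε ν).lin φ ζ x * η x ν := by
  obtain ⟨hΩ, hφs, hφW⟩ := id hφ
  have hD₂ : IsOpen {q : Coord m × JetFibre₂ m n | (q.1, q.2.1) ∈ W} :=
    isOpen_jetRegion (π := fun q : JetFibre₂ m n => q.1) (by fun_prop) hW
  have hD : IsOpen {q : Coord m × JetFibre r m n | (q.1, q.2 0 (fun a => Fin.elim0 a)) ∈ W} :=
    isOpen_jetRegion (π := fun q : JetFibre r m n => q 0 (fun a => Fin.elim0 a)) (by fun_prop) hW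
  -- Both sides are the derivative at `s = 0` of the first variation at `φ + sη` tested with `ζ`:
  -- once through `ε`, once through `L`.
  have key : ∀ {η ζ : Coord m → Coord n}, ContDiff ℝ ∞ η → ContDiff ℝ ∞ ζ →
      HasCompactSupport ζ → tsupport ζ ⊆ Ω →
      ∫ x, ∑ ν, (ε ν).lin φ η x * ζ x ν =
        ∫ x, fderiv ℝ (fderiv ℝ (L x)) (jet r φ x) (jet r η x) (jet r ζ x) := by
    intro η ζ hη hζ hζc hζs
    have hζν : ∀ ν, ContDiff ℝ ∞ (fun x => ζ x ν) := fun ν => contDiff_pi.1 hζ ν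
    have d1 := hasDerivAt_integral_comp_add_smul (K := tsupport ζ) hζc hΩ hζs hD₂
      (H := fun x q => ∑ ν, (ε ν).onFibre x q * ζ x ν)
      (ContDiffOn.sum fun ν _ => (hε ν).mul ((hζν ν).comp contDiff_fst).contDiffOn)
      (fun x q hx => by simp [image_eq_zero_of_notMem_tsupport hx])
      (contDiffOn_jet₂ hφs hΩ) ((contDiffOn_jet₂ hη.contDiffOn isOpen_univ).mono (subset_univ _))
      hφW
    have d2 := hasDerivAt_integral_comp_add_smul (K := tsupport ζ) hζc hΩ hζs hD
      (H := fun x q => fderiv ℝ (L x) q (jet r ζ x))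
      ((contDiffOn_fderiv_fibre hD hL (contDiffOn_jet hζ.contDiffOn isOpen_univ)).mono
        fun q hq => ⟨hq, mem_univ _⟩)
      (fun x q hx => by simp [jet_eq_zero hx])
      (contDiffOn_jet hφs hΩ) ((contDiffOn_jet hη.contDiffOn isOpen_univ).mono (subset_univ _))
      (fun x hx => by simpa only [mem_ofPred_eq, jet_zero_apply] using hφW x hx)
    -- The two integrals need agree only for small `s`, for which compactness keeps the graph of `φ
    -- + sη` over the support of `ζ` inside `W`.
    have hev : (fun s : ℝ => ∫ x, ∑ ν, (ε ν).onFibre x (jet₂ φ x + s • jet₂ η x) * ζ x ν) =ᶠ[𝓝 0]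
        fun s => ∫ x, fderiv ℝ (L x) (jet r φ x + s • jet r η x) (jet r ζ x) := by
      have hmap : ContinuousOn (fun q : ℝ × Coord m => (q.2, φ q.2 + q.1 • η q.2))
          (univ ×ˢ Ω) :=
        continuousOn_snd.prodMk ((hφs.continuousOn.comp continuousOn_snd fun q hq => hq.2).add
          (continuousOn_fst.smul (hη.continuous.comp_continuousOn continuousOn_snd)))
      have hopen := hmap.isOpen_inter_preimage (isOpen_univ.prod hΩ) hW
      have hloc : ∀ᶠ s : ℝ in 𝓝 0, ∀ x ∈ tsupport ζ,
          (s, x) ∈ (univ ×ˢ Ω) ∩ (fun q : ℝ × Coord m => (q.2, φ q.2 + q.1 • η q.2)) ⁻¹' W := by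
        refine IsCompact.eventually_forall_of_forall_eventually (x₀ := (0 : ℝ)) hζc
          (P := fun s x => (s, x) ∈ (univ ×ˢ Ω) ∩
            (fun q : ℝ × Coord m => (q.2, φ q.2 + q.1 • η q.2)) ⁻¹' W) fun x hx =>
          hopen.mem_nhds ⟨⟨mem_univ _, hζs hx⟩, ?_⟩
        simpa using hφW x (hζs hx)
      filter_upwards [hloc] with s hs
      have hΩs : IsOpen {x | (s, x) ∈ (univ ×ˢ Ω) ∩
          (fun q : ℝ × Coord m => (q.2, φ q.2 + q.1 • η q.2)) ⁻¹' W} :=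
        hopen.preimage (by fun_prop)
      -- The deformed section lives on an open set depending on `s`, which still contains the
      -- support of `ζ`.
      have hsec : IsSection W {x | (s, x) ∈ (univ ×ˢ Ω) ∩
          (fun q : ℝ × Coord m => (q.2, φ q.2 + q.1 • η q.2)) ⁻¹' W}
          (fun x => φ x + s • η x) :=
        ⟨hΩs, (hφs.mono fun x hx => hx.1.2).add (hη.const_smul s).contDiffOn, fun x hx => hx.2⟩
      have h1 := integral_eulerLagrange_mul hW hL hsec hζ hζc hs
      have h2 : ∀ x, ∑ ν, (ε ν).onFibre x (jet₂ φ x + s • jet₂ η x) * ζ x ν =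
          ∑ ν, eulerLagrange L (fun x => φ x + s • η x) ν x * ζ x ν := by
        intro x
        by_cases hx : x ∈ tsupport ζ
        · refine Finset.sum_congr rfl fun ν _ => ?_
          rw [← hEL _ _ hsec x (hs x hx) ν, ← jet₂_add_smul hφs hη hΩ s (hζs hx)]
          rfl
        · simp [image_eq_zero_of_notMem_tsupport hx]
      have h3 : ∀ x, fderiv ℝ (L x) (jet r φ x + s • jet r η x) (jet r ζ x) =
          fderiv ℝ (L x) (jet r (fun x => φ x + s • η x) x) (jet r ζ x) := by
        intro x
        by_cases hx : x ∈ tsupport ζ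
        · rw [jet_add_smul hφs hη hΩ s (hζs hx)]
        · simp [jet_eq_zero hx]
      simp only [h2, h3, h1]
    have h := d1.unique (d2.congr_of_eventuallyEq hev)
    have e1 : ∀ x, fderiv ℝ (fun q => ∑ ν, (ε ν).onFibre x q * ζ x ν) (jet₂ φ x) (jet₂ η x) =
        ∑ ν, (ε ν).lin φ η x * ζ x ν := by
      intro x
      by_cases hx : x ∈ tsupport ζ
      · have hd : ∀ ν, DifferentiableAt ℝ ((ε ν).onFibre x) (jet₂ φ x) := fun ν =>
          ((hε ν).differentiableAt_of_isOpen hD₂ (hφW x (hζs hx))).comp (f := fun q => (x, q))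
            (jet₂ φ x) (by fun_prop)
        rw [fderiv_fun_sum fun ν _ => (hd ν).mul_const _, _root_.sum_apply]
        refine Finset.sum_congr rfl fun ν _ => ?_
        rw [fderiv_mul_const (hd ν)]
        simp [JetFun.lin, mul_comm]
      · simp [image_eq_zero_of_notMem_tsupport hx]
    have e2 : ∀ x, fderiv ℝ (fun q => fderiv ℝ (L x) q (jet r ζ x)) (jet r φ x) (jet r η x) =
        fderiv ℝ (fderiv ℝ (L x)) (jet r φ x) (jet r η x) (jet r ζ x) := by
      intro x
      by_cases hx : x ∈ tsupport ζ
      · have hd : ContDiffAt ℝ ∞ (L x) (jet r φ x) := by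
          refine ContDiffAt.comp (f := fun q => (x, q))
            (g := fun q : Coord m × JetFibre r m n => L q.1 q.2) _
            (hL.contDiffAt (hD.mem_nhds ?_)) (by fun_prop)
          simpa only [mem_ofPred_eq, jet_zero_apply] using hφW x (hζs hx)
        rw [fderiv_clm_apply ((hd.fderiv_right (m := ∞) (by simp)).differentiableAt (by simp))
          (differentiableAt_const _)]
        simp
      · simp [jet_eq_zero hx]
    simpa only [e1, e2] using h
  -- Only the order of the two arguments of the second derivative of `L` now differs.
  rw [key hη hζ hζc hζs, key hζ hη hηc hηs]
  congr 1
  ext x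
  by_cases hx : x ∈ tsupport ζ
  · have hd : ContDiffAt ℝ ∞ (L x) (jet r φ x) := by
      refine ContDiffAt.comp (f := fun q => (x, q))
        (g := fun q : Coord m × JetFibre r m n => L q.1 q.2) _
        (hL.contDiffAt (hD.mem_nhds ?_)) (by fun_prop)
      simpa only [mem_ofPred_eq, jet_zero_apply] using hφW x (hζs hx)
    exact hd.isSymmSndFDerivAt (by simp; exact ENat.LEInfty.out) _ _
  · simp [jet_eq_zero hx]

end SelfAdjoint


/-! ### Formal adjoints of second-order operators -/

section AdjointOperator

variable {m : ℕ} {Ω : Set (Coord m)}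

/-- If `∑ A_{lp} ∂_l ∂_p + ∑ B_l ∂_l + C` and `∑ A'_{lp} ∂_l ∂_p + ∑ B'_l ∂_l + C'` are formally
adjoint, then the first operator is given by the usual formula for the adjoint of the second. -/
theorem eq_adjoint_of_integral_eq (hΩ : IsOpen Ω) {A A' : Fin m → Fin m → Coord m → ℝ}
    {B B' : Fin m → Coord m → ℝ} {C C' : Coord m → ℝ}
    (hA : ∀ l p, ContDiffOn ℝ ∞ (A l p) Ω) (hA' : ∀ l p, ContDiffOn ℝ ∞ (A' l p) Ω)
    (hB : ∀ l, ContDiffOn ℝ ∞ (B l) Ω) (hB' : ∀ l, ContDiffOn ℝ ∞ (B' l) Ω)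
    (hC : ContDiffOn ℝ ∞ C Ω) (hC' : ContDiffOn ℝ ∞ C' Ω) {f : Coord m → ℝ}
    (hf : ContDiff ℝ ∞ f)
    (h : ∀ g, ContDiff ℝ ∞ g → HasCompactSupport g → tsupport g ⊆ Ω →
      ∫ x, (C x * f x + ∑ l, B l x * pd l f x + ∑ l, ∑ p, A l p x * pd p (pd l f) x) * g x =
        ∫ x, (C' x * g x + ∑ l, B' l x * pd l g x + ∑ l, ∑ p, A' l p x * pd p (pd l g) x) * f x)
    {x : Coord m} (hx : x ∈ Ω) :
    C x * f x + ∑ l, B l x * pd l f x + ∑ l, ∑ p, A l p x * pd p (pd l f) x =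
      C' x * f x - ∑ l, pd l (fun x => B' l x * f x) x
        + ∑ l, ∑ p, pd l (pd p (fun x => A' l p x * f x)) x := by
  have hBf : ∀ l, ContDiffOn ℝ ∞ (fun x => B' l x * f x) Ω := fun l => (hB' l).mul hf.contDiffOn
  have hAf : ∀ l p, ContDiffOn ℝ ∞ (fun x => A' l p x * f x) Ω := fun l p =>
    (hA' l p).mul hf.contDiffOn
  have hX1 : ContDiffOn ℝ ∞ (fun x => C x * f x + ∑ l, B l x * pd l f x
      + ∑ l, ∑ p, A l p x * pd p (pd l f) x) Ω :=
    ((hC.mul hf.contDiffOn).add (ContDiffOn.sum fun l _ => (hB l).mul (hf.pd l).contDiffOn)).add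
      (ContDiffOn.sum fun l _ => ContDiffOn.sum fun p _ =>
        (hA l p).mul ((hf.pd l).pd p).contDiffOn)
  have hX2 : ContDiffOn ℝ ∞ (fun x => C' x * f x - ∑ l, pd l (fun x => B' l x * f x) x
        + ∑ l, ∑ p, pd l (pd p (fun x => A' l p x * f x)) x) Ω :=
    ((hC'.mul hf.contDiffOn).sub (ContDiffOn.sum fun l _ => (hBf l).pd l hΩ)).add
      (ContDiffOn.sum fun l _ => ContDiffOn.sum fun p _ => ((hAf l p).pd p hΩ).pd l hΩ)
  -- By the fundamental lemma the two sides need only be compared after testing with `g`; the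
  -- hypothesis turns the first into an integral with derivatives of `g`, and these are moved back
  -- by parts.
  refine sub_eq_zero.1 (eq_zero_of_integral_mul_eq_zero hΩ (hX1.sub hX2).continuousOn
    (fun g hg hgc hgs => ?_) hx)
  have hgs1 : ∀ l, tsupport (pd l g) ⊆ Ω := fun l => (tsupport_pd_subset l g).trans hgs
  have hgs2 : ∀ l p, tsupport (pd p (pd l g)) ⊆ Ω := fun l p =>
    (tsupport_pd_subset p _).trans (hgs1 l)
  have hI1 := integrable_mul_of_tsupport_subset hΩ hX1.continuousOn hg.continuous hgc hgs
  have hI2 := integrable_mul_of_tsupport_subset hΩ hX2.continuousOn hg.continuous hgc hgs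
  have hIB : ∀ l, Integrable fun x => B' l x * f x * pd l g x := fun l =>
    integrable_mul_of_tsupport_subset hΩ (hBf l).continuousOn (hg.pd l).continuous (hgc.pd l)
      (hgs1 l)
  have hIA : ∀ l p, Integrable fun x => A' l p x * f x * pd p (pd l g) x := fun l p =>
    integrable_mul_of_tsupport_subset hΩ (hAf l p).continuousOn ((hg.pd l).pd p).continuous
      ((hgc.pd l).pd p) (hgs2 l p)
  have hIC : Integrable fun x => C' x * f x * g x :=
    integrable_mul_of_tsupport_subset hΩ (hC'.mul hf.contDiffOn).continuousOn hg.continuous hgc hgs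
  have hIB2 : ∀ l, Integrable fun x => pd l (fun x => B' l x * f x) x * g x := fun l =>
    integrable_mul_of_tsupport_subset hΩ ((hBf l).pd l hΩ).continuousOn hg.continuous hgc hgs
  have hIA2 : ∀ l p, Integrable fun x => pd l (pd p (fun x => A' l p x * f x)) x * g x := fun l p =>
    integrable_mul_of_tsupport_subset hΩ (((hAf l p).pd p hΩ).pd l hΩ).continuousOn hg.continuous
      hgc hgs
  simp only [sub_mul]
  rw [integral_sub hI1 hI2, h g hg hgc hgs, sub_eq_zero]
  have e1 : ∀ x, (C' x * g x + ∑ l, B' l x * pd l g x + ∑ l, ∑ p, A' l p x * pd p (pd l g) x) * f x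
      = C' x * f x * g x + ∑ l, B' l x * f x * pd l g x
        + ∑ l, ∑ p, A' l p x * f x * pd p (pd l g) x := by
    intro x
    simp only [add_mul, Finset.sum_mul, mul_right_comm]
  have e2 : ∀ x, (C' x * f x - ∑ l, pd l (fun x => B' l x * f x) x
        + ∑ l, ∑ p, pd l (pd p (fun x => A' l p x * f x)) x) * g x =
      C' x * f x * g x - ∑ l, pd l (fun x => B' l x * f x) x * g x
        + ∑ l, ∑ p, pd l (pd p (fun x => A' l p x * f x)) x * g x := by
    intro x
    simp only [add_mul, sub_mul, Finset.sum_mul]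
  simp only [e1, e2]
  have hSB : Integrable fun x => ∑ l, B' l x * f x * pd l g x :=
    integrable_finsetSum _ fun l _ => hIB l
  have hSA : Integrable fun x => ∑ l, ∑ p, A' l p x * f x * pd p (pd l g) x :=
    integrable_finsetSum _ fun l _ => integrable_finsetSum _ fun p _ => hIA l p
  have hSB2 : Integrable fun x => ∑ l, pd l (fun x => B' l x * f x) x * g x :=
    integrable_finsetSum _ fun l _ => hIB2 l
  have hSA2 : Integrable fun x => ∑ l, ∑ p, pd l (pd p (fun x => A' l p x * f x)) x * g x :=
    integrable_finsetSum _ fun l _ => integrable_finsetSum _ fun p _ => hIA2 l p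
  have hCB : Integrable fun x => C' x * f x * g x + ∑ l, B' l x * f x * pd l g x := hIC.add hSB
  have hCB2 : Integrable fun x =>
      C' x * f x * g x - ∑ l, pd l (fun x => B' l x * f x) x * g x := hIC.sub hSB2
  rw [integral_add hCB hSA, integral_add hIC hSB, integral_add hCB2 hSA2, integral_sub hIC hSB2,
    integral_finsetSum _ fun l _ => hIB l, integral_finsetSum _ fun l _ => hIB2 l,
    integral_finsetSum _ fun l _ => integrable_finsetSum _ fun p _ => hIA l p,
    integral_finsetSum _ fun l _ => integrable_finsetSum _ fun p _ => hIA2 l p]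
  congr 1
  · rw [sub_eq_add_neg, ← Finset.sum_neg_distrib]
    congr 1
    refine Finset.sum_congr rfl fun l _ => ?_
    rw [integral_pd_mul hΩ (hBf l) hg hgc hgs, neg_neg]
  · refine Finset.sum_congr rfl fun l _ => ?_
    rw [integral_finsetSum _ fun p _ => hIA l p, integral_finsetSum _ fun p _ => hIA2 l p]
    refine Finset.sum_congr rfl fun p _ => ?_
    rw [integral_pd_mul hΩ ((hAf l p).pd p hΩ) hg hgc hgs,
      integral_pd_mul hΩ (hAf l p) (hg.pd l) (hgc.pd l) (hgs1 l), neg_neg]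

/-- The two leading coefficients of a pair of formally adjoint operators. -/
theorem coeff_eq_of_adjoint (hΩ : IsOpen Ω) {A A' : Fin m → Fin m → Coord m → ℝ}
    {B B' : Fin m → Coord m → ℝ} {C C' : Coord m → ℝ}
    (hA : ∀ l p, ContDiffOn ℝ ∞ (A l p) Ω) (hA' : ∀ l p, ContDiffOn ℝ ∞ (A' l p) Ω)
    (hB : ∀ l, ContDiffOn ℝ ∞ (B l) Ω) (hB' : ∀ l, ContDiffOn ℝ ∞ (B' l) Ω)
    (hC : ContDiffOn ℝ ∞ C Ω) (hC' : ContDiffOn ℝ ∞ C' Ω)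
    (hAs : ∀ l p, A l p = A p l) (hAs' : ∀ l p, A' l p = A' p l)
    (h : ∀ f g, ContDiff ℝ ∞ f → HasCompactSupport f → tsupport f ⊆ Ω →
      ContDiff ℝ ∞ g → HasCompactSupport g → tsupport g ⊆ Ω →
      ∫ x, (C x * f x + ∑ l, B l x * pd l f x + ∑ l, ∑ p, A l p x * pd p (pd l f) x) * g x =
        ∫ x, (C' x * g x + ∑ l, B' l x * pd l g x + ∑ l, ∑ p, A' l p x * pd p (pd l g) x) * f x)
    {x : Coord m} (hx : x ∈ Ω) :
    (∀ l p, A l p x = A' l p x) ∧ ∀ l, B l x + B' l x = 2 * ∑ p, pd p (A' l p) x := by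
  -- Testing with functions that vanish at `x` removes all terms of order zero, leaving the two
  -- leading coefficients.
  have main : ∀ q : Coord m → ℝ, ContDiff ℝ ∞ q → q x = 0 →
      ∑ l, B l x * pd l q x + ∑ l, ∑ p, A l p x * pd p (pd l q) x =
        -∑ l, B' l x * pd l q x + 2 * (∑ l, (∑ p, pd p (A' l p) x) * pd l q x)
          + ∑ l, ∑ p, A' l p x * pd p (pd l q) x := by
    intro q hq hq0
    obtain ⟨r, hr, hrΩ⟩ := Metric.nhds_basis_closedBall.mem_iff.1 (hΩ.mem_nhds hx)
    -- The cutoff equals one near `x`, so it makes the test function admissible without changing its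
    -- derivatives there.
    let χ : ContDiffBump x := ⟨r / 2, r, half_pos hr, half_lt_self hr⟩
    have hf : ContDiff ℝ ∞ fun y => χ y * q y := χ.contDiff.mul hq
    have hfq : (fun y => χ y * q y) =ᶠ[𝓝 x] q := by
      filter_upwards [χ.eventuallyEq_one] with y hy
      simp only [hy, Pi.one_apply, one_mul]
    have hfc : HasCompactSupport fun y => χ y * q y := χ.hasCompactSupport.mul_right
    have hfs : tsupport (fun y => χ y * q y) ⊆ Ω :=
      (closure_mono (Function.support_mul_subset_left _ _)).trans
        (χ.tsupport_eq.subset.trans hrΩ)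
    have key := eq_adjoint_of_integral_eq hΩ hA hA' hB hB' hC hC' hf
      (fun g hg hgc hgs => h _ g hf hfc hfs hg hgc hgs) hx
    have p1 : ∀ l, pd l (fun y => χ y * q y) =ᶠ[𝓝 x] pd l q := by
      intro l
      filter_upwards [hfq.eventuallyEq_nhds] with y hy
      exact pd_congr l hy
    have p2 : ∀ l p, pd p (pd l (fun y => χ y * q y)) x = pd p (pd l q) x := fun l p =>
      pd_congr p (p1 l)
    have dq : DifferentiableAt ℝ q x := hq.contDiffAt.differentiableAt (by simp)
    have dpq : ∀ p, DifferentiableAt ℝ (pd p q) x := fun p =>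
      (hq.pd p).contDiffAt.differentiableAt (by simp)
    have p3 : ∀ l, pd l (fun y => B' l y * (χ y * q y)) x = B' l x * pd l q x := by
      intro l
      have : (fun y => B' l y * (χ y * q y)) =ᶠ[𝓝 x] fun y => B' l y * q y := by
        filter_upwards [hfq] with y hy
        rw [hy]
      rw [pd_congr l this, pd_mul l ((hB' l).differentiableAt_of_isOpen hΩ hx) dq, hq0]
      ring
    have p4 : ∀ l p, pd l (pd p (fun y => A' l p y * (χ y * q y))) x =
        pd p (A' l p) x * pd l q x + pd l (A' l p) x * pd p q x
          + A' l p x * pd p (pd l q) x := by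
      intro l p
      have h1 : (fun y => A' l p y * (χ y * q y)) =ᶠ[𝓝 x] fun y => A' l p y * q y := by
        filter_upwards [hfq] with y hy
        rw [hy]
      have h2 : pd p (fun y => A' l p y * (χ y * q y)) =ᶠ[𝓝 x]
          fun y => pd p (A' l p) y * q y + A' l p y * pd p q y := by
        filter_upwards [h1.eventuallyEq_nhds, hΩ.mem_nhds hx] with y hy hyΩ
        rw [pd_congr p hy, pd_mul p ((hA' l p).differentiableAt_of_isOpen hΩ hyΩ)
          (hq.contDiffAt.differentiableAt (by simp))]
      have d1 := ((hA' l p).pd p hΩ).differentiableAt_of_isOpen hΩ hx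
      have d2 := (hA' l p).differentiableAt_of_isOpen hΩ hx
      have d3 : DifferentiableAt ℝ (fun y => pd p (A' l p) y * q y) x := d1.mul dq
      have d4 : DifferentiableAt ℝ (fun y => A' l p y * pd p q y) x := d2.mul (dpq p)
      rw [pd_congr l h2, pd_add l d3 d4, pd_mul l d1 dq,
        pd_mul l d2 (dpq p), hq0, pd_comm l p hq.contDiffAt]
      ring
    simp only [p2, p3, p4, fun l => (p1 l).eq_of_nhds, hq0, mul_zero,
      Finset.sum_add_distrib] at key
    -- Symmetry of `A'` merges the two mixed terms of the Leibniz rule; this is the origin of the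
    -- factor 2.
    have hsw : ∑ l, ∑ p, pd l (A' l p) x * pd p q x = ∑ l, ∑ p, pd p (A' l p) x * pd l q x := by
      rw [Finset.sum_comm]
      refine Finset.sum_congr rfl fun l _ => Finset.sum_congr rfl fun p _ => ?_
      rw [hAs' p l]
    rw [hsw] at key
    simp only [Finset.sum_mul]
    linarith
  have hcoord : ∀ a, ContDiff ℝ ∞ fun y : Coord m => y a - x a := fun a =>
    (contDiff_apply ℝ ℝ a).sub contDiff_const
  have hpc : ∀ a l, pd l (fun y : Coord m => y a - x a) = fun _ => if a = l then 1 else 0 := by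
    intro a l
    funext y
    rw [pd_sub l (by fun_prop) (by fun_prop), pd_coord, pd_const, sub_zero]
  constructor
  · intro a b
    -- This quadratic function has vanishing gradient at `x`, and its Hessian isolates the
    -- second-order coefficient with indices `a`, `b`.
    have h1 := main (fun y => (y a - x a) * (y b - x b)) ((hcoord a).mul (hcoord b)) (by simp)
    have hp1 : ∀ l, pd l (fun y : Coord m => (y a - x a) * (y b - x b)) = fun y =>
        (if a = l then 1 else 0) * (y b - x b) + (y a - x a) * (if b = l then 1 else 0) := by
      intro l
      funext y
      rw [pd_mul l (by fun_prop) (by fun_prop), hpc, hpc]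
    have hp2 : ∀ l p, pd p (pd l (fun y : Coord m => (y a - x a) * (y b - x b))) x =
        (if a = l then 1 else 0) * (if b = p then 1 else 0)
          + (if b = l then 1 else 0) * (if a = p then 1 else 0) := by
      intro l p
      rw [hp1, pd_add p (by fun_prop) (by fun_prop), pd_const_mul p _ (by fun_prop), hpc]
      simp only [mul_comm (_ - _)]
      rw [pd_const_mul p _ (by fun_prop), hpc]
    have hp1x : ∀ l, pd l (fun y : Coord m => (y a - x a) * (y b - x b)) x = 0 := by
      intro l
      rw [hp1]
      simp
    simp only [hp1x, hp2, mul_zero, Finset.sum_const_zero, neg_zero, zero_add, mul_add,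
      Finset.sum_add_distrib, mul_ite, mul_one,
      Finset.sum_ite_eq, Finset.mem_univ, if_true] at h1
    rw [hAs b a, hAs' b a] at h1
    linarith
  · intro a
    -- A linear function has no Hessian and isolates the first-order coefficient.
    have h1 := main (fun y => y a - x a) (hcoord a) (by simp)
    simp only [hpc, pd_const, mul_zero, Finset.sum_const_zero, add_zero, mul_ite, mul_one,
      Finset.sum_ite_eq, Finset.mem_univ, if_true] at h1
    linarith

end AdjointOperator


/-! ### The linearized form and the first two Helmholtz conditions -/

section Linearization

variable {m n : ℕ} {W : Set (Coord m × Coord n)} {Ω : Set (Coord m)} {F : JetFun m n}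
  {φ : Coord m → Coord n}

theorem isOpen_jet₂Region (hW : IsOpen W) :
    IsOpen {q : Coord m × JetFibre₂ m n | (q.1, q.2.1) ∈ W} :=
  isOpen_jetRegion (π := fun q : JetFibre₂ m n => q.1) (by fun_prop) hW

theorem JetFun.IsSmoothOver.differentiableAt_onFibre (hF : F.IsSmoothOver W) (hW : IsOpen W)
    {x : Coord m} (hx : (x, φ x) ∈ W) : DifferentiableAt ℝ (F.onFibre x) (jet₂ φ x) :=
  (hF.differentiableAt_of_isOpen (isOpen_jet₂Region hW) (x := (x, jet₂ φ x)) hx).comp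
    (f := fun q => (x, q)) (jet₂ φ x) (by fun_prop)

theorem JetFun.IsSmoothOver.dY_along (hF : F.IsSmoothOver W) (hW : IsOpen W)
    {x : Coord m} (hx : (x, φ x) ∈ W) (μ : Fin n) :
    (F.dY μ).along φ x = fderiv ℝ (F.onFibre x) (jet₂ φ x) (Pi.single μ 1, 0, 0) := by
  have h := (hF.differentiableAt_onFibre hW hx).hasFDerivAt.comp (φ x)
    (hasFDerivAt_prodMk_left (𝕜 := ℝ) (jet₂ φ x).1 (jet₂ φ x).2)
  exact congrArg (fun T => T (Pi.single μ 1)) h.fderiv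

theorem JetFun.IsSmoothOver.dZ_along (hF : F.IsSmoothOver W) (hW : IsOpen W)
    {x : Coord m} (hx : (x, φ x) ∈ W) (μ : Fin n) (l : Fin m) :
    (F.dZ μ l).along φ x =
      fderiv ℝ (F.onFibre x) (jet₂ φ x) (0, Pi.single μ (Pi.single l 1), 0) := by
  have h := (hF.differentiableAt_onFibre hW hx).hasFDerivAt.comp (jet₂ φ x).2.1
    ((hasFDerivAt_prodMk_right (𝕜 := ℝ) (jet₂ φ x).1 (jet₂ φ x).2).comp (jet₂ φ x).2.1
      (hasFDerivAt_prodMk_left (𝕜 := ℝ) (jet₂ φ x).2.1 (jet₂ φ x).2.2))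
  exact congrArg (fun T => T (Pi.single μ (Pi.single l 1))) h.fderiv

theorem JetFun.IsSmoothOver.dW_along (hF : F.IsSmoothOver W) (hW : IsOpen W)
    {x : Coord m} (hx : (x, φ x) ∈ W) (μ : Fin n) (l p : Fin m) :
    (F.dW μ l p).along φ x = fderiv ℝ (F.onFibre x) (jet₂ φ x) (0, 0, Pi.single μ
      ((1 / 2 : ℝ) • (Pi.single l (Pi.single p 1) + Pi.single p (Pi.single l 1)))) := by
  have h := (hF.differentiableAt_onFibre hW hx).hasFDerivAt.comp (jet₂ φ x).2.2
    ((hasFDerivAt_prodMk_right (𝕜 := ℝ) (jet₂ φ x).1 (jet₂ φ x).2).comp (jet₂ φ x).2.2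
      (hasFDerivAt_prodMk_right (𝕜 := ℝ) (jet₂ φ x).2.1 (jet₂ φ x).2.2))
  exact congrArg (fun T => T (Pi.single μ
    ((1 / 2 : ℝ) • (Pi.single l (Pi.single p 1) + Pi.single p (Pi.single l 1))))) h.fderiv

theorem JetFun.IsSmoothOver.contDiffOn_fderiv (hF : F.IsSmoothOver W) (hW : IsOpen W)
    (hφ : IsSection W Ω φ) (v : JetFibre₂ m n) :
    ContDiffOn ℝ ∞ (fun x => fderiv ℝ (F.onFibre x) (jet₂ φ x) v) Ω :=
  (contDiffOn_fderiv_fibre (isOpen_jet₂Region hW) hF (s := univ) (v := fun _ => v)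
    contDiffOn_const).comp (f := fun x => (x, jet₂ φ x))
    (contDiffOn_id.prodMk (contDiffOn_jet₂ hφ.2.1 hφ.1)) fun x hx => ⟨hφ.2.2 x hx, mem_univ _⟩

theorem JetFun.IsSmoothOver.contDiffOn_dY_along (hF : F.IsSmoothOver W) (hW : IsOpen W)
    (hφ : IsSection W Ω φ) (μ : Fin n) : ContDiffOn ℝ ∞ ((F.dY μ).along φ) Ω :=
  (hF.contDiffOn_fderiv hW hφ _).congr fun x hx => hF.dY_along hW (hφ.2.2 x hx) μ

theorem JetFun.IsSmoothOver.contDiffOn_dZ_along (hF : F.IsSmoothOver W) (hW : IsOpen W)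
    (hφ : IsSection W Ω φ) (μ : Fin n) (l : Fin m) :
    ContDiffOn ℝ ∞ ((F.dZ μ l).along φ) Ω :=
  (hF.contDiffOn_fderiv hW hφ _).congr fun x hx => hF.dZ_along hW (hφ.2.2 x hx) μ l

theorem JetFun.IsSmoothOver.contDiffOn_dW_along (hF : F.IsSmoothOver W) (hW : IsOpen W)
    (hφ : IsSection W Ω φ) (μ : Fin n) (l p : Fin m) :
    ContDiffOn ℝ ∞ ((F.dW μ l p).along φ) Ω :=
  (hF.contDiffOn_fderiv hW hφ _).congr fun x hx => hF.dW_along hW (hφ.2.2 x hx) μ l p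

theorem JetFun.dW_comm (μ : Fin n) (l p : Fin m) : F.dW μ l p = F.dW μ p l := by
  funext x y z w
  simp only [JetFun.dW, add_comm]

/-- The symmetrized vectors are the directions used by `JetFun.dW`. Their factor one half is
compensated by the sum over ordered pairs, because the Hessian of `f` is symmetric. -/
theorem jet₂_single (μ : Fin n) {f : Coord m → ℝ} (hf : ContDiff ℝ ∞ f) (x : Coord m) :
    jet₂ (fun x => (Pi.single μ (f x) : Coord n)) x =
      f x • ((Pi.single μ 1, 0, 0) : JetFibre₂ m n)
        + ∑ l, pd l f x • ((0, Pi.single μ (Pi.single l 1), 0) : JetFibre₂ m n)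
        + ∑ l, ∑ p, pd p (pd l f) x • ((0, 0, Pi.single μ ((1 / 2 : ℝ) •
          (Pi.single l (Pi.single p 1) + Pi.single p (Pi.single l 1)))) : JetFibre₂ m n) := by
  have h : ∀ σ, (fun x' => (Pi.single μ (f x') : Coord n) σ) = if σ = μ then f else fun _ => 0 := by
    intro σ
    funext x
    by_cases hσ : σ = μ
    · subst hσ; simp
    · simp [hσ]
  refine Prod.ext ?_ (Prod.ext ?_ ?_)
  · funext σ
    simp [jet₂, Prod.fst_sum, Pi.single_apply]
  · funext σ i
    simp only [jet₂, h, Prod.snd_add, Prod.fst_add, Prod.snd_sum, Prod.fst_sum]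
    by_cases hσ : σ = μ
    · subst hσ
      simp [Finset.sum_apply, Pi.single_apply]
    · simp [hσ, Finset.sum_apply, pd_const]
  · funext σ i j
    simp only [jet₂, h, Prod.snd_add, Prod.snd_sum]
    by_cases hσ : σ = μ
    · subst hσ
      have hc : pd i (pd j f) x = pd j (pd i f) x := pd_comm i j hf.contDiffAt
      simp [Finset.sum_apply, Pi.single_apply, apply_ite, Finset.sum_add_distrib,
        hc]
      ring
    · have h0 : pd i (fun _ : Coord m => (0 : ℝ)) = fun _ => 0 := funext fun y => pd_const i 0
      simp [hσ, Finset.sum_apply, h0, pd_const]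

/-- Identifies the coefficients of the linearized operator, one matrix entry at a time, with the
derivatives that occur in the Helmholtz conditions. -/
theorem JetFun.IsSmoothOver.lin_single (hF : F.IsSmoothOver W) (hW : IsOpen W)
    {x : Coord m} (hx : (x, φ x) ∈ W) (μ : Fin n) {f : Coord m → ℝ} (hf : ContDiff ℝ ∞ f) :
    F.lin φ (fun x => Pi.single μ (f x)) x = (F.dY μ).along φ x * f x
      + ∑ l, (F.dZ μ l).along φ x * pd l f x
      + ∑ l, ∑ p, (F.dW μ l p).along φ x * pd p (pd l f) x := by
  rw [JetFun.lin, jet₂_single μ hf]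
  simp only [map_add, map_sum, map_smul, smul_eq_mul, hF.dY_along hW hx, hF.dZ_along hW hx,
    hF.dW_along hW hx, mul_comm]

/-- A variational dynamical form satisfies the first two Helmholtz conditions. -/
theorem IsVariational.helmholtz {W₀ : Set (Coord m × Coord n)} {ε : DynForm m n}
    (hε : ∀ ν, (ε ν).IsSmoothOver W₀) (h : IsVariational W₀ ε) :
    Helmholtz1 W₀ ε ∧ Helmholtz2 W₀ ε := by
  have main : ∀ Ω φ, IsSection W₀ Ω φ → ∀ x ∈ Ω, ∀ μ ν : Fin n,
      (∀ l p, ((ε ν).dW μ l p).along φ x = ((ε μ).dW ν l p).along φ x) ∧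
      ∀ l, ((ε ν).dZ μ l).along φ x + ((ε μ).dZ ν l).along φ x =
        2 * ∑ p, pd p (((ε μ).dW ν l p).along φ) x := by
    rintro Ω φ ⟨hΩ, hφ, hφW⟩ x hx μ ν
    obtain ⟨W, hW, hxW, hWW, r, L, hL, hEL⟩ := h (x, φ x) (hφW x hx)
    have hmap : ContinuousOn (fun x => (x, φ x)) Ω := continuousOn_id.prodMk hφ.continuousOn
    -- The Lagrangian exists only over `W`, so the section is restricted to the points whose graph
    -- lies there.
    have hΩ' := hmap.isOpen_inter_preimage hΩ hW
    have hsec : IsSection W (Ω ∩ (fun x => (x, φ x)) ⁻¹' W) φ :=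
      ⟨hΩ', hφ.mono inter_subset_left, fun x hx => hx.2⟩
    have hεW : ∀ ν, (ε ν).IsSmoothOver W := fun ν => (hε ν).mono fun q hq => hWW hq
    have hsm : ∀ (κ : Fin n) {f : Coord m → ℝ}, ContDiff ℝ ∞ f →
        ContDiff ℝ ∞ fun x => (Pi.single κ (f x) : Coord n) := by
      intro κ f hf
      refine contDiff_pi.2 fun σ => ?_
      by_cases hσ : σ = κ
      · subst hσ; simpa using hf
      · simpa [hσ] using contDiff_const
    have hts : ∀ (κ : Fin n) (f : Coord m → ℝ),
        tsupport (fun x => (Pi.single κ (f x) : Coord n)) ⊆ tsupport f := fun κ f =>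
      closure_mono fun x hx h => hx (by simp [h])
    refine coeff_eq_of_adjoint hΩ' (fun l p => (hεW ν).contDiffOn_dW_along hW hsec μ l p)
      (fun l p => (hεW μ).contDiffOn_dW_along hW hsec ν l p)
      (fun l => (hεW ν).contDiffOn_dZ_along hW hsec μ l)
      (fun l => (hεW μ).contDiffOn_dZ_along hW hsec ν l)
      ((hεW ν).contDiffOn_dY_along hW hsec μ) ((hεW μ).contDiffOn_dY_along hW hsec ν)
      (fun l p => by rw [JetFun.dW_comm]) (fun l p => by rw [JetFun.dW_comm]) ?_ ⟨hx, hxW⟩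
    intro f g hf hfc hfs hg hgc hgs
    -- Variations in the single components `μ` and `ν` exhibit two transposed entries of the
    -- linearized operator as formal adjoints of each other.
    have key := integral_lin_comm hεW hW hL hEL hsec (hsm μ hf) (hsm ν hg)
      (hfc.of_isClosed_subset (isClosed_tsupport _) (hts μ f))
      (hgc.of_isClosed_subset (isClosed_tsupport _) (hts ν g))
      ((hts μ f).trans hfs) ((hts ν g).trans hgs)
    have e : ∀ (κ κ' : Fin n) {f g : Coord m → ℝ}, ContDiff ℝ ∞ f →
        tsupport g ⊆ Ω ∩ (fun x => (x, φ x)) ⁻¹' W → ∀ x,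
        ∑ τ, (ε τ).lin φ (fun x => Pi.single κ (f x)) x * (Pi.single κ' (g x) : Coord n) τ =
          (((ε κ').dY κ).along φ x * f x + ∑ l, ((ε κ').dZ κ l).along φ x * pd l f x
            + ∑ l, ∑ p, ((ε κ').dW κ l p).along φ x * pd p (pd l f) x) * g x := by
      intro κ κ' f g hf hgs x
      by_cases hx : x ∈ tsupport g
      · rw [← (hεW κ').lin_single hW (hgs hx).2 κ hf]
        simp [Pi.single_apply]
      · simp [image_eq_zero_of_notMem_tsupport hx]
    simpa only [e μ ν hf hgs, e ν μ hg hfs] using key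
  exact ⟨fun Ω φ hφ x hx μ ν l p => sub_eq_zero.2 ((main Ω φ hφ x hx μ ν).1 l p),
    fun Ω φ hφ x hx μ ν l => sub_eq_zero.2 ((main Ω φ hφ x hx μ ν).2 l)⟩

end Linearization


/-! ### Derivatives of the dynamical form -/

section DynForm

variable {m n : ℕ} {U : Set (Coord m)} {V : Set (Coord n)} {B : Multiplier m n}
  {ΓM : Connection m} {ΓN : Connection n}

/-- Smoothness on `U × V`. -/
def Multiplier.IsSmoothOn (B : Multiplier m n) (U : Set (Coord m)) (V : Set (Coord n)) : Prop :=
  ∀ i j σ ν, ContDiffOn ℝ ∞ (fun q : Coord m × Coord n => B q.1 q.2 i j σ ν) (U ×ˢ V)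

theorem contDiffOn_slice_left {f : Coord m → Coord n → ℝ}
    (hf : ContDiffOn ℝ ∞ (fun q : Coord m × Coord n => f q.1 q.2) (U ×ˢ V)) {y : Coord n}
    (hy : y ∈ V) : ContDiffOn ℝ ∞ (fun x => f x y) U :=
  hf.comp (f := fun x => (x, y)) (by fun_prop) fun x hx => ⟨hx, hy⟩

theorem contDiffOn_slice_right {f : Coord m → Coord n → ℝ}
    (hf : ContDiffOn ℝ ∞ (fun q : Coord m × Coord n => f q.1 q.2) (U ×ˢ V)) {x : Coord m}
    (hx : x ∈ U) : ContDiffOn ℝ ∞ (f x) V :=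
  hf.comp (f := fun y => (x, y)) (by fun_prop) fun y hy => ⟨hx, hy⟩

theorem pd_left_eq (hU : IsOpen U) (hV : IsOpen V) {f : Coord m → Coord n → ℝ}
    (hf : ContDiffOn ℝ ∞ (fun q : Coord m × Coord n => f q.1 q.2) (U ×ˢ V)) {x : Coord m}
    {y : Coord n} (hx : x ∈ U) (hy : y ∈ V) (i : Fin m) :
    pd i (fun x' => f x' y) x =
      fderiv ℝ (fun q : Coord m × Coord n => f q.1 q.2) (x, y) (Pi.single i 1, 0) :=
  congrArg (fun T => T (Pi.single i 1))
    ((hf.differentiableAt_of_isOpen (hU.prod hV) ⟨hx, hy⟩).hasFDerivAt.comp x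
      (hasFDerivAt_prodMk_left (𝕜 := ℝ) x y)).fderiv

theorem pd_right_eq (hU : IsOpen U) (hV : IsOpen V) {f : Coord m → Coord n → ℝ}
    (hf : ContDiffOn ℝ ∞ (fun q : Coord m × Coord n => f q.1 q.2) (U ×ˢ V)) {x : Coord m}
    {y : Coord n} (hx : x ∈ U) (hy : y ∈ V) (a : Fin n) :
    pd a (f x) y =
      fderiv ℝ (fun q : Coord m × Coord n => f q.1 q.2) (x, y) (0, Pi.single a 1) :=
  congrArg (fun T => T (Pi.single a 1))
    ((hf.differentiableAt_of_isOpen (hU.prod hV) ⟨hx, hy⟩).hasFDerivAt.comp y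
      (hasFDerivAt_prodMk_right (𝕜 := ℝ) x y)).fderiv

theorem contDiffOn_pd_left (hU : IsOpen U) (hV : IsOpen V) {f : Coord m → Coord n → ℝ}
    (hf : ContDiffOn ℝ ∞ (fun q : Coord m × Coord n => f q.1 q.2) (U ×ˢ V)) (i : Fin m) :
    ContDiffOn ℝ ∞ (fun q : Coord m × Coord n => pd i (fun x => f x q.2) q.1) (U ×ˢ V) :=
  ((hf.fderiv_of_isOpen (hU.prod hV) (m := ∞) (by simp)).clm_apply contDiffOn_const).congr
    fun q hq => pd_left_eq hU hV hf hq.1 hq.2 i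

theorem contDiffOn_pd_right (hU : IsOpen U) (hV : IsOpen V) {f : Coord m → Coord n → ℝ}
    (hf : ContDiffOn ℝ ∞ (fun q : Coord m × Coord n => f q.1 q.2) (U ×ˢ V)) (a : Fin n) :
    ContDiffOn ℝ ∞ (fun q : Coord m × Coord n => pd a (f q.1) q.2) (U ×ˢ V) :=
  ((hf.fderiv_of_isOpen (hU.prod hV) (m := ∞) (by simp)).clm_apply contDiffOn_const).congr
    fun q hq => pd_right_eq hU hV hf hq.1 hq.2 a

/-- Partial derivatives with respect to base and fibre coordinates commute. -/
theorem pd_left_pd_right_comm (hU : IsOpen U) (hV : IsOpen V) {f : Coord m → Coord n → ℝ}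
    (hf : ContDiffOn ℝ ∞ (fun q : Coord m × Coord n => f q.1 q.2) (U ×ˢ V)) {x : Coord m}
    {y : Coord n} (hx : x ∈ U) (hy : y ∈ V) (i : Fin m) (a : Fin n) :
    pd i (fun x' => pd a (f x') y) x = pd a (fun y' => pd i (fun x' => f x' y') x) y := by
  have hUV := hU.prod hV
  have hat := hf.contDiffAt (hUV.mem_nhds ⟨hx, hy⟩ : U ×ˢ V ∈ 𝓝 (x, y))
  have hd : DifferentiableAt ℝ (fderiv ℝ fun q : Coord m × Coord n => f q.1 q.2) (x, y) :=
    (hat.fderiv_right (m := ∞) (by simp)).differentiableAt (by simp)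
  have key : ∀ v w : Coord m × Coord n,
      fderiv ℝ (fun q' => fderiv ℝ (fun q : Coord m × Coord n => f q.1 q.2) q' v) (x, y) w =
        fderiv ℝ (fderiv ℝ fun q : Coord m × Coord n => f q.1 q.2) (x, y) w v := by
    intro v w
    rw [fderiv_clm_apply hd (differentiableAt_const v)]
    simp
  rw [pd_left_eq hU hV (f := fun x y => pd a (f x) y) (contDiffOn_pd_right hU hV hf a) hx hy,
    pd_right_eq hU hV (f := fun x y => pd i (fun x' => f x' y) x) (contDiffOn_pd_left hU hV hf i)
      hx hy]
  have e1 : (fun q : Coord m × Coord n => pd a (f q.1) q.2) =ᶠ[𝓝 (x, y)]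
      fun q' => fderiv ℝ (fun q : Coord m × Coord n => f q.1 q.2) q' (0, Pi.single a 1) := by
    filter_upwards [hUV.mem_nhds (⟨hx, hy⟩ : (x, y) ∈ U ×ˢ V)] with q hq
    exact pd_right_eq hU hV hf hq.1 hq.2 a
  have e2 : (fun q : Coord m × Coord n => pd i (fun x => f x q.2) q.1) =ᶠ[𝓝 (x, y)]
      fun q' => fderiv ℝ (fun q : Coord m × Coord n => f q.1 q.2) q' (Pi.single i 1, 0) := by
    filter_upwards [hUV.mem_nhds (⟨hx, hy⟩ : (x, y) ∈ U ×ˢ V)] with q hq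
    exact pd_left_eq hU hV hf hq.1 hq.2 i
  rw [e1.fderiv_eq, e2.fderiv_eq, key, key]
  exact hat.isSymmSndFDerivAt (by simp; exact ENat.LEInfty.out) _ _

theorem Multiplier.IsSmoothOn.dx (hB : B.IsSmoothOn U V) (hU : IsOpen U) (hV : IsOpen V)
    (p : Fin m) : (B.dx p).IsSmoothOn U V := fun i j σ ν =>
  contDiffOn_pd_left hU hV (f := fun x y => B x y i j σ ν) (hB i j σ ν) p

theorem Multiplier.IsSmoothOn.dφ (hB : B.IsSmoothOn U V) (hU : IsOpen U) (hV : IsOpen V)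
    (a : Fin n) : (B.dφ a).IsSmoothOn U V := fun i j σ ν =>
  contDiffOn_pd_right hU hV (f := fun x y => B x y i j σ ν) (hB i j σ ν) a

/-- The total derivative of a multiplier. -/
theorem Multiplier.IsSmoothOn.pd_along (hB : B.IsSmoothOn U V) (hU : IsOpen U) (hV : IsOpen V)
    {φ : Coord m → Coord n} {x : Coord m} (hx : x ∈ U) (hy : φ x ∈ V)
    (hφ : DifferentiableAt ℝ φ x) (l i j : Fin m) (σ ν : Fin n) :
    pd l (fun x' => B x' (φ x') i j σ ν) x =
      B.dx l x (φ x) i j σ ν + ∑ κ, B.dφ κ x (φ x) i j σ ν * pd l (fun x' => φ x' κ) x :=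
  pd_comp_graph l (F := fun q : Coord m × Coord n => B q.1 q.2 i j σ ν)
    ((hB i j σ ν).differentiableAt_of_isOpen (hU.prod hV) (x := (x, φ x)) ⟨hx, hy⟩) hφ

theorem Multiplier.IsSmoothOn.differentiableAt_along (hB : B.IsSmoothOn U V) (hU : IsOpen U)
    (hV : IsOpen V) {φ : Coord m → Coord n} {x : Coord m} (hx : x ∈ U) (hy : φ x ∈ V)
    (hφ : DifferentiableAt ℝ φ x) (i j : Fin m) (σ ν : Fin n) :
    DifferentiableAt ℝ (fun x' => B x' (φ x') i j σ ν) x :=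
  DifferentiableAt.comp (g := fun q : Coord m × Coord n => B q.1 q.2 i j σ ν)
    (f := fun x => (x, φ x)) x
    ((hB i j σ ν).differentiableAt_of_isOpen (hU.prod hV) (x := (x, φ x)) ⟨hx, hy⟩)
    (differentiableAt_id.prodMk hφ)

/-- The geodesic form and its Lagrangian are polynomials of degree at most two in each derivative
variable, so their derivatives can be read off as linear coefficients along a line. -/
theorem fderiv_eq_of_quadratic {E : Type*} [NormedAddCommGroup E] [NormedSpace ℝ E] {f : E → ℝ}
    {z v : E} (hf : DifferentiableAt ℝ f z) {a b c : ℝ}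
    (h : ∀ t : ℝ, f (z + t • v) = a + t * b + t ^ 2 * c) : fderiv ℝ f z v = b := by
  rw [← hf.lineDeriv_eq_fderiv, lineDeriv]
  simp only [h]
  have : HasDerivAt (fun t : ℝ => a + t * b + t ^ 2 * c) (0 + 1 * b + 2 * 0 ^ 1 * c) 0 :=
    (((hasDerivAt_const (0 : ℝ) a).add ((hasDerivAt_id (0 : ℝ)).mul_const b))).add
      (by simpa using (hasDerivAt_pow 2 (0 : ℝ)).mul_const c)
  rw [this.deriv]
  ring

theorem dynForm_isSmoothOver (hB : B.IsSmoothOn U V) (hΓM : ΓM.IsSmoothSymmetric U)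
    (hΓN : ΓN.IsSmoothSymmetric V) (ν : Fin n) :
    (dynForm (fun _ => 1) B ΓM ΓN ν).IsSmoothOver (U ×ˢ V) := by
  have hb : ∀ i j σ, ContDiffOn ℝ ∞ (fun q : Coord m × JetFibre₂ m n => B q.1 q.2.1 i j σ ν)
      {q | (q.1, q.2.1) ∈ U ×ˢ V} := fun i j σ =>
    (hB i j σ ν).comp (f := fun q : Coord m × JetFibre₂ m n => (q.1, q.2.1))
      (by fun_prop) fun q hq => hq
  have hM : ∀ k i j, ContDiffOn ℝ ∞ (fun q : Coord m × JetFibre₂ m n => ΓM q.1 k i j)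
      {q | (q.1, q.2.1) ∈ U ×ˢ V} := fun k i j =>
    (hΓM.1 k i j).comp contDiffOn_fst fun q hq => hq.1
  have hN : ∀ σ α lam, ContDiffOn ℝ ∞ (fun q : Coord m × JetFibre₂ m n => ΓN q.2.1 σ α lam)
      {q | (q.1, q.2.1) ∈ U ×ˢ V} := fun σ α lam =>
    (hΓN.1 σ α lam).comp (f := fun q : Coord m × JetFibre₂ m n => q.2.1) (by fun_prop)
      fun q hq => hq.2
  have hz : ∀ σ i, ContDiff ℝ ∞ (fun q : Coord m × JetFibre₂ m n => q.2.2.1 σ i) := fun σ i => by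
    fun_prop
  have hw : ∀ σ i j, ContDiff ℝ ∞ (fun q : Coord m × JetFibre₂ m n => q.2.2.2 σ i j) :=
    fun σ i j => by fun_prop
  refine contDiffOn_const.mul (ContDiffOn.sum fun i _ => ContDiffOn.sum fun j _ =>
    ContDiffOn.sum fun σ _ => (hb i j σ).mul ?_)
  refine ((hw σ i j).contDiffOn.sub (ContDiffOn.sum fun k _ =>
    (hM k i j).mul (hz σ k).contDiffOn)).add (ContDiffOn.sum fun α _ => ContDiffOn.sum fun lam _ =>
    ((hN σ α lam).mul (hz α i).contDiffOn).mul (hz lam j).contDiffOn)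

/-- The form is affine in the second derivatives, and the symmetrized direction yields the mean of
the `lp` and `pl` coefficients, which agree by the upper symmetry of `B`. -/
theorem dynForm_dW (hBs : ∀ x ∈ U, ∀ y ∈ V, ∀ i j σ ν, B x y i j σ ν = B x y j i σ ν)
    {x : Coord m} {y : Coord n} (hx : x ∈ U) (hy : y ∈ V)
    (z : Fin n → Fin m → ℝ) (w : Fin n → Fin m → Fin m → ℝ) (ν μ : Fin n) (l p : Fin m) :
    (dynForm (fun _ => 1) B ΓM ΓN ν).dW μ l p x y z w = B x y l p μ ν := by
  have hd : DifferentiableAt ℝ (fun w' => dynForm (fun _ => 1) B ΓM ΓN ν x y z w') w := by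
    unfold dynForm geodesicExpr
    fun_prop
  refine fderiv_eq_of_quadratic hd (a := dynForm (fun _ => 1) B ΓM ΓN ν x y z w) (c := 0) ?_
  intro t
  have key : ∑ i, ∑ j, ∑ σ, B x y i j σ ν * (Pi.single (M := fun _ => Fin m → Fin m → ℝ) μ
      ((1 / 2 : ℝ) • (Pi.single l (Pi.single p 1) + Pi.single p (Pi.single l 1)))) σ i j =
      B x y l p μ ν := by
    have h1 : ∀ i j, ∑ σ, B x y i j σ ν * (Pi.single (M := fun _ => Fin m → Fin m → ℝ) μ
        ((1 / 2 : ℝ) • (Pi.single l (Pi.single p 1) + Pi.single p (Pi.single l 1)))) σ i j =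
        B x y i j μ ν * ((1 / 2) * ((if i = l then if j = p then 1 else 0 else 0) +
          if i = p then if j = l then 1 else 0 else 0)) := by
      intro i j
      rw [Finset.sum_eq_single μ (fun σ _ hσ => by simp [hσ]) (by simp)]
      simp only [Pi.single_eq_same, Pi.smul_apply, Pi.add_apply, smul_eq_mul]
      congr 3
      · by_cases h : i = l
        · subst h; simp [Pi.single_apply]
        · simp [h]
      · by_cases h : i = p
        · subst h; simp [Pi.single_apply]
        · simp [h]
    simp only [h1, mul_add, Finset.sum_add_distrib, mul_ite, mul_one, mul_zero]
    have h2 : ∀ (c : Fin m → Fin m → ℝ) (a b : Fin m),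
        ∑ i, ∑ j, (if i = a then if j = b then c i j else 0 else 0) = c a b := by
      intro c a b
      rw [Finset.sum_eq_single a (fun i _ hi => by simp [hi]) (by simp)]
      simp
    rw [h2 (fun i j => B x y i j μ ν * (1 / 2)), h2 (fun i j => B x y i j μ ν * (1 / 2)),
      hBs x hx y hy p l]
    ring
  rw [← key]
  simp only [dynForm, geodesicExpr, one_mul, mul_zero, add_zero, Finset.mul_sum, Pi.add_apply,
    Pi.smul_apply, smul_eq_mul]
  simp only [← Finset.sum_add_distrib]
  refine Finset.sum_congr rfl fun i _ => Finset.sum_congr rfl fun j _ =>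
    Finset.sum_congr rfl fun σ _ => ?_
  ring

/-- The two velocity slots of the quadratic term contribute equally: exchanging them is absorbed by
the upper symmetry of `B` and by vanishing torsion. Hence the factor 2. -/
theorem dynForm_dZ (hBs : ∀ x ∈ U, ∀ y ∈ V, ∀ i j σ ν, B x y i j σ ν = B x y j i σ ν)
    (hNs : ∀ y ∈ V, ∀ σ α lam, ΓN y σ α lam = ΓN y σ lam α)
    {x : Coord m} {y : Coord n} (hx : x ∈ U) (hy : y ∈ V)
    (z : Fin n → Fin m → ℝ) (w : Fin n → Fin m → Fin m → ℝ) (ν μ : Fin n) (l : Fin m) :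
    (dynForm (fun _ => 1) B ΓM ΓN ν).dZ μ l x y z w =
      -∑ i, ∑ j, B x y i j μ ν * ΓM x l i j
        + ∑ j, ∑ lam, (∑ σ, 2 * (B x y l j σ ν * ΓN y σ μ lam)) * z lam j := by
  have hd : DifferentiableAt ℝ (fun z' => dynForm (fun _ => 1) B ΓM ΓN ν x y z' w) z := by
    unfold dynForm geodesicExpr
    fun_prop
  set v : Fin n → Fin m → ℝ := Pi.single μ (Pi.single l 1) with hv
  have hvv : ∀ σ i, v σ i = if σ = μ then if i = l then 1 else 0 else 0 := by
    intro σ i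
    by_cases h : σ = μ
    · subst h; simp [hv, Pi.single_apply]
    · simp [hv, h]
  have e1 : ∑ i, ∑ j, ∑ σ, B x y i j σ ν * ∑ k, ΓM x k i j * v σ k =
      ∑ i, ∑ j, B x y i j μ ν * ΓM x l i j := by
    refine Finset.sum_congr rfl fun i _ => Finset.sum_congr rfl fun j _ => ?_
    rw [Finset.sum_eq_single μ (fun σ _ hσ => by simp [hvv, hσ]) (by simp)]
    simp [hvv]
  have e2 : ∑ i, ∑ j, ∑ σ, B x y i j σ ν * ∑ α, ∑ lam, ΓN y σ α lam * v α i * z lam j =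
      ∑ j, ∑ lam, (∑ σ, B x y l j σ ν * ΓN y σ μ lam) * z lam j := by
    rw [Finset.sum_eq_single l (fun i _ hi => by simp [hvv, hi]) (by simp)]
    refine Finset.sum_congr rfl fun j _ => ?_
    simp only [Finset.sum_mul]
    rw [Finset.sum_comm]
    refine Finset.sum_congr rfl fun σ _ => ?_
    rw [Finset.sum_eq_single μ (fun α _ hα => by simp [hvv, hα]) (by simp)]
    simp [hvv, Finset.mul_sum, mul_assoc]
  have e3 : ∑ i, ∑ j, ∑ σ, B x y i j σ ν * ∑ α, ∑ lam, ΓN y σ α lam * z α i * v lam j =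
      ∑ j, ∑ lam, (∑ σ, B x y l j σ ν * ΓN y σ μ lam) * z lam j := by
    rw [← e2, Finset.sum_comm]
    refine Finset.sum_congr rfl fun i _ => Finset.sum_congr rfl fun j _ =>
      Finset.sum_congr rfl fun σ _ => ?_
    rw [hBs x hx y hy j i, Finset.sum_comm]
    congr 1
    refine Finset.sum_congr rfl fun α _ => Finset.sum_congr rfl fun lam _ => ?_
    rw [hNs y hy σ lam α]
    ring
  refine fderiv_eq_of_quadratic hd (a := dynForm (fun _ => 1) B ΓM ΓN ν x y z w)
    (c := ∑ i, ∑ j, ∑ σ, B x y i j σ ν * ∑ α, ∑ lam, ΓN y σ α lam * v α i * v lam j) ?_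
  intro t
  have e4 : ∑ j, ∑ lam, (∑ σ, 2 * (B x y l j σ ν * ΓN y σ μ lam)) * z lam j =
      ∑ i, ∑ j, ∑ σ, B x y i j σ ν * ∑ α, ∑ lam, ΓN y σ α lam * v α i * z lam j +
      ∑ i, ∑ j, ∑ σ, B x y i j σ ν * ∑ α, ∑ lam, ΓN y σ α lam * z α i * v lam j := by
    rw [e2, e3, ← two_mul]
    simp only [Finset.mul_sum, Finset.sum_mul, mul_assoc]
  rw [e4, ← e1]
  have h1 : ∀ σ i j, ∑ k, ΓM x k i j * (z σ k + t * v σ k) =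
      ∑ k, ΓM x k i j * z σ k + t * ∑ k, ΓM x k i j * v σ k := by
    intro σ i j
    rw [Finset.mul_sum, ← Finset.sum_add_distrib]
    exact Finset.sum_congr rfl fun k _ => by ring
  have h2 : ∀ σ i j, ∑ α, ∑ lam, ΓN y σ α lam * (z α i + t * v α i) * (z lam j + t * v lam j) =
      ∑ α, ∑ lam, ΓN y σ α lam * z α i * z lam j
        + t * (∑ α, ∑ lam, ΓN y σ α lam * v α i * z lam j
          + ∑ α, ∑ lam, ΓN y σ α lam * z α i * v lam j)
        + t ^ 2 * ∑ α, ∑ lam, ΓN y σ α lam * v α i * v lam j := by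
    intro σ i j
    simp only [Finset.mul_sum, ← Finset.sum_add_distrib]
    exact Finset.sum_congr rfl fun α _ => Finset.sum_congr rfl fun lam _ => by ring
  simp only [dynForm, geodesicExpr, one_mul, Pi.add_apply, Pi.smul_apply, smul_eq_mul]
  rw [Finset.sum_congr rfl fun i _ => Finset.sum_congr rfl fun j _ =>
    Finset.sum_congr rfl fun σ _ => show _ = B x y i j σ ν * (w σ i j - ∑ k, ΓM x k i j * z σ k +
        ∑ α, ∑ lam, ΓN y σ α lam * z α i * z lam j)
      + t * (-(B x y i j σ ν * ∑ k, ΓM x k i j * v σ k)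
        + (B x y i j σ ν * ∑ α, ∑ lam, ΓN y σ α lam * v α i * z lam j
          + B x y i j σ ν * ∑ α, ∑ lam, ΓN y σ α lam * z α i * v lam j))
      + t ^ 2 * (B x y i j σ ν * ∑ α, ∑ lam, ΓN y σ α lam * v α i * v lam j) by
    rw [h1, h2]; ring]
  simp only [Finset.sum_add_distrib, ← Finset.mul_sum, Finset.sum_neg_distrib]

theorem dynForm_dY (hV : IsOpen V) (hB : B.IsSmoothOn U V) (hΓN : ΓN.IsSmoothSymmetric V)
    {x : Coord m} {y : Coord n} (hx : x ∈ U) (hy : y ∈ V)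
    (z : Fin n → Fin m → ℝ) (w : Fin n → Fin m → Fin m → ℝ) (ν μ : Fin n) :
    (dynForm (fun _ => 1) B ΓM ΓN ν).dY μ x y z w =
      ∑ i, ∑ j, ∑ σ, (B.dφ μ x y i j σ ν * geodesicExpr ΓM ΓN σ i j x y z w
        + B x y i j σ ν * ∑ α, ∑ lam, pd μ (fun y' => ΓN y' σ α lam) y * z α i * z lam j) := by
  have hb : ∀ i j σ, DifferentiableAt ℝ (fun y' => B x y' i j σ ν) y := fun i j σ =>
    (contDiffOn_slice_right (f := fun x y => B x y i j σ ν) (hB i j σ ν)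
      hx).differentiableAt_of_isOpen hV hy
  have hN : ∀ σ α lam, DifferentiableAt ℝ (fun y' => ΓN y' σ α lam) y := fun σ α lam =>
    (hΓN.1 σ α lam).differentiableAt_of_isOpen hV hy
  have hg : ∀ σ i j, DifferentiableAt ℝ (fun y' => geodesicExpr ΓM ΓN σ i j x y' z w) y := by
    intro σ i j
    unfold geodesicExpr
    fun_prop
  simp only [JetFun.dY, dynForm, one_mul]
  rw [pd_sum μ fun i _ => by fun_prop]
  refine Finset.sum_congr rfl fun i _ => ?_
  rw [pd_sum μ fun j _ => by fun_prop]
  refine Finset.sum_congr rfl fun j _ => ?_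
  rw [pd_sum μ fun σ _ => by fun_prop]
  refine Finset.sum_congr rfl fun σ _ => ?_
  rw [pd_mul μ (hb i j σ) (hg σ i j)]
  congr 2
  unfold geodesicExpr
  rw [pd_add μ (by fun_prop) (by fun_prop), pd_const, zero_add, pd_sum μ fun α _ => by fun_prop]
  refine Finset.sum_congr rfl fun α _ => ?_
  rw [pd_sum μ fun lam _ => by fun_prop]
  refine Finset.sum_congr rfl fun lam _ => ?_
  rw [pd_mul μ (by fun_prop) (by fun_prop), pd_mul μ (hN σ α lam) (by fun_prop), pd_const, pd_const]
  ring

end DynForm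


/-! ### The third Helmholtz expression as a polynomial in the jet coordinates -/

section Algebra

variable {m n : ℕ}

theorem sum_pair_comm {α β γ δ : Type*} [Fintype α] [Fintype β] [Fintype γ] [Fintype δ]
    (f : α → β → γ → δ → ℝ) :
    ∑ a, ∑ b, ∑ c, ∑ d, f a b c d = ∑ c, ∑ d, ∑ a, ∑ b, f a b c d := by
  calc ∑ a, ∑ b, ∑ c, ∑ d, f a b c d = ∑ a, ∑ c, ∑ b, ∑ d, f a b c d :=
        Finset.sum_congr rfl fun a _ => Finset.sum_comm
    _ = ∑ c, ∑ a, ∑ b, ∑ d, f a b c d := Finset.sum_comm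
    _ = ∑ c, ∑ a, ∑ d, ∑ b, f a b c d :=
        Finset.sum_congr rfl fun c _ => Finset.sum_congr rfl fun a _ => Finset.sum_comm
    _ = ∑ c, ∑ d, ∑ a, ∑ b, f a b c d := Finset.sum_congr rfl fun c _ => Finset.sum_comm

theorem sum_rotate {α β γ : Type*} [Fintype α] [Fintype β] [Fintype γ] (f : α → β → γ → ℝ) :
    ∑ a, ∑ b, ∑ c, f a b c = ∑ b, ∑ c, ∑ a, f a b c := by
  rw [Finset.sum_comm]
  exact Finset.sum_congr rfl fun b _ => Finset.sum_comm

variable (M : Fin m → Fin m → Fin m → ℝ) (N dN : Fin n → Fin n → Fin n → ℝ)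
  (u : Fin n → Fin m → ℝ) (w : Fin n → Fin m → Fin m → ℝ)

/-- With `c = ∂_μ B`, `d = B` this sorts the fibre derivative of the form by degree in the jet
coordinates; with `c = B`, `d = 0` it sorts the form itself. -/
theorem sum_dY_expand (c d : Fin m → Fin m → Fin n → ℝ) :
    ∑ i, ∑ j, ∑ σ, (c i j σ * (w σ i j - ∑ k, M k i j * u σ k
        + ∑ α, ∑ lam, N σ α lam * u α i * u lam j)
      + d i j σ * ∑ α, ∑ lam, dN σ α lam * u α i * u lam j) =
    ∑ i, ∑ j, ∑ σ, c i j σ * w σ i j - ∑ k, ∑ σ, (∑ i, ∑ j, M k i j * c i j σ) * u σ k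
      + ∑ i, ∑ j, ∑ α, ∑ lam, (∑ σ, (c i j σ * N σ α lam + d i j σ * dN σ α lam))
        * u α i * u lam j := by
  have h1 : ∑ i, ∑ j, ∑ σ, c i j σ * ∑ k, M k i j * u σ k =
      ∑ k, ∑ σ, (∑ i, ∑ j, M k i j * c i j σ) * u σ k := by
    simp only [Finset.mul_sum, Finset.sum_mul]
    rw [sum_pair_comm, Finset.sum_comm]
    exact Finset.sum_congr rfl fun k _ => Finset.sum_congr rfl fun σ _ =>
      Finset.sum_congr rfl fun i _ => Finset.sum_congr rfl fun j _ => by ring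
  have h2 : ∀ i j, ∑ σ, (c i j σ * (∑ α, ∑ lam, N σ α lam * u α i * u lam j)
      + d i j σ * ∑ α, ∑ lam, dN σ α lam * u α i * u lam j) =
      ∑ α, ∑ lam, (∑ σ, (c i j σ * N σ α lam + d i j σ * dN σ α lam)) * u α i * u lam j := by
    intro i j
    simp only [Finset.mul_sum, Finset.sum_mul, ← Finset.sum_add_distrib]
    rw [sum_rotate]
    exact Finset.sum_congr rfl fun α _ => Finset.sum_congr rfl fun lam _ =>
      Finset.sum_congr rfl fun σ _ => by ring
  rw [← h1]
  simp only [← h2, ← Finset.sum_add_distrib, ← Finset.sum_sub_distrib]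
  exact Finset.sum_congr rfl fun i _ => Finset.sum_congr rfl fun j _ =>
    Finset.sum_congr rfl fun σ _ => by ring

variable (dM : Fin m → Fin m → Fin m → ℝ) (dN' : Fin n → Fin n → Fin n → ℝ)

/-- Total divergence of the first-order coefficients. -/
theorem sum_dZ_expand (e : Fin m → Fin m → ℝ) (ex : Fin m → Fin m → Fin m → ℝ)
    (eφ : Fin n → Fin m → Fin m → ℝ) (b : Fin m → Fin m → Fin n → ℝ)
    (bx : Fin m → Fin m → Fin m → Fin n → ℝ) (bφ : Fin n → Fin m → Fin m → Fin n → ℝ)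
    (K : Fin n → Fin n → ℝ) (dK : Fin n → Fin n → Fin n → ℝ)
    (hw : ∀ σ i j, w σ i j = w σ j i) :
    ∑ l, (-∑ i, ∑ j, ((ex l i j + ∑ κ, eφ κ i j * u κ l) * M l i j + e i j * dM l i j)
      + ∑ j, ∑ lam, ((∑ σ, 2 * ((bx l l j σ + ∑ κ, bφ κ l j σ * u κ l) * K σ lam
          + b l j σ * ∑ κ, dK κ σ lam * u κ l)) * u lam j
        + (∑ σ, 2 * (b l j σ * K σ lam)) * w lam j l)) =
    ∑ i, ∑ j, ∑ lam, (∑ σ, 2 * (b i j σ * K σ lam)) * w lam i j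
      + ∑ i, ∑ j, ∑ κ, ∑ lam, (2 * ∑ σ, (bφ κ i j σ * K σ lam + b i j σ * dK κ σ lam))
        * u κ i * u lam j
      + ∑ k, ∑ σ, (2 * (∑ l, ∑ lam, bx l l k lam * K lam σ) - ∑ i, ∑ j, M k i j * eφ σ i j) * u σ k
      + (-(∑ l, ∑ i, ∑ j, ex l i j * M l i j) - ∑ l, ∑ i, ∑ j, e i j * dM l i j) := by
  have h1 : ∑ l, ∑ i, ∑ j, (∑ κ, eφ κ i j * u κ l) * M l i j =
      ∑ k, ∑ σ, (∑ i, ∑ j, M k i j * eφ σ i j) * u σ k := by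
    simp only [Finset.sum_mul]
    refine Finset.sum_congr rfl fun l _ => ?_
    rw [sum_rotate, sum_rotate]
    exact Finset.sum_congr rfl fun k _ => Finset.sum_congr rfl fun σ _ =>
      Finset.sum_congr rfl fun i _ => by ring
  have h2 : ∑ l, ∑ j, ∑ lam, (∑ σ, 2 * (bx l l j σ * K σ lam)) * u lam j =
      ∑ k, ∑ σ, (2 * (∑ l, ∑ lam, bx l l k lam * K lam σ)) * u σ k := by
    rw [sum_rotate]
    simp only [Finset.mul_sum, Finset.sum_mul]
  have h3 : ∑ l, ∑ j, ∑ lam, (∑ σ, 2 * ((∑ κ, bφ κ l j σ * u κ l) * K σ lam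
          + b l j σ * ∑ κ, dK κ σ lam * u κ l)) * u lam j =
      ∑ i, ∑ j, ∑ κ, ∑ lam, (2 * ∑ σ, (bφ κ i j σ * K σ lam + b i j σ * dK κ σ lam))
        * u κ i * u lam j := by
    refine Finset.sum_congr rfl fun l _ => Finset.sum_congr rfl fun j _ => ?_
    simp only [Finset.mul_sum, Finset.sum_mul, ← Finset.sum_add_distrib]
    rw [Finset.sum_congr rfl fun lam _ => Finset.sum_comm, Finset.sum_comm]
    exact Finset.sum_congr rfl fun κ _ => Finset.sum_congr rfl fun lam _ =>
      Finset.sum_congr rfl fun σ _ => by ring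
  have h4 : ∑ l, ∑ j, ∑ lam, (∑ σ, 2 * (b l j σ * K σ lam)) * w lam j l =
      ∑ i, ∑ j, ∑ lam, (∑ σ, 2 * (b i j σ * K σ lam)) * w lam i j := by
    exact Finset.sum_congr rfl fun i _ => Finset.sum_congr rfl fun j _ =>
      Finset.sum_congr rfl fun lam _ => by rw [hw]
  simp only [sub_mul, Finset.sum_sub_distrib]
  rw [← h1, ← h2, ← h3, ← h4]
  simp only [add_mul, mul_add, Finset.sum_add_distrib, Finset.sum_neg_distrib]
  ring

/-- Second total divergence of the leading coefficients. -/
theorem sum_dW_expand (bxx : Fin m → Fin m → Fin m → Fin m → ℝ)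
    (bφx : Fin n → Fin m → Fin m → Fin m → ℝ) (bxφ : Fin m → Fin n → Fin m → Fin m → ℝ)
    (bφφ : Fin n → Fin n → Fin m → Fin m → ℝ) (bφ : Fin n → Fin m → Fin m → ℝ)
    (hw : ∀ σ i j, w σ i j = w σ j i) (hc : ∀ p κ i j, bxφ p κ i j = bφx κ p i j)
    (hs : ∀ κ p i j, bφx κ p i j = bφx κ p j i)
    (hs' : ∀ κ lam i j, bφφ κ lam i j = bφφ κ lam j i) :
    ∑ l, ∑ p, (bxx l p l p + ∑ κ, bφx κ p l p * u κ l
      + ∑ lam, ((bxφ l lam l p + ∑ κ, bφφ κ lam l p * u κ l) * u lam p + bφ lam l p * w lam p l)) =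
    ∑ i, ∑ j, ∑ lam, bφ lam i j * w lam i j
      + ∑ i, ∑ j, ∑ κ, ∑ lam, bφφ lam κ i j * u κ i * u lam j
      + ∑ k, ∑ σ, (2 * ∑ p, bφx σ p k p) * u σ k
      + ∑ l, ∑ p, bxx l p l p := by
  have h1 : ∑ l, ∑ p, ∑ κ, bφx κ p l p * u κ l = ∑ k, ∑ σ, (∑ p, bφx σ p k p) * u σ k := by
    refine Finset.sum_congr rfl fun l _ => ?_
    rw [Finset.sum_comm]
    simp only [Finset.sum_mul]
  -- The two orders of mixed base and fibre differentiation give the same contribution, whence the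
  -- factor 2.
  have h2 : ∑ l, ∑ p, ∑ lam, bxφ l lam l p * u lam p =
      ∑ k, ∑ σ, (∑ p, bφx σ p k p) * u σ k := by
    rw [← h1, Finset.sum_comm]
    refine Finset.sum_congr rfl fun l _ => Finset.sum_congr rfl fun p _ =>
      Finset.sum_congr rfl fun κ _ => ?_
    rw [hc, hs]
  have h3 : ∑ l, ∑ p, ∑ lam, (∑ κ, bφφ κ lam l p * u κ l) * u lam p =
      ∑ i, ∑ j, ∑ κ, ∑ lam, bφφ lam κ i j * u κ i * u lam j := by
    rw [Finset.sum_comm]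
    refine Finset.sum_congr rfl fun l _ => Finset.sum_congr rfl fun p _ =>
      Finset.sum_congr rfl fun κ _ => ?_
    rw [Finset.sum_mul]
    refine Finset.sum_congr rfl fun lam _ => ?_
    rw [hs']
    ring
  have h4 : ∑ l, ∑ p, ∑ lam, bφ lam l p * w lam p l = ∑ i, ∑ j, ∑ lam, bφ lam i j * w lam i j :=
    Finset.sum_congr rfl fun i _ => Finset.sum_congr rfl fun j _ =>
      Finset.sum_congr rfl fun lam _ => by rw [hw]
  have h5 : ∑ k, ∑ σ, (2 * ∑ p, bφx σ p k p) * u σ k =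
      2 * ∑ k, ∑ σ, (∑ p, bφx σ p k p) * u σ k := by
    simp only [Finset.mul_sum, Finset.sum_mul, mul_assoc]
  rw [h5]
  simp only [add_mul, Finset.sum_add_distrib]
  rw [h1, h2, h3, h4]
  ring

/-- The monomial `u κ i * u lam j` is unchanged when both index pairs are exchanged, so a quadratic
form sees only the correspondingly symmetrized coefficients. -/
theorem sum_quadratic_symm (f : Fin m → Fin m → Fin n → Fin n → ℝ) :
    ∑ i, ∑ j, ∑ κ, ∑ lam, f i j κ lam * u κ i * u lam j =
      ∑ i, ∑ j, ∑ κ, ∑ lam, f j i lam κ * u κ i * u lam j := by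
  rw [Finset.sum_comm]
  refine Finset.sum_congr rfl fun i _ => Finset.sum_congr rfl fun j _ => ?_
  rw [Finset.sum_comm]
  exact Finset.sum_congr rfl fun κ _ => Finset.sum_congr rfl fun lam _ => by ring

end Algebra

/-! ### Sections with prescribed jets -/

section Sections

variable {m n : ℕ} {U : Set (Coord m)} {V : Set (Coord n)}

/-- The second-order Taylor polynomial with the given jet works on the open set that it maps into
`V`. Identities along sections thereby become identities in independent jet coordinates. -/
theorem exists_isSection_jet (hU : IsOpen U) (hV : IsOpen V) {x : Coord m} {y : Coord n}
    (hx : x ∈ U) (hy : y ∈ V) (z : Fin n → Fin m → ℝ) (w : Fin n → Fin m → Fin m → ℝ)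
    (hw : ∀ σ i j, w σ i j = w σ j i) :
    ∃ Ω φ, IsSection (U ×ˢ V) Ω φ ∧ x ∈ Ω ∧ φ x = y ∧
      (∀ σ i, pd i (fun x' => φ x' σ) x = z σ i) ∧
      ∀ σ i j, pd j (pd i (fun x' => φ x' σ)) x = w σ i j := by
  -- The factor one half compensates for the double sum, in which each mixed term occurs twice.
  set φ : Coord m → Coord n := fun x' σ => y σ + (∑ i, z σ i * (x' i - x i)
    + ∑ i, ∑ j, (1 / 2 * w σ i j) * ((x' i - x i) * (x' j - x j))) with hφdef
  have hφ : ContDiff ℝ ∞ φ := by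
    refine contDiff_pi.2 fun σ => contDiff_const.add ((ContDiff.sum fun i _ => ?_).add
      (ContDiff.sum fun i _ => ContDiff.sum fun j _ => ?_))
    · exact contDiff_const.mul ((contDiff_apply ℝ ℝ i).sub contDiff_const)
    · exact contDiff_const.mul (((contDiff_apply ℝ ℝ i).sub contDiff_const).mul
        ((contDiff_apply ℝ ℝ j).sub contDiff_const))
  have hpc : ∀ a l, pd l (fun y : Coord m => y a - x a) = fun _ => if a = l then 1 else 0 := by
    intro a l
    funext y
    rw [pd_sub l (by fun_prop) (by fun_prop), pd_coord, pd_const, sub_zero]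
  have h1 : ∀ σ l, pd l (fun x' => φ x' σ) = fun x' => z σ l + ∑ j, w σ l j * (x' j - x j) := by
    intro σ l
    funext x'
    simp only [hφdef]
    rw [pd_add l (by fun_prop) (by fun_prop), pd_const, zero_add,
      pd_add l (by fun_prop) (by fun_prop), pd_sum l fun i _ => by fun_prop]
    congr 1
    · rw [Finset.sum_congr rfl fun i _ => by
        rw [pd_const_mul l _ (by fun_prop), hpc]]
      simp
    · have e : ∀ i j, pd l (fun x' : Coord m => 1 / 2 * w σ i j * ((x' i - x i) * (x' j - x j))) x'
          = 1 / 2 * w σ i j * ((if i = l then 1 else 0) * (x' j - x j)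
            + (x' i - x i) * (if j = l then 1 else 0)) := by
        intro i j
        rw [pd_const_mul l _ (by fun_prop), pd_mul l (by fun_prop) (by fun_prop), hpc, hpc]
      rw [pd_sum l fun i _ => by fun_prop,
        Finset.sum_congr rfl fun i _ => (pd_sum l fun j _ => by fun_prop).trans
          (Finset.sum_congr rfl fun j _ => e i j)]
      simp only [mul_add, Finset.sum_add_distrib]
      rw [Finset.sum_eq_single l (fun i _ hi => by simp [hi]) (by simp)]
      have e2 : ∀ i, ∑ j, 1 / 2 * w σ i j * ((x' i - x i) * (if j = l then 1 else 0)) =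
          1 / 2 * w σ l i * (x' i - x i) := by
        intro i
        rw [Finset.sum_eq_single l (fun i _ hi => by simp [hi]) (by simp), hw σ i l]
        simp
      simp only [e2, if_true, one_mul, ← Finset.sum_add_distrib]
      exact Finset.sum_congr rfl fun j _ => by ring
  refine ⟨U ∩ φ ⁻¹' V, φ, ⟨hU.inter (hV.preimage hφ.continuous), hφ.contDiffOn,
    fun x hx => hx⟩, ?_, ?_, ?_, ?_⟩
  · have : φ x = y := by funext σ; simp [hφdef]
    exact ⟨hx, by rw [mem_preimage, this]; exact hy⟩
  · funext σ; simp [hφdef]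
  · intro σ i
    rw [h1]
    simp
  · intro σ i j
    rw [h1, pd_add j (by fun_prop) (by fun_prop), pd_const, zero_add,
      pd_sum j fun a _ => by fun_prop,
      Finset.sum_congr rfl fun a _ => by rw [pd_const_mul j _ (by fun_prop), hpc]]
    simp

theorem affine_eq_zero {a : ℝ} {c : Fin m → Fin n → ℝ}
    (h : ∀ u : Fin n → Fin m → ℝ, a + ∑ j, ∑ lam, c j lam * u lam j = 0) :
    a = 0 ∧ ∀ j lam, c j lam = 0 := by
  have h0 : a = 0 := by simpa using h 0
  refine ⟨h0, fun j lam => ?_⟩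
  have := h (Pi.single lam (Pi.single j 1))
  rw [h0, zero_add, Finset.sum_eq_single j, Finset.sum_eq_single lam] at this
  · simpa using this
  · intro l _ hl; simp [hl]
  · simp
  · intro i _ hi
    refine Finset.sum_eq_zero fun l _ => ?_
    by_cases hl : l = lam
    · subst hl; simp [hi]
    · simp [hl]
  · simp

/-- A polynomial determines its coefficients once they carry the symmetry of their monomials; the
hypotheses `hs₁` and `hs₂` express that symmetry. -/
theorem jetPolynomial_eq_zero {t : ℝ} {c₁ : Fin m → Fin m → Fin n → ℝ} {c₃ : Fin m → Fin n → ℝ}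
    {c₂ : Fin m → Fin m → Fin n → Fin n → ℝ} (hs₁ : ∀ i j σ, c₁ i j σ = c₁ j i σ)
    (hs₂ : ∀ i j α lam, c₂ i j α lam = c₂ j i lam α)
    (h : ∀ (u : Fin n → Fin m → ℝ) (w : Fin n → Fin m → Fin m → ℝ),
      (∀ σ i j, w σ i j = w σ j i) →
      ∑ i, ∑ j, ∑ σ, c₁ i j σ * w σ i j
        + ∑ i, ∑ j, ∑ α, ∑ lam, c₂ i j α lam * u α i * u lam j
        + ∑ k, ∑ σ, c₃ k σ * u σ k + t = 0) :
    (∀ i j σ, c₁ i j σ = 0) ∧ (∀ i j α lam, c₂ i j α lam = 0) ∧ (∀ k σ, c₃ k σ = 0) ∧ t = 0 := by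
  have ht : t = 0 := by simpa using h 0 0 (by simp)
  have hq : ∀ u : Fin n → Fin m → ℝ,
      ∑ i, ∑ j, ∑ α, ∑ lam, c₂ i j α lam * u α i * u lam j = 0 ∧
      ∑ k, ∑ σ, c₃ k σ * u σ k = 0 := by
    intro u
    have h1 := h u 0 (by simp)
    -- Reversing the sign of `u` separates the even part from the odd part.
    have h2 := h (-u) 0 (by simp)
    simp only [Pi.zero_apply, mul_zero, Finset.sum_const_zero, Pi.neg_apply, mul_neg, neg_mul,
      neg_neg, Finset.sum_neg_distrib, ht] at h1 h2
    constructor <;> linarith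
  refine ⟨fun i j σ => ?_, fun i j α lam => ?_, ?_, ht⟩
  -- A symmetric elementary matrix tests the second-order coefficient; it is hit twice, also when `i
  -- = j`.
  · have h1 := h 0 (Pi.single σ (Pi.single i (Pi.single j 1) + Pi.single j (Pi.single i 1))) (by
      intro τ a b
      by_cases hτ : τ = σ
      · subst hτ
        simp only [Pi.single_eq_same, Pi.add_apply]
        by_cases h1 : a = i <;> by_cases h2 : b = j <;> by_cases h3 : a = j <;>
          by_cases h4 : b = i <;> simp [Pi.single_apply, h1, h2, h3, h4] <;> simp_all
      · simp [hτ])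
    have e : ∀ a b, ∑ τ, c₁ a b τ * (Pi.single (M := fun _ => Fin m → Fin m → ℝ) σ
        (Pi.single i (Pi.single j 1) + Pi.single j (Pi.single i 1))) τ a b =
        (if a = i then if b = j then c₁ a b σ else 0 else 0)
          + if a = j then if b = i then c₁ a b σ else 0 else 0 := by
      intro a b
      rw [Finset.sum_eq_single σ (fun τ _ hτ => by simp [hτ]) (by simp)]
      simp only [Pi.single_eq_same, Pi.add_apply, mul_add]
      congr 1
      · by_cases h1 : a = i
        · subst h1; simp [Pi.single_apply]
        · simp [h1]
      · by_cases h1 : a = j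
        · subst h1; simp [Pi.single_apply]
        · simp [h1]
    have e2 : ∀ (c : Fin m → Fin m → ℝ) (a b : Fin m),
        ∑ i, ∑ j, (if i = a then if j = b then c i j else 0 else 0) = c a b := by
      intro c a b
      rw [Finset.sum_eq_single a (fun i _ hi => by simp [hi]) (by simp)]
      simp
    simp only [e, Finset.sum_add_distrib, e2 (fun a b => c₁ a b σ), ht, Pi.zero_apply, mul_zero,
      Finset.sum_const_zero, add_zero] at h1
    rw [hs₁ j i] at h1
    linarith
  -- Polarization at two elementary vectors isolates a coefficient of the quadratic form.
  · set v₁ : Fin n → Fin m → ℝ := Pi.single α (Pi.single i 1) with hv₁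
    set v₂ : Fin n → Fin m → ℝ := Pi.single lam (Pi.single j 1) with hv₂
    have hv : ∀ (α : Fin n) (i : Fin m) σ a, (Pi.single α (Pi.single i 1) : Fin n → Fin m → ℝ) σ a =
        if a = i then if σ = α then 1 else 0 else 0 := by
      intro α i σ a
      by_cases h : σ = α
      · subst h; simp [Pi.single_apply]
      · simp [h]
    have b1 : ∀ (α lam : Fin n) (i j : Fin m), ∑ i', ∑ j', ∑ α', ∑ lam', c₂ i' j' α' lam'
        * (Pi.single α (Pi.single i 1) : Fin n → Fin m → ℝ) α' i'
        * (Pi.single lam (Pi.single j 1) : Fin n → Fin m → ℝ) lam' j' = c₂ i j α lam := by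
      intro α lam i j
      simp only [hv]
      rw [Finset.sum_eq_single i (fun i' _ hi => by simp [hi]) (by simp),
        Finset.sum_eq_single j (fun i' _ hi => by simp [hi]) (by simp),
        Finset.sum_eq_single α (fun i' _ hi => by simp [hi]) (by simp),
        Finset.sum_eq_single lam (fun i' _ hi => by simp [hi]) (by simp)]
      simp
    have h1 := (hq (v₁ + v₂)).1
    have h2 := (hq v₁).1
    have h3 := (hq v₂).1
    simp only [Pi.add_apply, mul_add, add_mul, Finset.sum_add_distrib] at h1
    rw [h2, h3, hv₁, hv₂, b1, b1, hs₂ j i] at h1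
    linarith
  · exact (affine_eq_zero (a := 0) fun u => by rw [zero_add]; exact (hq u).2).2

end Sections


/-! ### The Helmholtz conditions of the dynamical form -/

section Helmholtz

variable {m n : ℕ} {U : Set (Coord m)} {V : Set (Coord n)} {B : Multiplier m n}
  {ΓM : Connection m} {ΓN : Connection n} {Ω : Set (Coord m)} {φ : Coord m → Coord n}

theorem dynForm_dW_along (hB : B.IsAdmissible U V) {x : Coord m} (hx : x ∈ U) (hy : φ x ∈ V)
    (ν μ : Fin n) (l p : Fin m) :
    ((dynForm (fun _ => 1) B ΓM ΓN ν).dW μ l p).along φ x = B x (φ x) l p μ ν :=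
  dynForm_dW hB.2 hx hy _ _ ν μ l p

theorem dynForm_dZ_along (hB : B.IsAdmissible U V) (hΓN : ΓN.IsSmoothSymmetric V)
    {x : Coord m} (hx : x ∈ U) (hy : φ x ∈ V) (ν μ : Fin n) (l : Fin m) :
    ((dynForm (fun _ => 1) B ΓM ΓN ν).dZ μ l).along φ x =
      -∑ i, ∑ j, B x (φ x) i j μ ν * ΓM x l i j
        + ∑ j, ∑ lam, (∑ σ, 2 * (B x (φ x) l j σ ν * ΓN (φ x) σ μ lam))
          * pd j (fun x' => φ x' lam) x :=
  dynForm_dZ hB.2 (fun y hy σ α lam => hΓN.2 y hy σ α lam) hx hy _ _ ν μ l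

theorem pd_dW_along (hU : IsOpen U) (hV : IsOpen V) (hB : B.IsAdmissible U V)
    (hφ : IsSection (U ×ˢ V) Ω φ) {x : Coord m} (hx : x ∈ Ω) (ν μ : Fin n) (l p k : Fin m) :
    pd k (((dynForm (fun _ => 1) B ΓM ΓN ν).dW μ l p).along φ) x =
      B.dx k x (φ x) l p μ ν
        + ∑ κ, B.dφ κ x (φ x) l p μ ν * pd k (fun x' => φ x' κ) x := by
  rw [pd_congr_of_eqOn k hφ.1 hx fun y hy =>
    dynForm_dW_along (x := y) hB (hφ.2.2 y hy).1 (hφ.2.2 y hy).2 ν μ l p]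
  exact Multiplier.IsSmoothOn.pd_along hB.1 hU hV (hφ.2.2 x hx).1 (hφ.2.2 x hx).2
    (hφ.2.1.differentiableAt_of_isOpen hφ.1 hx) k l p μ ν

theorem helmholtz1_iff (hU : IsOpen U) (hV : IsOpen V) (hB : B.IsAdmissible U V) :
    Helmholtz1 (U ×ˢ V) (dynForm (fun _ => 1) B ΓM ΓN) ↔ B.LowerSymm U V := by
  constructor
  · intro h x hx y hy i j σ ν
    -- The condition involves no derivatives of the section, so a section with vanishing first and
    -- second derivatives at `x` suffices.
    obtain ⟨Ω, φ, hφ, hxΩ, rfl, -, -⟩ := exists_isSection_jet hU hV hx hy 0 0 (by simp)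
    have := h Ω φ hφ x hxΩ σ ν i j
    rwa [dynForm_dW_along hB hx hy, dynForm_dW_along hB hx hy, sub_eq_zero] at this
  · intro h Ω φ hφ x hx μ ν l p
    obtain ⟨h1, h2⟩ := hφ.2.2 x hx
    rw [dynForm_dW_along hB h1 h2, dynForm_dW_along hB h1 h2, sub_eq_zero]
    exact h x h1 _ h2 l p μ ν

theorem Multiplier.LowerSymm.dx (hU : IsOpen U) (h : B.LowerSymm U V) (p : Fin m) :
    (B.dx p).LowerSymm U V := fun _ hx y hy i j σ ν =>
  pd_congr_of_eqOn p hU hx fun x' hx' => h x' hx' y hy i j σ ν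

theorem Multiplier.LowerSymm.dφ (hV : IsOpen V) (h : B.LowerSymm U V) (a : Fin n) :
    (B.dφ a).LowerSymm U V := fun x hx _ hy i j σ ν =>
  pd_congr_of_eqOn a hV hy fun y' hy' => h x hx y' hy' i j σ ν

theorem Multiplier.IsAdmissible.dx_symm (hU : IsOpen U) (hB : B.IsAdmissible U V) (p : Fin m) :
    ∀ x ∈ U, ∀ y ∈ V, ∀ i j σ ν, B.dx p x y i j σ ν = B.dx p x y j i σ ν :=
  fun _ hx y hy i j σ ν => pd_congr_of_eqOn p hU hx fun x' hx' => hB.2 x' hx' y hy i j σ ν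

theorem Multiplier.IsAdmissible.dφ_symm (hV : IsOpen V) (hB : B.IsAdmissible U V) (a : Fin n) :
    ∀ x ∈ U, ∀ y ∈ V, ∀ i j σ ν, B.dφ a x y i j σ ν = B.dφ a x y j i σ ν :=
  fun x hx _ hy i j σ ν => pd_congr_of_eqOn a hV hy fun y' hy' => hB.2 x hx y' hy' i j σ ν

theorem Multiplier.IsAdmissible.dx (hU : IsOpen U) (hV : IsOpen V) (hB : B.IsAdmissible U V)
    (p : Fin m) : (B.dx p).IsAdmissible U V :=
  ⟨Multiplier.IsSmoothOn.dx hB.1 hU hV p, hB.dx_symm hU p⟩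

theorem Multiplier.IsAdmissible.dφ (hU : IsOpen U) (hV : IsOpen V) (hB : B.IsAdmissible U V)
    (a : Fin n) : (B.dφ a).IsAdmissible U V :=
  ⟨Multiplier.IsSmoothOn.dφ hB.1 hU hV a, hB.dφ_symm hV a⟩

/-- Affine in the velocities, with the `HP21` defect as constant term and the `HP22` defect as
linear coefficient. Lower symmetry of `B` is what makes the total derivative combine with both
velocity terms. -/
theorem helmholtz2_expr (hU : IsOpen U) (hV : IsOpen V) (hB : B.IsAdmissible U V)
    (hΓN : ΓN.IsSmoothSymmetric V) (hs : B.LowerSymm U V) (hφ : IsSection (U ×ˢ V) Ω φ)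
    {x : Coord m} (hx : x ∈ Ω) (μ ν : Fin n) (l : Fin m) :
    ((dynForm (fun _ => 1) B ΓM ΓN ν).dZ μ l).along φ x
      + ((dynForm (fun _ => 1) B ΓM ΓN μ).dZ ν l).along φ x
      - 2 * ∑ p, pd p (((dynForm (fun _ => 1) B ΓM ΓN μ).dW ν l p).along φ) x =
    2 * ((-∑ i, ∑ j, B x (φ x) i j μ ν * ΓM x l i j - ∑ p, B.dx p x (φ x) l p μ ν)
      + ∑ j, ∑ lam, (∑ σ, ΓN (φ x) σ μ lam * B x (φ x) l j σ ν
          + ∑ σ, ΓN (φ x) σ ν lam * B x (φ x) l j σ μ - B.dφ lam x (φ x) l j μ ν)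
        * pd j (fun x' => φ x' lam) x) := by
  obtain ⟨h1, h2⟩ := hφ.2.2 x hx
  rw [dynForm_dZ_along hB hΓN h1 h2, dynForm_dZ_along hB hΓN h1 h2]
  simp only [pd_dW_along hU hV hB hφ hx, hs.dx hU _ x h1 _ h2 _ _ ν μ,
    hs.dφ hV _ x h1 _ h2 _ _ ν μ, hs x h1 _ h2 _ _ ν μ]
  have e1 : ∀ κ τ : Fin n, ∑ j, ∑ lam, (∑ σ, 2 * (B x (φ x) l j σ κ * ΓN (φ x) σ τ lam))
      * pd j (fun x' => φ x' lam) x =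
      2 * ∑ j, ∑ lam, (∑ σ, ΓN (φ x) σ τ lam * B x (φ x) l j σ κ)
        * pd j (fun x' => φ x' lam) x := by
    intro κ τ
    simp only [Finset.mul_sum, Finset.sum_mul]
    exact Finset.sum_congr rfl fun j _ => Finset.sum_congr rfl fun lam _ =>
      Finset.sum_congr rfl fun σ _ => by ring
  rw [e1, e1]
  simp only [add_mul, sub_mul, Finset.sum_add_distrib, Finset.sum_sub_distrib]
  ring

theorem helmholtz2_iff (hU : IsOpen U) (hV : IsOpen V) (hB : B.IsAdmissible U V)
    (hΓN : ΓN.IsSmoothSymmetric V) (hs : B.LowerSymm U V) :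
    Helmholtz2 (U ×ˢ V) (dynForm (fun _ => 1) B ΓM ΓN) ↔ HP21 U V B ΓM ∧ HP22 U V B ΓN := by
  constructor
  · intro h
    have key : ∀ x ∈ U, ∀ y ∈ V, ∀ (μ ν : Fin n) (l : Fin m),
        (-∑ i, ∑ j, B x y i j μ ν * ΓM x l i j - ∑ p, B.dx p x y l p μ ν) = 0 ∧
        ∀ j lam, (∑ σ, ΓN y σ μ lam * B x y l j σ ν
          + ∑ σ, ΓN y σ ν lam * B x y l j σ μ - B.dφ lam x y l j μ ν) = 0 := by
      intro x hx y hy μ ν l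
      refine affine_eq_zero fun u => ?_
      obtain ⟨Ω, φ, hφ, hxΩ, rfl, hu, -⟩ := exists_isSection_jet hU hV hx hy u 0 (by simp)
      have := h Ω φ hφ x hxΩ μ ν l
      rw [helmholtz2_expr hU hV hB hΓN hs hφ hxΩ] at this
      simp only [hu] at this
      linarith
    exact ⟨fun x hx y hy μ ν l => sub_eq_zero.1 (key x hx y hy μ ν l).1,
      fun x hx y hy i j μ ν lam => sub_eq_zero.1 ((key x hx y hy μ ν i).2 j lam)⟩
  · rintro ⟨h1, h2⟩ Ω φ hφ x hx μ ν l
    obtain ⟨hxU, hyV⟩ := hφ.2.2 x hx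
    rw [helmholtz2_expr hU hV hB hΓN hs hφ hx, h1 x hxU _ hyV, sub_self]
    simp [h2 x hxU _ hyV]

theorem pd_comp {k n : ℕ} {f : Coord n → ℝ} {φ : Coord k → Coord n} {x : Coord k}
    (hf : DifferentiableAt ℝ f (φ x)) (hφ : DifferentiableAt ℝ φ x) (i : Fin k) :
    pd i (fun x' => f (φ x')) x = ∑ a, pd a f (φ x) * pd i (fun x' => φ x' a) x := by
  have : pd i (fun x' => f (φ x')) x =
      pd i (fun _ => f (φ x)) x + ∑ a, pd a f (φ x) * pd i (fun x' => φ x' a) x :=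
    pd_comp_graph i (F := fun q : Coord k × Coord n => f q.2) (φ := φ) (x := x)
      (hf.comp (f := Prod.snd) (x, φ x) differentiableAt_snd) hφ
  rwa [pd_const, zero_add] at this

theorem pd_dZ_along (hU : IsOpen U) (hV : IsOpen V) (hB : B.IsAdmissible U V)
    (hΓM : ΓM.IsSmoothSymmetric U) (hΓN : ΓN.IsSmoothSymmetric V)
    (hφ : IsSection (U ×ˢ V) Ω φ) {x : Coord m} (hx : x ∈ Ω) (ν μ : Fin n) (l : Fin m) :
    pd l (((dynForm (fun _ => 1) B ΓM ΓN ν).dZ μ l).along φ) x =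
      -∑ i, ∑ j, ((B.dx l x (φ x) i j μ ν
            + ∑ κ, B.dφ κ x (φ x) i j μ ν * pd l (fun x' => φ x' κ) x) * ΓM x l i j
          + B x (φ x) i j μ ν * pd l (fun x' => ΓM x' l i j) x)
      + ∑ j, ∑ lam, ((∑ σ, 2 * ((B.dx l x (φ x) l j σ ν
            + ∑ κ, B.dφ κ x (φ x) l j σ ν * pd l (fun x' => φ x' κ) x) * ΓN (φ x) σ μ lam
          + B x (φ x) l j σ ν * ∑ κ, pd κ (fun y' => ΓN y' σ μ lam) (φ x)
            * pd l (fun x' => φ x' κ) x)) * pd j (fun x' => φ x' lam) x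
        + (∑ σ, 2 * (B x (φ x) l j σ ν * ΓN (φ x) σ μ lam))
          * pd l (pd j (fun x' => φ x' lam)) x) := by
  obtain ⟨h1, h2⟩ := hφ.2.2 x hx
  have hdφ := hφ.2.1.differentiableAt_of_isOpen hφ.1 hx
  have hBd := fun i j σ τ =>
    Multiplier.IsSmoothOn.differentiableAt_along hB.1 hU hV h1 h2 hdφ i j σ τ
  have hMd : ∀ k i j, DifferentiableAt ℝ (fun x' => ΓM x' k i j) x := fun k i j =>
    (hΓM.1 k i j).differentiableAt_of_isOpen hU h1
  have hNd' : ∀ σ α lam, DifferentiableAt ℝ (fun y' => ΓN y' σ α lam) (φ x) := fun σ α lam =>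
    (hΓN.1 σ α lam).differentiableAt_of_isOpen hV h2
  have hNd : ∀ σ α lam, DifferentiableAt ℝ (fun x' => ΓN (φ x') σ α lam) x := fun σ α lam =>
    (hNd' σ α lam).comp x hdφ
  have hud : ∀ lam j, DifferentiableAt ℝ (pd j fun x' => φ x' lam) x := fun lam j =>
    ((contDiffOn_apply hφ.2.1 lam).pd j hφ.1).differentiableAt_of_isOpen hφ.1 hx
  have d1 : ∀ i j, DifferentiableAt ℝ (fun y => B y (φ y) i j μ ν * ΓM y l i j) x := fun i j =>
    (hBd i j μ ν).mul (hMd l i j)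
  have d2 : ∀ i, DifferentiableAt ℝ (fun y => ∑ j, B y (φ y) i j μ ν * ΓM y l i j) x := fun i =>
    DifferentiableAt.fun_sum fun j _ => d1 i j
  have d3 : DifferentiableAt ℝ (fun y => -∑ i, ∑ j, B y (φ y) i j μ ν * ΓM y l i j) x :=
    (DifferentiableAt.fun_sum fun i _ => d2 i).fun_neg
  have e1 : ∀ j σ lam, DifferentiableAt ℝ (fun y => B y (φ y) l j σ ν * ΓN (φ y) σ μ lam) x :=
    fun j σ lam => (hBd l j σ ν).mul (hNd σ μ lam)
  have e2 : ∀ j lam, DifferentiableAt ℝ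
      (fun y => ∑ σ, 2 * (B y (φ y) l j σ ν * ΓN (φ y) σ μ lam)) x := fun j lam =>
    DifferentiableAt.fun_sum fun σ _ => (e1 j σ lam).const_mul 2
  have e3 : ∀ j lam, DifferentiableAt ℝ
      (fun y => (∑ σ, 2 * (B y (φ y) l j σ ν * ΓN (φ y) σ μ lam)) * pd j (fun x' => φ x' lam) y) x :=
    fun j lam => (e2 j lam).mul (hud lam j)
  have e4 : ∀ j, DifferentiableAt ℝ (fun y => ∑ lam,
      (∑ σ, 2 * (B y (φ y) l j σ ν * ΓN (φ y) σ μ lam)) * pd j (fun x' => φ x' lam) y) x :=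
    fun j => DifferentiableAt.fun_sum fun lam _ => e3 j lam
  rw [pd_congr_of_eqOn l hφ.1 hx fun y hy =>
    dynForm_dZ_along (x := y) hB hΓN (hφ.2.2 y hy).1 (hφ.2.2 y hy).2 ν μ l,
    pd_add l d3 (DifferentiableAt.fun_sum fun j _ => e4 j), pd_neg, pd_sum l fun i _ => d2 i,
    pd_sum l fun j _ => e4 j]
  congr 1
  · congr 1
    refine Finset.sum_congr rfl fun i _ => ?_
    rw [pd_sum l fun j _ => d1 i j]
    refine Finset.sum_congr rfl fun j _ => ?_
    rw [pd_mul l (hBd _ _ _ _) (hMd _ _ _), Multiplier.IsSmoothOn.pd_along hB.1 hU hV h1 h2 hdφ]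
  · refine Finset.sum_congr rfl fun j _ => ?_
    rw [pd_sum l fun lam _ => e3 j lam]
    refine Finset.sum_congr rfl fun lam _ => ?_
    rw [pd_mul l (e2 j lam) (hud lam j), pd_sum l fun σ _ => (e1 j σ lam).const_mul 2]
    congr 2
    refine Finset.sum_congr rfl fun σ _ => ?_
    rw [pd_const_mul l _ (e1 j σ lam), pd_mul l (hBd _ _ _ _) (hNd _ _ _),
      Multiplier.IsSmoothOn.pd_along hB.1 hU hV h1 h2 hdφ,
      pd_comp (f := fun y' => ΓN y' σ μ lam) (hNd' _ _ _) hdφ]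

theorem pd_pd_dW_along (hU : IsOpen U) (hV : IsOpen V) (hB : B.IsAdmissible U V)
    (hφ : IsSection (U ×ˢ V) Ω φ) {x : Coord m} (hx : x ∈ Ω) (ν μ : Fin n) (l p : Fin m) :
    pd l (pd p (((dynForm (fun _ => 1) B ΓM ΓN ν).dW μ l p).along φ)) x =
      (B.dx p).dx l x (φ x) l p μ ν
        + ∑ κ, (B.dx p).dφ κ x (φ x) l p μ ν * pd l (fun x' => φ x' κ) x
        + ∑ lam, (((B.dφ lam).dx l x (φ x) l p μ ν
            + ∑ κ, (B.dφ lam).dφ κ x (φ x) l p μ ν * pd l (fun x' => φ x' κ) x)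
            * pd p (fun x' => φ x' lam) x
          + B.dφ lam x (φ x) l p μ ν * pd l (pd p fun x' => φ x' lam) x) := by
  obtain ⟨h1, h2⟩ := hφ.2.2 x hx
  have hdφ := hφ.2.1.differentiableAt_of_isOpen hφ.1 hx
  have hBx := Multiplier.IsSmoothOn.dx hB.1 hU hV
  have hBφ := Multiplier.IsSmoothOn.dφ hB.1 hU hV
  have hud : ∀ lam j, DifferentiableAt ℝ (pd j fun x' => φ x' lam) x := fun lam j =>
    ((contDiffOn_apply hφ.2.1 lam).pd j hφ.1).differentiableAt_of_isOpen hφ.1 hx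
  have hd1 := (hBx p).differentiableAt_along hU hV h1 h2 hdφ l p μ ν
  have hd2 := fun lam => (hBφ lam).differentiableAt_along hU hV h1 h2 hdφ l p μ ν
  rw [pd_congr_of_eqOn l hφ.1 hx fun y hy => pd_dW_along hU hV hB hφ hy ν μ l p p,
    pd_add l hd1 (by fun_prop), pd_sum l fun i _ => by fun_prop,
    (hBx p).pd_along hU hV h1 h2 hdφ]
  congr 1
  refine Finset.sum_congr rfl fun lam _ => ?_
  rw [pd_mul l (hd2 lam) (hud lam p), (hBφ lam).pd_along hU hV h1 h2 hdφ]

theorem coeff31_symm (hV : IsOpen V) (hB : B.IsAdmissible U V) {x : Coord m}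
    {y : Coord n} (hx : x ∈ U) (hy : y ∈ V) (i j : Fin m) (μ ν σ : Fin n) :
    coeff31 B ΓN x y i j μ ν σ = coeff31 B ΓN x y j i μ ν σ := by
  simp only [coeff31, hB.dφ_symm hV _ x hx y hy i j, hB.2 x hx y hy i j]

theorem pd_connection_symm (hV : IsOpen V) (hΓN : ΓN.IsSmoothSymmetric V) {y : Coord n}
    (hy : y ∈ V) (a σ α lam : Fin n) :
    pd a (fun y' => ΓN y' σ α lam) y = pd a (fun y' => ΓN y' σ lam α) y :=
  pd_congr_of_eqOn a hV hy fun y' hy' => hΓN.2 y' hy' σ α lam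

theorem dφ_dφ_comm (hV : IsOpen V) (hB : B.IsSmoothOn U V) {x : Coord m}
    {y : Coord n} (hx : x ∈ U) (hy : y ∈ V) (i j : Fin m) (α lam μ ν : Fin n) :
    (B.dφ α).dφ lam x y i j μ ν = (B.dφ lam).dφ α x y i j μ ν :=
  pd_comm lam α ((contDiffOn_slice_right (f := fun x y => B x y i j μ ν) (hB i j μ ν)
    hx).contDiffAt (hV.mem_nhds hy))

/-- Provides the symmetry that `jetPolynomial_eq_zero` demands. The `α` and `lam` terms change
places, the others are invariant because the connection is torsion-free and second derivatives
commute. -/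
theorem coeff32_symm (hV : IsOpen V) (hU : IsOpen U) (hB : B.IsAdmissible U V)
    (hΓN : ΓN.IsSmoothSymmetric V) {x : Coord m}
    {y : Coord n} (hx : x ∈ U) (hy : y ∈ V) (i j : Fin m) (μ ν α lam : Fin n) :
    coeff32 B ΓN x y i j μ ν α lam = coeff32 B ΓN x y j i μ ν lam α := by
  unfold coeff32
  congr 1
  · refine Finset.sum_congr rfl fun σ _ => ?_
    simp only [hB.dφ_symm hV _ x hx y hy i j, hB.2 x hx y hy i j, hΓN.2 y hy σ lam α,
      pd_connection_symm hV hΓN hy _ σ lam α, hΓN.2 y hy σ lam μ, hΓN.2 y hy σ α μ,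
      pd_connection_symm hV hΓN hy _ σ lam μ, pd_connection_symm hV hΓN hy _ σ α μ]
    ring
  · rw [dφ_dφ_comm hV hB.1 hx hy, (hB.dφ hU hV lam).dφ_symm hV α x hx y hy]

/-- The three groups of derivatives are expanded as jet polynomials and collected by monomial. The
indices of the coefficients come out as `ν μ`, since the total-divergence terms differentiate `ε_μ`
with respect to `φ^ν`; as both indices are arbitrary, this is harmless. -/
theorem helmholtz3_expr (hU : IsOpen U) (hV : IsOpen V) (hB : B.IsAdmissible U V)
    (hΓM : ΓM.IsSmoothSymmetric U) (hΓN : ΓN.IsSmoothSymmetric V)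
    (hφ : IsSection (U ×ˢ V) Ω φ) {x : Coord m} (hx : x ∈ Ω) (μ ν : Fin n) :
    ((dynForm (fun _ => 1) B ΓM ΓN ν).dY μ).along φ x
      - ((dynForm (fun _ => 1) B ΓM ΓN μ).dY ν).along φ x
      + ∑ l, pd l (((dynForm (fun _ => 1) B ΓM ΓN μ).dZ ν l).along φ) x
      - ∑ l, ∑ p, pd l (pd p (((dynForm (fun _ => 1) B ΓM ΓN μ).dW ν l p).along φ)) x =
    ∑ i, ∑ j, ∑ σ, coeff31 B ΓN x (φ x) i j ν μ σ * pd j (pd i fun x' => φ x' σ) x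
      + ∑ i, ∑ j, ∑ α, ∑ lam, coeff32 B ΓN x (φ x) i j ν μ α lam
        * pd i (fun x' => φ x' α) x * pd j (fun x' => φ x' lam) x
      + ∑ k, ∑ σ, coeff33 B ΓM ΓN x (φ x) k ν μ σ * pd k (fun x' => φ x' σ) x
      + coeff34 B ΓM x (φ x) ν μ := by
  obtain ⟨h1, h2⟩ := hφ.2.2 x hx
  set u : Fin n → Fin m → ℝ := fun σ i => pd i (fun x' => φ x' σ) x with hu
  set w : Fin n → Fin m → Fin m → ℝ := fun σ i j => pd j (pd i fun x' => φ x' σ) x with hwdef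
  have hw : ∀ σ i j, w σ i j = w σ j i := fun σ i j =>
    pd_comm j i ((contDiffOn_apply hφ.2.1 σ).contDiffAt (hφ.1.mem_nhds hx))
  have eY : ∀ ν μ : Fin n, ((dynForm (fun _ => 1) B ΓM ΓN ν).dY μ).along φ x = _ := fun ν μ =>
    (dynForm_dY hV hB.1 hΓN h1 h2 u w ν μ).trans (sum_dY_expand (fun k i j => ΓM x k i j)
      (fun σ α lam => ΓN (φ x) σ α lam) (fun σ α lam => pd μ (fun y' => ΓN y' σ α lam) (φ x)) u w
      (fun i j σ => B.dφ μ x (φ x) i j σ ν) (fun i j σ => B x (φ x) i j σ ν))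
  have eZ := (Finset.sum_congr rfl fun l _ => pd_dZ_along hU hV hB hΓM hΓN hφ hx μ ν l).trans
    (sum_dZ_expand (fun l i j => ΓM x l i j) u w
      (fun l i j => pd l (fun x' => ΓM x' l i j) x) (fun i j => B x (φ x) i j ν μ)
      (fun l i j => B.dx l x (φ x) i j ν μ) (fun κ i j => B.dφ κ x (φ x) i j ν μ)
      (fun i j σ => B x (φ x) i j σ μ) (fun l i j σ => B.dx l x (φ x) i j σ μ)
      (fun κ i j σ => B.dφ κ x (φ x) i j σ μ) (fun σ lam => ΓN (φ x) σ ν lam)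
      (fun κ σ lam => pd κ (fun y' => ΓN y' σ ν lam) (φ x)) hw)
  have eW := (Finset.sum_congr rfl fun l _ => Finset.sum_congr rfl fun p _ =>
    pd_pd_dW_along (ΓM := ΓM) (ΓN := ΓN) hU hV hB hφ hx μ ν l p).trans
    (sum_dW_expand u w (fun l p i j => (B.dx p).dx l x (φ x) i j ν μ)
      (fun κ p i j => (B.dx p).dφ κ x (φ x) i j ν μ)
      (fun l lam i j => (B.dφ lam).dx l x (φ x) i j ν μ)
      (fun κ lam i j => (B.dφ lam).dφ κ x (φ x) i j ν μ)
      (fun lam i j => B.dφ lam x (φ x) i j ν μ) hw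
      (fun p κ i j => pd_left_pd_right_comm hU hV (f := fun x y => B x y i j ν μ)
        (hB.1 i j ν μ) h1 h2 p κ)
      (fun κ p i j => (hB.dx hU hV p).dφ_symm hV κ x h1 _ h2 i j ν μ)
      (fun κ lam i j => (hB.dφ hU hV lam).dφ_symm hV κ x h1 _ h2 i j ν μ))
  rw [eY, eY, eZ, eW]
  have g1 : ∑ i, ∑ j, ∑ σ, coeff31 B ΓN x (φ x) i j ν μ σ * w σ i j =
      ∑ i, ∑ j, ∑ σ, B.dφ μ x (φ x) i j σ ν * w σ i j
      - ∑ i, ∑ j, ∑ σ, B.dφ ν x (φ x) i j σ μ * w σ i j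
      + ∑ i, ∑ j, ∑ lam, (∑ σ, 2 * (B x (φ x) i j σ μ * ΓN (φ x) σ ν lam)) * w lam i j
      - ∑ i, ∑ j, ∑ lam, B.dφ lam x (φ x) i j ν μ * w lam i j := by
    simp only [← Finset.sum_add_distrib, ← Finset.sum_sub_distrib]
    refine Finset.sum_congr rfl fun i _ => Finset.sum_congr rfl fun j _ =>
      Finset.sum_congr rfl fun σ _ => ?_
    simp only [coeff31, hΓN.2 _ h2 _ σ ν, ← Finset.mul_sum]
    ring
  have g2 : ∑ i, ∑ j, ∑ α, ∑ lam, coeff32 B ΓN x (φ x) i j ν μ α lam * u α i * u lam j =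
      ∑ i, ∑ j, ∑ α, ∑ lam, (∑ σ, (B.dφ μ x (φ x) i j σ ν * ΓN (φ x) σ α lam
          + B x (φ x) i j σ ν * pd μ (fun y' => ΓN y' σ α lam) (φ x))) * u α i * u lam j
      - ∑ i, ∑ j, ∑ α, ∑ lam, (∑ σ, (B.dφ ν x (φ x) i j σ μ * ΓN (φ x) σ α lam
          + B x (φ x) i j σ μ * pd ν (fun y' => ΓN y' σ α lam) (φ x))) * u α i * u lam j
      + ∑ i, ∑ j, ∑ κ, ∑ lam, (2 * ∑ σ, (B.dφ κ x (φ x) i j σ μ * ΓN (φ x) σ ν lam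
          + B x (φ x) i j σ μ * pd κ (fun y' => ΓN y' σ ν lam) (φ x))) * u κ i * u lam j
      - ∑ i, ∑ j, ∑ κ, ∑ lam, (B.dφ κ).dφ lam x (φ x) i j ν μ * u κ i * u lam j := by
    -- The doubled term is split into two halves with velocity slots exchanged, matching the
    -- separate `α` and `lam` terms of `coeff32`.
    have hh : ∑ i, ∑ j, ∑ κ, ∑ lam, (2 * ∑ σ, (B.dφ κ x (φ x) i j σ μ * ΓN (φ x) σ ν lam
          + B x (φ x) i j σ μ * pd κ (fun y' => ΓN y' σ ν lam) (φ x))) * u κ i * u lam j =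
        ∑ i, ∑ j, ∑ κ, ∑ lam, (∑ σ, (B.dφ κ x (φ x) i j σ μ * ΓN (φ x) σ ν lam
          + B x (φ x) i j σ μ * pd κ (fun y' => ΓN y' σ ν lam) (φ x))) * u κ i * u lam j
        + ∑ i, ∑ j, ∑ κ, ∑ lam, (∑ σ, (B.dφ lam x (φ x) i j σ μ * ΓN (φ x) σ κ ν
          + B x (φ x) i j σ μ * pd lam (fun y' => ΓN y' σ κ ν) (φ x))) * u κ i * u lam j := by
      have e2 : ∑ i, ∑ j, ∑ κ, ∑ lam, (∑ σ, (B.dφ lam x (φ x) i j σ μ * ΓN (φ x) σ κ ν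
          + B x (φ x) i j σ μ * pd lam (fun y' => ΓN y' σ κ ν) (φ x))) * u κ i * u lam j =
        ∑ i, ∑ j, ∑ κ, ∑ lam, (∑ σ, (B.dφ lam x (φ x) j i σ μ * ΓN (φ x) σ ν κ
          + B x (φ x) j i σ μ * pd lam (fun y' => ΓN y' σ ν κ) (φ x))) * u κ i * u lam j := by
        refine Finset.sum_congr rfl fun i _ => Finset.sum_congr rfl fun j _ =>
          Finset.sum_congr rfl fun κ _ => Finset.sum_congr rfl fun lam _ => ?_
        simp only [hB.dφ_symm hV _ x h1 _ h2 i j, hB.2 x h1 _ h2 i j, hΓN.2 _ h2 _ κ ν,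
          pd_connection_symm hV hΓN h2 _ _ κ ν]
      have e3 := sum_quadratic_symm u (fun i j κ lam => ∑ σ, (B.dφ κ x (φ x) i j σ μ
          * ΓN (φ x) σ ν lam
          + B x (φ x) i j σ μ * pd κ (fun y' => ΓN y' σ ν lam) (φ x)))
      rw [e2, ← e3, ← two_mul]
      simp only [Finset.mul_sum, Finset.sum_mul, mul_assoc]
    rw [hh]
    simp only [← Finset.sum_add_distrib, ← Finset.sum_sub_distrib]
    refine Finset.sum_congr rfl fun i _ => Finset.sum_congr rfl fun j _ =>
      Finset.sum_congr rfl fun α _ => Finset.sum_congr rfl fun lam _ => ?_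
    simp only [coeff32, ← add_mul, ← sub_mul]
    congr 3
    simp only [← Finset.sum_add_distrib, ← Finset.sum_sub_distrib]
    exact Finset.sum_congr rfl fun σ _ => by ring
  have g3 : ∑ k, ∑ σ, coeff33 B ΓM ΓN x (φ x) k ν μ σ * u σ k =
      -(∑ k, ∑ σ, (∑ i, ∑ j, ΓM x k i j * B.dφ μ x (φ x) i j σ ν) * u σ k)
      + ∑ k, ∑ σ, (∑ i, ∑ j, ΓM x k i j * B.dφ ν x (φ x) i j σ μ) * u σ k
      + ∑ k, ∑ σ, (2 * (∑ l, ∑ lam, B.dx l x (φ x) l k lam μ * ΓN (φ x) lam ν σ)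
          - ∑ i, ∑ j, ΓM x k i j * B.dφ σ x (φ x) i j ν μ) * u σ k
      - ∑ k, ∑ σ, (2 * ∑ p, (B.dx p).dφ σ x (φ x) k p ν μ) * u σ k := by
    simp only [← Finset.sum_add_distrib, ← Finset.sum_sub_distrib, ← Finset.sum_neg_distrib]
    refine Finset.sum_congr rfl fun k _ => Finset.sum_congr rfl fun σ _ => ?_
    have hc : ∀ p, (B.dφ σ).dx p x (φ x) k p ν μ = (B.dx p).dφ σ x (φ x) k p ν μ := fun p =>
      pd_left_pd_right_comm hU hV (f := fun x y => B x y k p ν μ) (hB.1 k p ν μ) h1 h2 p σ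
    simp only [coeff33, hc, mul_sub, Finset.sum_sub_distrib]
    ring
  rw [g1, g2, g3]
  simp only [coeff34]
  ring

theorem helmholtz3_iff (hU : IsOpen U) (hV : IsOpen V) (hB : B.IsAdmissible U V)
    (hΓM : ΓM.IsSmoothSymmetric U) (hΓN : ΓN.IsSmoothSymmetric V) :
    Helmholtz3 (U ×ˢ V) (dynForm (fun _ => 1) B ΓM ΓN) ↔
      ∀ x ∈ U, ∀ y ∈ V,
        (∀ i j μ ν σ, coeff31 B ΓN x y i j μ ν σ = 0) ∧
        (∀ i j μ ν α lam, coeff32 B ΓN x y i j μ ν α lam = 0) ∧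
        (∀ k μ ν σ, coeff33 B ΓM ΓN x y k μ ν σ = 0) ∧
        (∀ μ ν, coeff34 B ΓM x y μ ν = 0) := by
  constructor
  · intro h x hx y hy
    have key := fun ν μ : Fin n => jetPolynomial_eq_zero
      (t := coeff34 B ΓM x y ν μ) (c₁ := fun i j σ => coeff31 B ΓN x y i j ν μ σ)
      (c₂ := fun i j α lam => coeff32 B ΓN x y i j ν μ α lam)
      (c₃ := fun k σ => coeff33 B ΓM ΓN x y k ν μ σ)
      (fun i j σ => coeff31_symm hV hB hx hy i j ν μ σ)
      (fun i j α lam => coeff32_symm hV hU hB hΓN hx hy i j ν μ α lam) (by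
        intro u w hw
        obtain ⟨Ω, φ, hφ, hxΩ, rfl, hu, hww⟩ := exists_isSection_jet hU hV hx hy u w hw
        have := h Ω φ hφ x hxΩ μ ν
        rw [helmholtz3_expr hU hV hB hΓM hΓN hφ hxΩ] at this
        simpa only [hu, hww] using this)
    exact ⟨fun i j μ ν σ => (key μ ν).1 i j σ, fun i j μ ν α lam => (key μ ν).2.1 i j α lam,
      fun k μ ν σ => (key μ ν).2.2.1 k σ, fun μ ν => (key μ ν).2.2.2⟩
  · intro h Ω φ hφ x hx μ ν
    obtain ⟨h1, h2⟩ := hφ.2.2 x hx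
    obtain ⟨k1, k2, k3, k4⟩ := h x h1 _ h2
    rw [helmholtz3_expr hU hV hB hΓM hΓN hφ hx]
    simp [k1, k2, k3, k4]

end Helmholtz


/-! ### Parallel symmetric tensors -/

section Parallel

variable {n : ℕ} {V : Set (Coord n)} {Γ : Connection n}

/-- The symmetric tensor `b` is parallel at `y`. -/
def IsParallelAt (Γ : Connection n) (b : Coord n → Fin n → Fin n → ℝ) (y : Coord n) : Prop :=
  ∀ μ ν lam, ∑ σ, Γ y σ μ lam * b y σ ν + ∑ σ, Γ y σ ν lam * b y σ μ = pd lam (fun y' => b y' μ ν) y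

/-- The connection coefficients with the upper index lowered by `b`. -/
def lowered (Γ : Connection n) (b : Coord n → Fin n → Fin n → ℝ) (c α lam : Fin n)
    (y : Coord n) : ℝ :=
  ∑ σ, b y σ c * Γ y σ α lam

theorem IsParallelAt.lowered_add {b : Coord n → Fin n → Fin n → ℝ} {y : Coord n}
    (h : IsParallelAt Γ b y) (μ ν lam : Fin n) :
    lowered Γ b ν μ lam y + lowered Γ b μ ν lam y = pd lam (fun y' => b y' μ ν) y := by
  rw [← h μ ν lam]
  simp only [lowered, mul_comm]

theorem lowered_symm {b : Coord n → Fin n → Fin n → ℝ} {y : Coord n}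
    (hΓ : ∀ σ α lam, Γ y σ α lam = Γ y σ lam α) (c α lam : Fin n) :
    lowered Γ b c α lam y = lowered Γ b c lam α y := by
  simp only [lowered, hΓ _ α lam]

/-- The Koszul formula. -/
theorem IsParallelAt.two_mul_lowered {b : Coord n → Fin n → Fin n → ℝ} {y : Coord n}
    (hΓ : ∀ σ α lam, Γ y σ α lam = Γ y σ lam α)
    (h : IsParallelAt Γ b y) (c α lam : Fin n) :
    2 * lowered Γ b c α lam y = pd lam (fun y' => b y' α c) y + pd α (fun y' => b y' lam c) y
      - pd c (fun y' => b y' α lam) y := by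
  have h1 := h.lowered_add α c lam
  have h2 := h.lowered_add lam c α
  have h3 := h.lowered_add α lam c
  have s1 := lowered_symm hΓ (b := b) c lam α
  have s2 := lowered_symm hΓ (b := b) lam α c
  have s3 := lowered_symm hΓ (b := b) α lam c
  linarith

/-- Converse of the Koszul formula: on adding the versions with `μ` and `ν` exchanged, all
derivatives cancel except that in the direction `lam`. No regularity of `b` is involved. -/
theorem isParallelAt_of_two_mul_lowered {b : Coord n → Fin n → Fin n → ℝ} {y : Coord n}
    (hV : IsOpen V) (hy : y ∈ V) (hs : ∀ y ∈ V, ∀ σ ν, b y σ ν = b y ν σ)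
    (h : ∀ c α lam, 2 * lowered Γ b c α lam y = pd lam (fun y' => b y' α c) y
      + pd α (fun y' => b y' lam c) y - pd c (fun y' => b y' α lam) y) :
    IsParallelAt Γ b y := by
  intro μ ν lam
  have h1 := h ν μ lam
  have h2 := h μ ν lam
  have e1 : pd lam (fun y' => b y' ν μ) y = pd lam (fun y' => b y' μ ν) y :=
    pd_congr_of_eqOn lam hV hy fun y' hy' => hs y' hy' ν μ
  have e2 : pd μ (fun y' => b y' lam ν) y = pd μ (fun y' => b y' ν lam) y :=
    pd_congr_of_eqOn μ hV hy fun y' hy' => hs y' hy' lam ν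
  have e3 : pd ν (fun y' => b y' lam μ) y = pd ν (fun y' => b y' μ lam) y :=
    pd_congr_of_eqOn ν hV hy fun y' hy' => hs y' hy' lam μ
  simp only [lowered] at h1 h2
  simp only [mul_comm (Γ y _ _ _)]
  linarith

theorem pd_lowered {b : Coord n → Fin n → Fin n → ℝ} {y : Coord n} (hV : IsOpen V) (hy : y ∈ V)
    (hb : ∀ σ ν, ContDiffOn ℝ ∞ (fun y => b y σ ν) V) (hΓ : Γ.IsSmoothSymmetric V)
    (a c α lam : Fin n) :
    pd a (lowered Γ b c α lam) y =
      ∑ σ, (pd a (fun y' => b y' σ c) y * Γ y σ α lam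
        + b y σ c * pd a (fun y' => Γ y' σ α lam) y) := by
  have hbd := fun σ => (hb σ c).differentiableAt_of_isOpen hV hy
  have hΓd := fun σ => (hΓ.1 σ α lam).differentiableAt_of_isOpen hV hy
  unfold lowered
  rw [pd_sum a fun σ _ => (hbd σ).fun_mul (hΓd σ)]
  exact Finset.sum_congr rfl fun σ _ => pd_mul a (hbd σ) (hΓd σ)

theorem contDiffOn_lowered {b : Coord n → Fin n → Fin n → ℝ}
    (hb : ∀ σ ν, ContDiffOn ℝ ∞ (fun y => b y σ ν) V) (hΓ : Γ.IsSmoothSymmetric V)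
    (c α lam : Fin n) : ContDiffOn ℝ ∞ (lowered Γ b c α lam) V :=
  ContDiffOn.sum fun σ _ => (hb σ c).mul (hΓ.1 σ α lam)

/-- The curvature with its upper index lowered by a parallel tensor. -/
theorem sum_mul_curvature {b : Coord n → Fin n → Fin n → ℝ} {y : Coord n} (hV : IsOpen V)
    (hy : y ∈ V) (hb : ∀ σ ν, ContDiffOn ℝ ∞ (fun y => b y σ ν) V) (hΓ : Γ.IsSmoothSymmetric V)
    (h : IsParallelAt Γ b y) (μ lam ν α : Fin n) :
    ∑ β, b y β μ * curvature Γ y β lam ν α =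
      pd ν (lowered Γ b μ α lam) y - pd α (lowered Γ b μ ν lam) y
        - ∑ β, lowered Γ b β μ ν y * Γ y β α lam + ∑ β, lowered Γ b β μ α y * Γ y β ν lam := by
  have e1 : ∑ β, b y β μ * curvature Γ y β lam ν α =
      ∑ β, b y β μ * pd ν (fun y' => Γ y' β α lam) y - ∑ β, b y β μ * pd α (fun y' => Γ y' β ν lam) y
        + (∑ κ, lowered Γ b μ ν κ y * Γ y κ α lam - ∑ κ, lowered Γ b μ α κ y * Γ y κ ν lam) := by
    have : ∀ a c, ∑ κ, lowered Γ b μ a κ y * Γ y κ c lam =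
        ∑ β, b y β μ * ∑ κ, Γ y β a κ * Γ y κ c lam := by
      intro a c
      simp only [lowered, Finset.sum_mul, Finset.mul_sum, mul_assoc]
      exact Finset.sum_comm
    simp only [this, curvature, Finset.sum_sub_distrib, mul_add, mul_sub, Finset.sum_add_distrib]
  -- Parallelism trades one lowered symbol for a derivative of `b`, which later cancels against the
  -- product rule for the derivative of `lowered`.
  have e2 : ∀ a c, ∑ κ, lowered Γ b μ a κ y * Γ y κ c lam =
      ∑ κ, pd a (fun y' => b y' κ μ) y * Γ y κ c lam - ∑ κ, lowered Γ b κ μ a y * Γ y κ c lam := by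
    intro a c
    rw [← Finset.sum_sub_distrib]
    refine Finset.sum_congr rfl fun κ _ => ?_
    rw [← h.lowered_add κ μ a, lowered_symm (hΓ.2 y hy) μ κ a]
    ring
  rw [e1, e2, e2, pd_lowered hV hy hb hΓ, pd_lowered hV hy hb hΓ]
  simp only [Finset.sum_add_distrib]
  ring

/-- Both sides are the value of the symmetric bilinear form `b` on the same pair of vectors of
connection coefficients. -/
theorem sum_lowered_comm {b : Coord n → Fin n → Fin n → ℝ} {y : Coord n}
    (hs : ∀ σ ν, b y σ ν = b y ν σ) (α β γ δ : Fin n) :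
    ∑ κ, lowered Γ b κ α β y * Γ y κ γ δ = ∑ κ, lowered Γ b κ γ δ y * Γ y κ α β := by
  simp only [lowered, Finset.sum_mul]
  rw [Finset.sum_comm]
  refine Finset.sum_congr rfl fun κ _ => Finset.sum_congr rfl fun σ _ => ?_
  rw [hs κ σ]
  ring

theorem sum_lowered_congr {b : Coord n → Fin n → Fin n → ℝ} {y : Coord n}
    (hΓ : ∀ σ α lam, Γ y σ α lam = Γ y σ lam α) (α β γ δ : Fin n) :
    ∑ κ, lowered Γ b κ α β y * Γ y κ γ δ = ∑ κ, lowered Γ b κ β α y * Γ y κ δ γ := by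
  refine Finset.sum_congr rfl fun κ _ => ?_
  rw [lowered_symm hΓ, hΓ κ γ δ]

/-- Torsion-freeness and symmetry of `b` cancel the products of connection coefficients, so the
difference is linear in first derivatives of the lowered symbols. The same combination arises from
`coeff32`. -/
theorem sum_mul_curvature_sub {b : Coord n → Fin n → Fin n → ℝ} {y : Coord n} (hV : IsOpen V)
    (hy : y ∈ V) (hb : ∀ σ ν, ContDiffOn ℝ ∞ (fun y => b y σ ν) V) (hΓ : Γ.IsSmoothSymmetric V)
    (hs : ∀ y ∈ V, ∀ σ ν, b y σ ν = b y ν σ)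
    (h : IsParallelAt Γ b y) (μ lam ν α : Fin n) :
    ∑ β, b y β μ * curvature Γ y β lam ν α - ∑ σ, b y σ ν * curvature Γ y σ α μ lam =
      pd ν (lowered Γ b μ α lam) y - pd α (lowered Γ b μ ν lam) y
        - pd μ (lowered Γ b ν α lam) y + pd lam (lowered Γ b ν α μ) y := by
  rw [sum_mul_curvature hV hy hb hΓ h, sum_mul_curvature hV hy hb hΓ h]
  have hc : ∀ a c α lam, pd a (lowered Γ b c α lam) y = pd a (lowered Γ b c lam α) y :=
    fun a c α lam => pd_congr_of_eqOn a hV hy fun y' hy' => lowered_symm (hΓ.2 y' hy') c α lam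
  rw [hc μ ν lam α, hc lam ν μ α, sum_lowered_congr (hΓ.2 y hy) ν μ lam α,
    sum_lowered_comm (hs y hy) ν lam μ α]
  ring

/-- Pair symmetry of the curvature lowered by a parallel symmetric tensor. -/
theorem sum_mul_curvature_symm {b : Coord n → Fin n → Fin n → ℝ} {y : Coord n} (hV : IsOpen V)
    (hy : y ∈ V) (hb : ∀ σ ν, ContDiffOn ℝ ∞ (fun y => b y σ ν) V) (hΓ : Γ.IsSmoothSymmetric V)
    (hs : ∀ y ∈ V, ∀ σ ν, b y σ ν = b y ν σ)
    (h : ∀ y ∈ V, IsParallelAt Γ b y) (μ lam ν α : Fin n) :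
    ∑ β, b y β μ * curvature Γ y β lam ν α = ∑ σ, b y σ ν * curvature Γ y σ α μ lam := by
  rw [← sub_eq_zero, sum_mul_curvature_sub hV hy hb hΓ hs (h y hy)]
  have hd : ∀ a σ ν, DifferentiableAt ℝ (pd a fun y => b y σ ν) y := fun a σ ν =>
    ((hb σ ν).pd a hV).differentiableAt_of_isOpen hV hy
  -- The differentiated Koszul formula turns all four terms into second derivatives of `b`, which
  -- cancel by commuting partial derivatives and the symmetry of `b`.
  have key : ∀ a c α lam, 2 * pd a (lowered Γ b c α lam) y =
      pd a (pd lam fun y' => b y' α c) y + pd a (pd α fun y' => b y' lam c) y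
        - pd a (pd c fun y' => b y' α lam) y := by
    intro a c α lam
    rw [← pd_const_mul a 2 ((contDiffOn_lowered hb hΓ c α lam).differentiableAt_of_isOpen hV hy),
      pd_congr_of_eqOn a hV hy fun y' hy' =>
        (h y' hy').two_mul_lowered (hΓ.2 y' hy') c α lam,
      pd_sub a ((hd _ _ _).fun_add (hd _ _ _)) (hd _ _ _), pd_add a (hd _ _ _) (hd _ _ _)]
  have hcm : ∀ a c σ ν, pd a (pd c fun y' => b y' σ ν) y = pd c (pd a fun y' => b y' σ ν) y :=
    fun a c σ ν => pd_comm a c ((hb σ ν).contDiffAt (hV.mem_nhds hy))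
  have hss : ∀ a c σ ν, pd a (pd c fun y' => b y' σ ν) y = pd a (pd c fun y' => b y' ν σ) y :=
    fun a c σ ν => pd_congr_of_eqOn a hV hy fun y' hy' =>
      pd_congr_of_eqOn c hV hy' fun y'' hy'' => hs y'' hy'' σ ν
  have k1 := key ν μ α lam
  have k2 := key α μ ν lam
  have k3 := key μ ν α lam
  have k4 := key lam ν α μ
  have t1 := (hcm α lam ν μ).trans (hss lam α ν μ)
  have t2 := (hcm α μ ν lam).trans (hss μ α ν lam)
  linarith [hcm ν lam α μ, hcm ν α lam μ, hcm ν μ α lam, hcm μ lam α ν]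

end Parallel


/-! ### Relations between the Helmholtz coefficients -/

section Relations

variable {m n : ℕ} {U : Set (Coord m)} {V : Set (Coord n)} {B : Multiplier m n}
  {ΓM : Connection m} {ΓN : Connection n}

theorem coeff31_eq (hΓN : ΓN.IsSmoothSymmetric V) {x : Coord m} {y : Coord n} (hy : y ∈ V)
    (i j : Fin m) (μ ν σ : Fin n) :
    coeff31 B ΓN x y i j μ ν σ = B.dφ ν x y i j σ μ - B.dφ μ x y i j σ ν - B.dφ σ x y i j μ ν
      + 2 * lowered ΓN (B x · i j) ν μ σ y := by
  simp only [coeff31, lowered, hΓN.2 y hy _ σ μ]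
  ring

/-- For fixed `x`, `i`, `j` the vanishing of `P` is the Koszul formula for `B^{ij}`, which for a
torsion-free connection and symmetric `B^{ij}` is equivalent to parallelism. -/
theorem coeff31_iff (hV : IsOpen V) (hΓN : ΓN.IsSmoothSymmetric V)
    (hs : B.LowerSymm U V) :
    (∀ x ∈ U, ∀ y ∈ V, ∀ i j μ ν σ, coeff31 B ΓN x y i j μ ν σ = 0) ↔ HP22 U V B ΓN := by
  constructor
  · intro h x hx y hy i j
    refine isParallelAt_of_two_mul_lowered hV hy (fun y hy σ ν => hs x hx y hy i j σ ν) ?_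
    intro c α lam
    have h1 := h x hx y hy i j α c lam
    rw [coeff31_eq hΓN hy, hs.dφ hV _ x hx y hy i j α c] at h1
    have e1 : pd lam (fun y' => B x y' i j α c) y = B.dφ lam x y i j c α :=
      hs.dφ hV _ x hx y hy i j α c
    have e2 : pd c (fun y' => B x y' i j α lam) y = B.dφ c x y i j lam α :=
      hs.dφ hV _ x hx y hy i j α lam
    have e3 : pd α (fun y' => B x y' i j lam c) y = B.dφ α x y i j lam c := rfl
    rw [e1, e2, e3]
    linarith
  · intro h x hx y hy i j μ ν σ
    have h1 := IsParallelAt.two_mul_lowered (b := fun y => B x y i j) (hΓN.2 y hy)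
      (h x hx y hy i j) ν μ σ
    have e1 : pd ν (fun y' => B x y' i j μ σ) y = B.dφ ν x y i j σ μ :=
      hs.dφ hV _ x hx y hy i j μ σ
    rw [coeff31_eq hΓN hy, h1, e1]
    simp only [Multiplier.dφ]
    ring

/-- `HP21` and its derivative along the fibre convert both terms with base derivatives of `B` into
contractions with `ΓM`; what is contracted is then `P` up to sign. -/
theorem coeff33_eq (hU : IsOpen U) (hV : IsOpen V) (hB : B.IsAdmissible U V)
    (hΓN : ΓN.IsSmoothSymmetric V) (h : HP21 U V B ΓM) {x : Coord m} {y : Coord n}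
    (hx : x ∈ U) (hy : y ∈ V) (k : Fin m) (μ ν σ : Fin n) :
    coeff33 B ΓM ΓN x y k μ ν σ = -∑ i, ∑ j, ΓM x k i j * coeff31 B ΓN x y i j μ ν σ := by
  have e1 : ∑ l, ∑ lam, B.dx l x y l k lam ν * ΓN y lam μ σ =
      -∑ i, ∑ j, ΓM x k i j * lowered ΓN (B x · i j) ν μ σ y := by
    have h1 : ∀ lam, ∑ l, B.dx l x y l k lam ν = -∑ i, ∑ j, B x y i j lam ν * ΓM x k i j := by
      intro lam
      rw [h x hx y hy lam ν k]
      exact Finset.sum_congr rfl fun l _ => hB.dx_symm hU l x hx y hy l k lam ν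
    rw [Finset.sum_comm]
    simp only [← Finset.sum_mul, h1, neg_mul, Finset.sum_neg_distrib, lowered, Finset.mul_sum]
    simp only [Finset.sum_mul]
    rw [sum_rotate]
    congr 1
    exact Finset.sum_congr rfl fun i _ => Finset.sum_congr rfl fun j _ =>
      Finset.sum_congr rfl fun lam _ => by ring
  have e2 : ∑ p, (B.dφ σ).dx p x y k p μ ν = -∑ i, ∑ j, ΓM x k i j * B.dφ σ x y i j μ ν := by
    have hd : ∀ i j, DifferentiableAt ℝ (fun y' => B x y' i j μ ν) y := fun i j =>
      (contDiffOn_slice_right (f := fun x y => B x y i j μ ν) (hB.1 i j μ ν)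
        hx).differentiableAt_of_isOpen hV hy
    have hdx : ∀ p, DifferentiableAt ℝ (fun y' => B.dx p x y' k p μ ν) y := fun p =>
      (contDiffOn_slice_right (f := fun x y => B.dx p x y k p μ ν) ((hB.dx hU hV p).1 k p μ ν)
        hx).differentiableAt_of_isOpen hV hy
    have h1 : ∀ p, (B.dφ σ).dx p x y k p μ ν = pd σ (fun y' => B.dx p x y' k p μ ν) y := fun p =>
      pd_left_pd_right_comm hU hV (f := fun x y => B x y k p μ ν) (hB.1 k p μ ν) hx hy p σ
    simp only [h1]
    rw [← pd_sum σ fun p _ => hdx p, pd_congr_of_eqOn σ hV hy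
      fun y' hy' => (h x hx y' hy' μ ν k).symm, pd_neg,
      pd_sum σ fun i _ => DifferentiableAt.fun_sum fun j _ => (hd i j).mul_const _]
    congr 1
    refine Finset.sum_congr rfl fun i _ => ?_
    rw [pd_sum σ fun j _ => (hd i j).mul_const _]
    refine Finset.sum_congr rfl fun j _ => ?_
    simp only [mul_comm (B x _ i j μ ν)]
    rw [pd_const_mul σ _ (hd i j)]
    rfl
  have e3 : ∑ i, ∑ j, ΓM x k i j * (2 * lowered ΓN (B x · i j) ν μ σ y) =
      2 * ∑ i, ∑ j, ΓM x k i j * lowered ΓN (B x · i j) ν μ σ y := by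
    simp only [Finset.mul_sum, mul_left_comm (2 : ℝ)]
  unfold coeff33
  rw [e1, e2]
  simp only [coeff31_eq hΓN hy, mul_add, mul_sub, Finset.sum_add_distrib, Finset.sum_sub_distrib,
    e3]
  ring

/-- The divergence in `l` of the identity `HP21`, expanded by the product rule. -/
theorem coeff34_eq_zero (hU : IsOpen U) (hV : IsOpen V) (hB : B.IsAdmissible U V)
    (hΓM : ΓM.IsSmoothSymmetric U) (h : HP21 U V B ΓM) {x : Coord m} {y : Coord n}
    (hx : x ∈ U) (hy : y ∈ V) (μ ν : Fin n) : coeff34 B ΓM x y μ ν = 0 := by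
  have hd : ∀ i j, DifferentiableAt ℝ (fun x' => B x' y i j μ ν) x := fun i j =>
    (contDiffOn_slice_left (f := fun x y => B x y i j μ ν) (hB.1 i j μ ν)
      hy).differentiableAt_of_isOpen hU hx
  have hM : ∀ k i j, DifferentiableAt ℝ (fun x' => ΓM x' k i j) x := fun k i j =>
    (hΓM.1 k i j).differentiableAt_of_isOpen hU hx
  have hdx : ∀ l p, DifferentiableAt ℝ (fun x' => B.dx p x' y l p μ ν) x := fun l p =>
    (contDiffOn_slice_left (f := fun x y => B.dx p x y l p μ ν) ((hB.dx hU hV p).1 l p μ ν)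
      hy).differentiableAt_of_isOpen hU hx
  have e : ∀ l, ∑ p, (B.dx p).dx l x y l p μ ν =
      -∑ i, ∑ j, (B.dx l x y i j μ ν * ΓM x l i j
        + B x y i j μ ν * pd l (fun x' => ΓM x' l i j) x) := by
    intro l
    have h1 : ∑ p, (B.dx p).dx l x y l p μ ν = pd l (fun x' => ∑ p, B.dx p x' y l p μ ν) x :=
      (pd_sum l fun p _ => hdx l p).symm
    rw [h1, pd_congr_of_eqOn l hU hx fun x' hx' => (h x' hx' y hy μ ν l).symm, pd_neg,
      pd_sum l fun i _ => DifferentiableAt.fun_sum fun j _ => (hd i j).fun_mul (hM l i j)]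
    congr 1
    refine Finset.sum_congr rfl fun i _ => ?_
    rw [pd_sum l fun j _ => (hd i j).fun_mul (hM l i j)]
    exact Finset.sum_congr rfl fun j _ => pd_mul l (hd i j) (hM l i j)
  unfold coeff34
  simp only [e, Finset.sum_neg_distrib, Finset.sum_add_distrib]
  ring

theorem contDiffOn_fibre (hB : B.IsAdmissible U V) {x : Coord m} (hx : x ∈ U) (i j : Fin m)
    (σ ν : Fin n) : ContDiffOn ℝ ∞ (fun y => B x y i j σ ν) V :=
  contDiffOn_slice_right (f := fun x y => B x y i j σ ν) (hB.1 i j σ ν) hx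

/-- The product rule collects the terms of `Q` into derivatives of lowered connection symbols, and
these form the combination found in `sum_mul_curvature_sub`. -/
theorem coeff32_eq (hV : IsOpen V) (hB : B.IsAdmissible U V)
    (hΓN : ΓN.IsSmoothSymmetric V) (hs : B.LowerSymm U V) (h : HP22 U V B ΓN)
    {x : Coord m} {y : Coord n} (hx : x ∈ U) (hy : y ∈ V) (i j : Fin m) (μ ν α lam : Fin n) :
    coeff32 B ΓN x y i j μ ν α lam =
      ∑ β, B x y i j β μ * curvature ΓN y β lam ν α
        - ∑ σ, B x y i j σ ν * curvature ΓN y σ α μ lam := by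
  set b : Coord n → Fin n → Fin n → ℝ := fun y => B x y i j
  have hbs := contDiffOn_fibre hB hx i j
  have hp : ∀ y ∈ V, IsParallelAt ΓN b y := fun y hy => h x hx y hy i j
  have key := sum_mul_curvature_sub (b := b) hV hy hbs hΓN (fun y hy => hs x hx y hy i j)
    (hp y hy) μ lam ν α
  have hl : ∀ c a d, DifferentiableAt ℝ (lowered ΓN b c a d) y := fun c a d =>
    (contDiffOn_lowered hbs hΓN c a d).differentiableAt_of_isOpen hV hy
  -- Differentiating `HP22` replaces the second derivative of `B`; one of the resulting terms then
  -- cancels.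
  have e2 : (B.dφ α).dφ lam x y i j μ ν =
      pd α (lowered ΓN b ν μ lam) y + pd α (lowered ΓN b μ ν lam) y := by
    rw [dφ_dφ_comm hV hB.1 hx hy, ← pd_add α (hl _ _ _) (hl _ _ _)]
    exact pd_congr_of_eqOn α hV hy fun y' hy' => ((hp y' hy').lowered_add μ ν lam).symm
  have e1 : coeff32 B ΓN x y i j μ ν α lam = pd ν (lowered ΓN b μ α lam) y
      - pd μ (lowered ΓN b ν α lam) y + pd α (lowered ΓN b ν μ lam) y
      + pd lam (lowered ΓN b ν α μ) y - (B.dφ α).dφ lam x y i j μ ν := by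
    rw [pd_lowered hV hy hbs hΓN, pd_lowered hV hy hbs hΓN, pd_lowered hV hy hbs hΓN,
      pd_lowered hV hy hbs hΓN]
    simp only [← Finset.sum_add_distrib, ← Finset.sum_sub_distrib]
    unfold coeff32
    congr 1
    refine Finset.sum_congr rfl fun σ _ => ?_
    simp only [Multiplier.dφ]
    ring
  rw [e1, e2]
  refine Eq.trans ?_ key.symm
  ring

end Relations

/-! ### The Lagrangian -/

section Lagrangian

variable {m n : ℕ} {U : Set (Coord m)} {V : Set (Coord n)} {B : Multiplier m n}
  {ΓM : Connection m} {ΓN : Connection n}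

/-- `-½ B^{ij}_{στ} φ^σ_i φ^τ_j` as a function of the first-order jet coordinates. -/
def kinetic (B : Multiplier m n) (x : Coord m) (y : Coord n) (z : Fin n → Fin m → ℝ) : ℝ :=
  -(1 / 2) * ∑ i, ∑ j, ∑ σ, ∑ τ, B x y i j σ τ * z σ i * z τ j

/-- The Lagrangian `-½ B^{ij}_{στ} φ^σ_i φ^τ_j`. -/
def kineticLagrangian (B : Multiplier m n) (x : Coord m) (q : JetFibre 1 m n) : ℝ :=
  kinetic B x (q 0 fun a => Fin.elim0 a) fun σ i => q 1 (fun _ => i) σ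

theorem contDiffOn_kineticLagrangian (hB : B.IsAdmissible U V) :
    ContDiffOn ℝ ∞ (fun q : Coord m × JetFibre 1 m n => kineticLagrangian B q.1 q.2)
      {q | (q.1, q.2 0 (fun a => Fin.elim0 a)) ∈ U ×ˢ V} := by
  refine contDiffOn_const.mul (ContDiffOn.sum fun i _ => ContDiffOn.sum fun j _ =>
    ContDiffOn.sum fun σ _ => ContDiffOn.sum fun τ _ => ?_)
  have h1 : ContDiffOn ℝ ∞
      (fun q : Coord m × JetFibre 1 m n => B q.1 (q.2 0 fun a => Fin.elim0 a) i j σ τ)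
      {q | (q.1, q.2 0 (fun a => Fin.elim0 a)) ∈ U ×ˢ V} :=
    (hB.1 i j σ τ).comp (f := fun q : Coord m × JetFibre 1 m n => (q.1, q.2 0 fun a => Fin.elim0 a))
      (contDiff_fst.prodMk (contDiff_pi.1 (contDiff_pi.1 contDiff_snd 0) _)).contDiffOn
      fun q hq => hq
  have h2 : ∀ (σ : Fin n) (i : Fin m), ContDiff ℝ ∞
      (fun q : Coord m × JetFibre 1 m n => q.2 1 (fun _ => i) σ) := fun σ i =>
    contDiff_pi.1 (contDiff_pi.1 (contDiff_pi.1 contDiff_snd 1) _) σ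
  exact (h1.mul (h2 σ i).contDiffOn).mul (h2 τ j).contDiffOn

theorem fderiv_kineticLagrangian_zero (hU : IsOpen U) (hV : IsOpen V) (hB : B.IsAdmissible U V)
    {x : Coord m} {q : JetFibre 1 m n} (hx : x ∈ U) (hy : q 0 (fun a => Fin.elim0 a) ∈ V)
    (p : Fin ((0 : Fin (1 + 1)) : ℕ) → Fin m) (ν : Fin n) :
    fderiv ℝ (kineticLagrangian B x) q (Pi.single 0 (Pi.single p (Pi.single ν 1))) =
      -(1 / 2) * ∑ i, ∑ j, ∑ σ, ∑ τ, B.dφ ν x (q 0 fun a => Fin.elim0 a) i j σ τ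
        * q 1 (fun _ => i) σ * q 1 (fun _ => j) τ := by
  set y := q 0 fun a => Fin.elim0 a with hydef
  have hD : IsOpen {q : Coord m × JetFibre 1 m n | (q.1, q.2 0 (fun a => Fin.elim0 a)) ∈ U ×ˢ V} :=
    isOpen_jetRegion (π := fun q : JetFibre 1 m n => q 0 (fun a => Fin.elim0 a)) (by fun_prop)
      (hU.prod hV)
  have hd : DifferentiableAt ℝ (kineticLagrangian B x) q :=
    ((contDiffOn_kineticLagrangian hB).differentiableAt_of_isOpen hD (x := (x, q)) ⟨hx, hy⟩).comp
      (f := fun q => (x, q)) q (by fun_prop)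
  have hBd : ∀ i j σ τ, DifferentiableAt ℝ (fun y' => B x y' i j σ τ) y := fun i j σ τ =>
    (contDiffOn_fibre hB hx i j σ τ).differentiableAt_of_isOpen hV hy
  have hd1 : ∀ i j σ τ, DifferentiableAt ℝ
      (fun y' => B x y' i j σ τ * q 1 (fun _ => i) σ * q 1 (fun _ => j) τ) y := fun i j σ τ =>
    ((hBd i j σ τ).mul_const _).mul_const _
  have hd2 : ∀ i j σ, DifferentiableAt ℝ
      (fun y' => ∑ τ, B x y' i j σ τ * q 1 (fun _ => i) σ * q 1 (fun _ => j) τ) y := fun i j σ =>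
    DifferentiableAt.fun_sum fun τ _ => hd1 i j σ τ
  have hd3 : ∀ i j, DifferentiableAt ℝ
      (fun y' => ∑ σ, ∑ τ, B x y' i j σ τ * q 1 (fun _ => i) σ * q 1 (fun _ => j) τ) y :=
    fun i j => DifferentiableAt.fun_sum fun σ _ => hd2 i j σ
  have hd4 : ∀ i, DifferentiableAt ℝ
      (fun y' => ∑ j, ∑ σ, ∑ τ, B x y' i j σ τ * q 1 (fun _ => i) σ * q 1 (fun _ => j) τ) y :=
    fun i => DifferentiableAt.fun_sum fun j _ => hd3 i j
  have hd5 : DifferentiableAt ℝ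
      (fun y' => ∑ i, ∑ j, ∑ σ, ∑ τ,
        B x y' i j σ τ * q 1 (fun _ => i) σ * q 1 (fun _ => j) τ) y :=
    DifferentiableAt.fun_sum fun i _ => hd4 i
  have hg : fderiv ℝ (kineticLagrangian B x) q (Pi.single 0 (Pi.single p (Pi.single ν 1))) =
      pd ν (fun y' => kinetic B x y' fun σ i => q 1 (fun _ => i) σ) y := by
    have hd6 : DifferentiableAt ℝ (fun y' => kinetic B x y' fun σ i => q 1 (fun _ => i) σ) y :=
      hd5.const_mul _
    rw [pd, ← hd.lineDeriv_eq_fderiv, ← hd6.lineDeriv_eq_fderiv, lineDeriv, lineDeriv]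
    congr 1
    funext t
    have hp : p = fun a => Fin.elim0 a := funext fun a => Fin.elim0 a
    simp [kineticLagrangian, hp, hydef]
  rw [hg]
  unfold kinetic
  rw [pd_const_mul ν _ hd5, pd_sum ν fun i _ => hd4 i]
  congr 1
  refine Finset.sum_congr rfl fun i _ => ?_
  rw [pd_sum ν fun j _ => hd3 i j]
  refine Finset.sum_congr rfl fun j _ => ?_
  rw [pd_sum ν fun σ _ => hd2 i j σ]
  refine Finset.sum_congr rfl fun σ _ => ?_
  rw [pd_sum ν fun τ _ => hd1 i j σ τ]
  refine Finset.sum_congr rfl fun τ _ => ?_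
  rw [pd_mul ν ((hBd i j σ τ).mul_const _) (by fun_prop), pd_mul ν (hBd i j σ τ) (by fun_prop),
    pd_const, pd_const]
  simp only [Multiplier.dφ]
  ring

/-- The two velocity slots contribute equally by the joint symmetry of `B` in upper and lower
indices, which consumes the factor one half. -/
theorem fderiv_kineticLagrangian_one (hU : IsOpen U) (hV : IsOpen V) (hB : B.IsAdmissible U V)
    (hs : B.LowerSymm U V)
    {x : Coord m} {q : JetFibre 1 m n} (hx : x ∈ U) (hy : q 0 (fun a => Fin.elim0 a) ∈ V)
    (l : Fin m) (ν : Fin n) :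
    fderiv ℝ (kineticLagrangian B x) q
      (Pi.single 1 (Pi.single (fun _ => l) (Pi.single ν 1))) =
      -∑ j, ∑ τ, B x (q 0 fun a => Fin.elim0 a) l j τ ν * q 1 (fun _ => j) τ := by
  have hD : IsOpen {q : Coord m × JetFibre 1 m n | (q.1, q.2 0 (fun a => Fin.elim0 a)) ∈ U ×ˢ V} :=
    isOpen_jetRegion (π := fun q : JetFibre 1 m n => q 0 (fun a => Fin.elim0 a)) (by fun_prop)
      (hU.prod hV)
  have hd : DifferentiableAt ℝ (kineticLagrangian B x) q :=
    ((contDiffOn_kineticLagrangian hB).differentiableAt_of_isOpen hD (x := (x, q)) ⟨hx, hy⟩).comp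
      (f := fun q => (x, q)) q (by fun_prop)
  set y := q 0 fun a => Fin.elim0 a with hydef
  set z : Fin n → Fin m → ℝ := fun σ i => q 1 (fun _ => i) σ with hz
  set v : Fin n → Fin m → ℝ := fun σ i => if i = l then if σ = ν then 1 else 0 else 0 with hv
  have hvq : ∀ t : ℝ, kineticLagrangian B x
      (q + t • (Pi.single 1 (Pi.single (fun _ => l) (Pi.single ν 1)) : JetFibre 1 m n)) =
      kinetic B x y (fun σ i => z σ i + t * v σ i) := by
    intro t
    have e : ∀ (σ : Fin n) (i : Fin m), (Pi.single (fun _ => l) (Pi.single ν 1) :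
        (Fin ((1 : Fin (1 + 1)) : ℕ) → Fin m) → Coord n) (fun _ => i) σ = v σ i := by
      intro σ i
      by_cases h : i = l
      · subst h; simp [hv, Pi.single_apply]
      · have : (fun _ => i : Fin ((1 : Fin (1 + 1)) : ℕ) → Fin m) ≠ fun _ => l := fun h' =>
          h (congrFun h' (0 : Fin 1))
        rw [Pi.single_eq_of_ne this]
        simp [hv, h]
    simp only [kineticLagrangian, Pi.add_apply, Pi.smul_apply, Pi.single_eq_same, e, smul_eq_mul]
    rw [Pi.single_eq_of_ne (by simp)]
    simp [hydef, hz]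
  have h1 : ∑ i, ∑ j, ∑ σ, ∑ τ, B x y i j σ τ * v σ i * z τ j =
      ∑ j, ∑ τ, B x y l j τ ν * z τ j := by
    rw [Finset.sum_eq_single l (fun i _ hi => by simp [hv, hi]) (by simp)]
    refine Finset.sum_congr rfl fun j _ => ?_
    rw [Finset.sum_eq_single ν (fun i _ hi => by simp [hv, hi]) (by simp)]
    refine Finset.sum_congr rfl fun τ _ => ?_
    rw [hs x hx y hy l j ν τ]
    simp [hv]
  have h2 : ∑ i, ∑ j, ∑ σ, ∑ τ, B x y i j σ τ * z σ i * v τ j =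
      ∑ j, ∑ τ, B x y l j τ ν * z τ j := by
    rw [← h1, Finset.sum_comm]
    refine Finset.sum_congr rfl fun i _ => Finset.sum_congr rfl fun j _ => ?_
    rw [Finset.sum_comm]
    refine Finset.sum_congr rfl fun σ _ => Finset.sum_congr rfl fun τ _ => ?_
    rw [hs x hx y hy j i, hB.2 x hx y hy j i]
    ring
  refine fderiv_eq_of_quadratic hd (a := kinetic B x y z) (c := kinetic B x y v) fun t => ?_
  rw [hvq]
  have h3 : ∑ i, ∑ j, ∑ σ, ∑ τ, B x y i j σ τ * (z σ i + t * v σ i) * (z τ j + t * v τ j) =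
      ∑ i, ∑ j, ∑ σ, ∑ τ, B x y i j σ τ * z σ i * z τ j
      + t * (∑ i, ∑ j, ∑ σ, ∑ τ, B x y i j σ τ * v σ i * z τ j
        + ∑ i, ∑ j, ∑ σ, ∑ τ, B x y i j σ τ * z σ i * v τ j)
      + t ^ 2 * ∑ i, ∑ j, ∑ σ, ∑ τ, B x y i j σ τ * v σ i * v τ j := by
    simp only [Finset.mul_sum, ← Finset.sum_add_distrib]
    exact Finset.sum_congr rfl fun i _ => Finset.sum_congr rfl fun j _ =>
      Finset.sum_congr rfl fun σ _ => Finset.sum_congr rfl fun τ _ => by ring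
  unfold kinetic
  rw [h3, h1, h2]
  ring

theorem iteratedPd_one {f : Coord m → ℝ} (l : Fin m) (x : Coord m) :
    iteratedPd (fun _ : Fin 1 => l) f x = pd l f x := by
  simp [iteratedPd, pd, iteratedFDeriv_one_apply]

/-- The minus sign of the first-order Euler–Lagrange term cancels that of the momenta, so their
total divergence enters with a plus sign; this explains the negative sign chosen in the Lagrangian.
-/
theorem eulerLagrange_kineticLagrangian (hU : IsOpen U) (hV : IsOpen V) (hB : B.IsAdmissible U V)
    (hs : B.LowerSymm U V) {Ω : Set (Coord m)} {φ : Coord m → Coord n}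
    (hφ : IsSection (U ×ˢ V) Ω φ) {x : Coord m} (hx : x ∈ Ω) (ν : Fin n) :
    eulerLagrange (kineticLagrangian B) φ ν x =
      -(1 / 2) * ∑ i, ∑ j, ∑ σ, ∑ τ, B.dφ ν x (φ x) i j σ τ
        * pd i (fun x' => φ x' σ) x * pd j (fun x' => φ x' τ) x
      + ∑ l, ∑ j, ∑ τ, ((B.dx l x (φ x) l j τ ν
          + ∑ κ, B.dφ κ x (φ x) l j τ ν * pd l (fun x' => φ x' κ) x) * pd j (fun x' => φ x' τ) x
        + B x (φ x) l j τ ν * pd l (pd j fun x' => φ x' τ) x) := by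
  obtain ⟨h1, h2⟩ := hφ.2.2 x hx
  have hdφ := hφ.2.1.differentiableAt_of_isOpen hφ.1 hx
  have hj0 : ∀ x, jet 1 φ x 0 (fun a => Fin.elim0 a) = φ x := fun x => jet_zero_apply φ x
  have hj1 : ∀ y ∈ Ω, ∀ (i : Fin m) (σ : Fin n),
      jet 1 φ y 1 (fun _ => i) σ = pd i (fun x' => φ x' σ) y := by
    intro y hy i σ
    have := iteratedPd_apply hφ.2.1 hφ.1 (fun _ : Fin 1 => i) hy σ
    rw [iteratedPd_one] at this
    exact this
  unfold eulerLagrange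
  rw [Fin.sum_univ_two]
  congr 1
  · have e : ∀ p : Fin ((0 : Fin (1 + 1)) : ℕ) → Fin m,
        iteratedPd p (fun x' => fderiv ℝ (kineticLagrangian B x') (jet 1 φ x')
          (Pi.single 0 (Pi.single p (Pi.single ν 1)))) x =
        -(1 / 2) * ∑ i, ∑ j, ∑ σ, ∑ τ, B.dφ ν x (φ x) i j σ τ
          * pd i (fun x' => φ x' σ) x * pd j (fun x' => φ x' τ) x := by
      intro p
      refine (iteratedPd_zero p _ x).trans ?_
      rw [fderiv_kineticLagrangian_zero hU hV hB h1 (by rw [hj0]; exact h2)]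
      simp only [hj0, hj1 x hx]
    simp only [e]
    simp
  · have hud : ∀ j τ, DifferentiableAt ℝ (pd j fun x' => φ x' τ) x := fun j τ =>
      ((contDiffOn_apply hφ.2.1 τ).pd j hφ.1).differentiableAt_of_isOpen hφ.1 hx
    have hBd := fun i j σ τ =>
      Multiplier.IsSmoothOn.differentiableAt_along hB.1 hU hV h1 h2 hdφ i j σ τ
    have e : ∀ l : Fin m,
        iteratedPd (fun _ : Fin ((1 : Fin (1 + 1)) : ℕ) => l)
          (fun x' => fderiv ℝ (kineticLagrangian B x') (jet 1 φ x')
          (Pi.single 1 (Pi.single (fun _ => l) (Pi.single ν 1)))) x =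
        -∑ j, ∑ τ, ((B.dx l x (φ x) l j τ ν
          + ∑ κ, B.dφ κ x (φ x) l j τ ν * pd l (fun x' => φ x' κ) x) * pd j (fun x' => φ x' τ) x
        + B x (φ x) l j τ ν * pd l (pd j fun x' => φ x' τ) x) := by
      intro l
      refine (iteratedPd_one l x).trans ?_
      have e1 : EqOn (fun x' => fderiv ℝ (kineticLagrangian B x') (jet 1 φ x')
          (Pi.single 1 (Pi.single (fun _ => l) (Pi.single ν 1))))
          (fun y => -∑ j, ∑ τ, B y (φ y) l j τ ν * pd j (fun x' => φ x' τ) y) Ω := by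
        intro y hy
        refine (fderiv_kineticLagrangian_one hU hV hB hs (hφ.2.2 y hy).1
          (by rw [hj0]; exact (hφ.2.2 y hy).2) l ν).trans ?_
        simp only [hj0, hj1 y hy]
      rw [pd_congr_of_eqOn l hφ.1 hx e1, pd_neg,
        pd_sum l fun j _ => DifferentiableAt.fun_sum fun τ _ => (hBd _ _ _ _).fun_mul (hud j τ)]
      congr 1
      refine Finset.sum_congr rfl fun j _ => ?_
      rw [pd_sum l fun τ _ => (hBd _ _ _ _).fun_mul (hud j τ)]
      refine Finset.sum_congr rfl fun τ _ => ?_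
      rw [pd_mul l (hBd _ _ _ _) (hud j τ),
        Multiplier.IsSmoothOn.pd_along hB.1 hU hV h1 h2 hdφ]
    -- Index tuples of length one are identified with single indices.
    have e2 := Fintype.sum_equiv (Equiv.funUnique (Fin 1) (Fin m))
      (fun p : Fin ((1 : Fin (1 + 1)) : ℕ) → Fin m =>
        iteratedPd p (fun x' => fderiv ℝ (kineticLagrangian B x') (jet 1 φ x')
          (Pi.single 1 (Pi.single p (Pi.single ν 1)))) x)
      (fun l => -∑ j, ∑ τ, ((B.dx l x (φ x) l j τ ν
          + ∑ κ, B.dφ κ x (φ x) l j τ ν * pd l (fun x' => φ x' κ) x) * pd j (fun x' => φ x' τ) x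
        + B x (φ x) l j τ ν * pd l (pd j fun x' => φ x' τ) x)) (fun p => by
        have hp : p = fun _ => p (0 : Fin 1) := funext fun a => by
          rw [show a = (0 : Fin 1) from Subsingleton.elim (α := Fin 1) _ _]
        conv_lhs => rw [hp]
        exact e (p (0 : Fin 1)))
    refine (congrArg _ e2).trans ?_
    simp

/-- One Lagrangian serves over all of `U × V`. The second-order terms agree at once, the linear ones
by `HP21` and the quadratic ones by the Koszul formula. -/
theorem isVariational_of_symm_of_HP (hU : IsOpen U) (hV : IsOpen V) (hB : B.IsAdmissible U V)
    (hΓN : ΓN.IsSmoothSymmetric V) (hs : B.LowerSymm U V) (h21 : HP21 U V B ΓM)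
    (h22 : HP22 U V B ΓN) : IsVariational (U ×ˢ V) (dynForm (fun _ => 1) B ΓM ΓN) := by
  intro w hw
  refine ⟨U ×ˢ V, hU.prod hV, hw, Subset.rfl, 1, kineticLagrangian B,
    contDiffOn_kineticLagrangian hB, fun Ω φ hφ x hx ν => ?_⟩
  obtain ⟨h1, h2⟩ := hφ.2.2 x hx
  rw [eulerLagrange_kineticLagrangian hU hV hB hs hφ hx]
  set u : Fin n → Fin m → ℝ := fun σ i => pd i (fun x' => φ x' σ) x with hu
  set w : Fin n → Fin m → Fin m → ℝ := fun σ i j => pd j (pd i fun x' => φ x' σ) x with hwdef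
  have hw : ∀ σ i j, w σ i j = w σ j i := fun σ i j =>
    pd_comm j i ((contDiffOn_apply hφ.2.1 σ).contDiffAt (hφ.1.mem_nhds hx))
  -- The vanishing summand brings the form into the shape of `sum_dY_expand`.
  have e0 : (dynForm (fun _ => 1) B ΓM ΓN ν).along φ x =
      ∑ i, ∑ j, ∑ σ, (B x (φ x) i j σ ν * (w σ i j - ∑ k, ΓM x k i j * u σ k
        + ∑ α, ∑ lam, ΓN (φ x) σ α lam * u α i * u lam j)
      + 0 * ∑ α, ∑ lam, ΓN (φ x) σ α lam * u α i * u lam j) := by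
    simp [JetFun.along, dynForm, geodesicExpr, hu, hwdef]
  rw [e0, sum_dY_expand (fun k i j => ΓM x k i j) (fun σ α lam => ΓN (φ x) σ α lam)
    (fun σ α lam => ΓN (φ x) σ α lam) u w (fun i j σ => B x (φ x) i j σ ν) (fun _ _ _ => 0)]
  have g1 : ∑ l, ∑ j, ∑ τ, B x (φ x) l j τ ν * w τ j l =
      ∑ i, ∑ j, ∑ σ, B x (φ x) i j σ ν * w σ i j :=
    Finset.sum_congr rfl fun i _ => Finset.sum_congr rfl fun j _ =>
      Finset.sum_congr rfl fun σ _ => by rw [hw]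
  have g2 : ∑ l, ∑ j, ∑ τ, B.dx l x (φ x) l j τ ν * u τ j =
      -∑ k, ∑ σ, (∑ i, ∑ j, ΓM x k i j * B x (φ x) i j σ ν) * u σ k := by
    rw [sum_rotate, ← Finset.sum_neg_distrib]
    refine Finset.sum_congr rfl fun k _ => ?_
    rw [← Finset.sum_neg_distrib]
    refine Finset.sum_congr rfl fun σ _ => ?_
    have := h21 x h1 (φ x) h2 σ ν k
    rw [← Finset.sum_mul, ← neg_mul]
    congr 1
    simp only [mul_comm (ΓM x _ _ _)]
    rw [this]
    exact Finset.sum_congr rfl fun l _ => hB.dx_symm hU l x h1 _ h2 l k σ ν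
  have g3 : ∑ i, ∑ j, ∑ α, ∑ lam, (∑ σ, (B x (φ x) i j σ ν * ΓN (φ x) σ α lam
        + 0 * ΓN (φ x) σ α lam)) * u α i * u lam j =
      -(1 / 2) * ∑ i, ∑ j, ∑ σ, ∑ τ, B.dφ ν x (φ x) i j σ τ * u σ i * u τ j
      + ∑ l, ∑ j, ∑ τ, (∑ κ, B.dφ κ x (φ x) l j τ ν * u κ l) * u τ j := by
    have k1 : ∑ l, ∑ j, ∑ τ, (∑ κ, B.dφ κ x (φ x) l j τ ν * u κ l) * u τ j =
        ∑ i, ∑ j, ∑ α, ∑ lam, B.dφ α x (φ x) i j lam ν * u α i * u lam j := by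
      refine Finset.sum_congr rfl fun i _ => Finset.sum_congr rfl fun j _ => ?_
      simp only [Finset.sum_mul]
      exact Finset.sum_comm
    have k2 : ∑ i, ∑ j, ∑ α, ∑ lam, B.dφ α x (φ x) i j lam ν * u α i * u lam j =
        ∑ i, ∑ j, ∑ α, ∑ lam, B.dφ lam x (φ x) i j α ν * u α i * u lam j := by
      rw [sum_quadratic_symm u (fun i j α lam => B.dφ α x (φ x) i j lam ν)]
      refine Finset.sum_congr rfl fun i _ => Finset.sum_congr rfl fun j _ =>
        Finset.sum_congr rfl fun κ _ => Finset.sum_congr rfl fun lam _ => ?_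
      rw [hB.dφ_symm hV _ x h1 _ h2 j i]
    -- Symmetrizing over the two velocity slots produces both of the positive terms of the Koszul
    -- formula with weight one half.
    have k3 : ∑ i, ∑ j, ∑ α, ∑ lam, B.dφ α x (φ x) i j lam ν * u α i * u lam j =
        (1 / 2) * ∑ i, ∑ j, ∑ α, ∑ lam, B.dφ α x (φ x) i j lam ν * u α i * u lam j
        + (1 / 2) * ∑ i, ∑ j, ∑ α, ∑ lam, B.dφ lam x (φ x) i j α ν * u α i * u lam j := by
      rw [← k2]; ring
    rw [k1, k3]
    simp only [Finset.mul_sum, ← Finset.sum_add_distrib]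
    refine Finset.sum_congr rfl fun i _ => Finset.sum_congr rfl fun j _ =>
      Finset.sum_congr rfl fun α _ => Finset.sum_congr rfl fun lam _ => ?_
    have k4 : 2 * ∑ σ, B x (φ x) i j σ ν * ΓN (φ x) σ α lam = B.dφ lam x (φ x) i j α ν
        + B.dφ α x (φ x) i j lam ν - B.dφ ν x (φ x) i j α lam :=
      IsParallelAt.two_mul_lowered (b := fun y => B x y i j) (hΓN.2 _ h2)
        (h22 x h1 (φ x) h2 i j) ν α lam
    simp only [zero_mul, add_zero]
    linear_combination (1 / 2) * u α i * u lam j * k4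
  rw [g3, sub_eq_add_neg, ← g2, ← g1]
  have hwl : ∀ (l j : Fin m) (τ : Fin n), pd l (pd j fun x' => φ x' τ) x = w τ j l :=
    fun _ _ _ => rfl
  simp only [add_mul, Finset.sum_add_distrib]
  ring

end Lagrangian


/-! ### Variationality for a general multiplier -/

section General

variable {m n : ℕ} {U : Set (Coord m)} {V : Set (Coord n)} {B : Multiplier m n}
  {ΓM : Connection m} {ΓN : Connection n}

/-- The first two Helmholtz conditions already yield an explicit Lagrangian, so the equivalence
closes without the third. -/
theorem isVariational_iff (hU : IsOpen U) (hV : IsOpen V) (hB : B.IsAdmissible U V)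
    (hΓM : ΓM.IsSmoothSymmetric U) (hΓN : ΓN.IsSmoothSymmetric V) :
    IsVariational (U ×ˢ V) (dynForm (fun _ => 1) B ΓM ΓN) ↔
      B.LowerSymm U V ∧ HP21 U V B ΓM ∧ HP22 U V B ΓN := by
  refine ⟨fun h => ?_, fun ⟨hs, h21, h22⟩ => isVariational_of_symm_of_HP hU hV hB hΓN hs h21 h22⟩
  obtain ⟨H1, H2⟩ := h.helmholtz fun ν => dynForm_isSmoothOver hB.1 hΓM hΓN ν
  have hs := (helmholtz1_iff hU hV hB).1 H1
  exact ⟨hs, (helmholtz2_iff hU hV hB hΓN hs).1 H2⟩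

theorem sum_multiplier_mul_curvature_symm (hV : IsOpen V) (hB : B.IsAdmissible U V)
    (hΓN : ΓN.IsSmoothSymmetric V) (hs : B.LowerSymm U V) (h : HP22 U V B ΓN)
    {x : Coord m} {y : Coord n} (hx : x ∈ U) (hy : y ∈ V) (i j : Fin m) (μ ν α lam : Fin n) :
    ∑ β, B x y i j β μ * curvature ΓN y β lam ν α =
      ∑ σ, B x y i j σ ν * curvature ΓN y σ α μ lam :=
  sum_mul_curvature_symm (b := fun y => B x y i j) hV hy (contDiffOn_fibre hB hx i j) hΓN
    (fun y hy => hs x hx y hy i j) (fun y hy => h x hx y hy i j) μ lam ν α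

theorem helmholtz3_of_symm_of_HP (hU : IsOpen U) (hV : IsOpen V) (hB : B.IsAdmissible U V)
    (hΓM : ΓM.IsSmoothSymmetric U) (hΓN : ΓN.IsSmoothSymmetric V) (hs : B.LowerSymm U V)
    (h21 : HP21 U V B ΓM) (h22 : HP22 U V B ΓN) :
    Helmholtz3 (U ×ˢ V) (dynForm (fun _ => 1) B ΓM ΓN) := by
  have hP := (coeff31_iff hV hΓN hs).2 h22
  refine (helmholtz3_iff hU hV hB hΓM hΓN).2 fun x hx y hy =>
    ⟨hP x hx y hy, fun i j μ ν α lam => ?_, fun k μ ν σ => ?_,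
      fun μ ν => coeff34_eq_zero hU hV hB hΓM h21 hx hy μ ν⟩
  · rw [coeff32_eq hV hB hΓN hs h22 hx hy,
      sum_multiplier_mul_curvature_symm hV hB hΓN hs h22 hx hy, sub_self]
  · rw [coeff33_eq hU hV hB hΓN h21 hx hy]
    simp [hP x hx y hy]

theorem isVariational_iff_helmholtz (hU : IsOpen U) (hV : IsOpen V) (hB : B.IsAdmissible U V)
    (hΓM : ΓM.IsSmoothSymmetric U) (hΓN : ΓN.IsSmoothSymmetric V) :
    IsVariational (U ×ˢ V) (dynForm (fun _ => 1) B ΓM ΓN) ↔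
      Helmholtz1 (U ×ˢ V) (dynForm (fun _ => 1) B ΓM ΓN) ∧
      Helmholtz2 (U ×ˢ V) (dynForm (fun _ => 1) B ΓM ΓN) ∧
      Helmholtz3 (U ×ˢ V) (dynForm (fun _ => 1) B ΓM ΓN) := by
  rw [isVariational_iff hU hV hB hΓM hΓN]
  constructor
  · rintro ⟨hs, h21, h22⟩
    exact ⟨(helmholtz1_iff hU hV hB).2 hs, (helmholtz2_iff hU hV hB hΓN hs).2 ⟨h21, h22⟩,
      helmholtz3_of_symm_of_HP hU hV hB hΓM hΓN hs h21 h22⟩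
  · rintro ⟨H1, H2, -⟩
    have hs := (helmholtz1_iff hU hV hB).1 H1
    exact ⟨hs, (helmholtz2_iff hU hV hB hΓN hs).1 H2⟩

end General


/-! ### Calculus of matrix-valued functions -/

section MatrixCalculus

variable {k r : ℕ} {U : Set (Coord k)} {A : Coord k → Matrix (Fin r) (Fin r) ℝ}

theorem contDiffOn_det (hA : ∀ i j, ContDiffOn ℝ ∞ (fun x => A x i j) U) :
    ContDiffOn ℝ ∞ (fun x => (A x).det) U := by
  simp only [Matrix.det_apply']
  exact ContDiffOn.sum fun σ _ => contDiffOn_const.mul (contDiffOn_prod fun i _ => hA _ _)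

/-- Cramer's rule: the entry is a quotient of determinants, hence of polynomials in the entries of
`A`. -/
theorem contDiffOn_inv (hA : ∀ i j, ContDiffOn ℝ ∞ (fun x => A x i j) U)
    (hdet : ∀ x ∈ U, (A x).det ≠ 0) (i j : Fin r) :
    ContDiffOn ℝ ∞ (fun x => (A x)⁻¹ i j) U := by
  have h : ContDiffOn ℝ ∞ (fun x => ((A x).updateRow j (Pi.single i 1)).det) U := by
    refine contDiffOn_det fun a b => ?_
    by_cases hab : a = j
    · subst hab
      simpa using contDiffOn_const
    · simpa [Matrix.updateRow_ne hab] using hA a b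
  refine ((contDiffOn_det hA).inv hdet |>.mul h).congr fun x _ => ?_
  simp [Matrix.inv_def, Matrix.adjugate_apply, Ring.inverse_eq_inv']

/-- Jacobi's formula. -/
theorem pd_det (p : Fin k) {x : Coord k} (hA : ∀ i j, DifferentiableAt ℝ (fun x => A x i j) x) :
    pd p (fun x => (A x).det) x =
      ∑ i, ∑ j, (A x).adjugate j i * pd p (fun x' => A x' i j) x := by
  -- As a multilinear function of the rows, the determinant is differentiated by replacing one row
  -- at a time; each resulting determinant is expanded through the adjugate.
  let f : ContinuousMultilinearMap ℝ (fun _ : Fin r => Fin r → ℝ) ℝ :=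
    { toMultilinearMap := (Matrix.detRowAlternating (R := ℝ) (n := Fin r)).toMultilinearMap
      cont := (continuous_id : Continuous fun M : Matrix (Fin r) (Fin r) ℝ => M).matrix_det }
  have hA' : HasFDerivAt (fun x => (fun i j => A x i j : Fin r → Fin r → ℝ))
      (ContinuousLinearMap.pi fun i => ContinuousLinearMap.pi fun j =>
        fderiv ℝ (fun x' => A x' i j) x) x :=
    hasFDerivAt_pi.2 fun i => hasFDerivAt_pi.2 fun j => (hA i j).hasFDerivAt
  have h := (f.hasFDerivAt (A x)).comp x hA'
  have h' : fderiv ℝ (fun x => (A x).det) x = _ := h.fderiv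
  rw [pd, h']
  refine (f.linearDeriv_apply _ _).trans ?_
  refine Finset.sum_congr rfl fun i _ => ?_
  change ((A x).updateRow i fun j => pd p (fun x' => A x' i j) x).det = _
  rw [← Matrix.cramer_transpose_apply, Matrix.cramer_eq_adjugate_mulVec,
    ← Matrix.adjugate_transpose]
  simp [Matrix.mulVec, dotProduct]

/-- The derivative of `A A⁻¹ = 1`. -/
theorem sum_mul_pd_inv (hU : IsOpen U) {x : Coord k} (hx : x ∈ U)
    (hA : ∀ i j, ContDiffOn ℝ ∞ (fun x => A x i j) U) (hdet : ∀ x ∈ U, (A x).det ≠ 0)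
    (p : Fin k) (a c : Fin r) :
    ∑ b, A x a b * pd p (fun x' => (A x')⁻¹ b c) x =
      -∑ b, pd p (fun x' => A x' a b) x * (A x)⁻¹ b c := by
  have hd : ∀ b, DifferentiableAt ℝ (fun x => A x a b) x := fun b =>
    (hA a b).differentiableAt_of_isOpen hU hx
  have hi : ∀ b, DifferentiableAt ℝ (fun x => (A x)⁻¹ b c) x := fun b =>
    (contDiffOn_inv hA hdet b c).differentiableAt_of_isOpen hU hx
  have h0 : pd p (fun x' => ∑ b, A x' a b * (A x')⁻¹ b c) x = 0 := by
    rw [pd_congr_of_eqOn (g := fun _ => (1 : Matrix (Fin r) (Fin r) ℝ) a c) p hU hx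
      fun x' hx' => ?_, pd_const]
    rw [← Matrix.mul_nonsing_inv _ (hdet x' hx').isUnit, Matrix.mul_apply]
  rw [pd_sum p fun b _ => (hd b).fun_mul (hi b)] at h0
  simp only [pd_mul p (hd _) (hi _), Finset.sum_add_distrib] at h0
  linarith

end MatrixCalculus

/-! ### The Levi-Civita connection -/

section LeviCivita

variable {n : ℕ} {V : Set (Coord n)} {Γ : Connection n} {h : Coord n → Matrix (Fin n) (Fin n) ℝ}

/-- Regularity of `h` enters here: lowering an index with `h` and raising it with the inverse matrix
undo each other. -/
theorem two_mul_lowered_iff_leviCivita {y : Coord n} (hV : IsOpen V) (hy : y ∈ V)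
    (hs : ∀ y ∈ V, ∀ μ ν, h y μ ν = h y ν μ) (hdet : (h y).det ≠ 0) :
    (∀ c α lam, 2 * lowered Γ h c α lam y = pd lam (fun y' => h y' α c) y
      + pd α (fun y' => h y' lam c) y - pd c (fun y' => h y' α lam) y) ↔
    ∀ σ α lam, Γ y σ α lam = leviCivita h y σ α lam := by
  have hs' : ∀ a μ ν, pd a (fun y' => h y' μ ν) y = pd a (fun y' => h y' ν μ) y := fun a μ ν =>
    pd_congr_of_eqOn a hV hy fun y' hy' => hs y' hy' μ ν
  have e1 : ∀ σ τ, ∑ c, (h y)⁻¹ σ c * h y τ c = if σ = τ then 1 else 0 := by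
    intro σ τ
    simp only [hs y hy τ, ← Matrix.mul_apply, Matrix.nonsing_inv_mul _ hdet.isUnit,
      Matrix.one_apply]
  have e2 : ∀ c d, ∑ σ, h y σ c * (h y)⁻¹ σ d = if c = d then 1 else 0 := by
    intro c d
    simp only [hs y hy _ c, ← Matrix.mul_apply, Matrix.mul_nonsing_inv _ hdet.isUnit,
      Matrix.one_apply]
  constructor
  · intro H σ α lam
    have e3 : Γ y σ α lam = ∑ c, (h y)⁻¹ σ c * lowered Γ h c α lam y := by
      simp only [lowered, Finset.mul_sum, ← mul_assoc]
      rw [Finset.sum_comm]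
      simp [← Finset.sum_mul, e1]
    rw [e3, leviCivita, Finset.mul_sum]
    refine Finset.sum_congr rfl fun c _ => ?_
    have := H c α lam
    rw [hs' lam c α, hs' α c lam]
    linear_combination (1 / 2) * (h y)⁻¹ σ c * this
  · intro H c α lam
    simp only [lowered, H, leviCivita, Finset.mul_sum]
    rw [Finset.sum_comm]
    have e4 : ∀ d, ∑ σ, 2 * (h y σ c * (1 / 2 * ((h y)⁻¹ σ d * (pd α (fun y' => h y' d lam) y
        + pd lam (fun y' => h y' d α) y - pd d (fun y' => h y' α lam) y)))) =
        (if c = d then 1 else 0) * (pd α (fun y' => h y' d lam) y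
        + pd lam (fun y' => h y' d α) y - pd d (fun y' => h y' α lam) y) := by
      intro d
      rw [← e2 c d, Finset.sum_mul]
      exact Finset.sum_congr rfl fun σ _ => by ring
    simp only [e4, ite_mul, one_mul, zero_mul, Finset.sum_ite_eq, Finset.mem_univ, if_true]
    rw [hs' lam c α, hs' α c lam]
    ring

theorem isParallelAt_iff_leviCivita {y : Coord n} (hV : IsOpen V) (hy : y ∈ V)
    (hΓ : Γ.IsSmoothSymmetric V) (hs : ∀ y ∈ V, ∀ μ ν, h y μ ν = h y ν μ)
    (hdet : (h y).det ≠ 0) :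
    IsParallelAt Γ h y ↔ ∀ σ α lam, Γ y σ α lam = leviCivita h y σ α lam := by
  rw [← two_mul_lowered_iff_leviCivita hV hy hs hdet]
  exact ⟨fun H => H.two_mul_lowered (hΓ.2 y hy), isParallelAt_of_two_mul_lowered hV hy hs⟩

end LeviCivita

/-! ### The volume density -/

section Volume

variable {m : ℕ} {U : Set (Coord m)} {g : Coord m → Matrix (Fin m) (Fin m) ℝ}

theorem volDensity_ne_zero {x : Coord m} (hdet : (g x).det ≠ 0) : volDensity g x ≠ 0 := by
  rw [volDensity, Matrix.det_nonsing_inv, Ring.inverse_eq_inv']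
  exact Real.sqrt_ne_zero'.2 (abs_pos.2 (inv_ne_zero hdet))

/-- The fourth power removes both the square root and the absolute value, so the density can be
differentiated without distinguishing the sign of the determinant. -/
theorem volDensity_pow_four_mul {x : Coord m} (hdet : (g x).det ≠ 0) :
    volDensity g x ^ 4 * (g x).det ^ 2 = 1 := by
  rw [volDensity, Matrix.det_nonsing_inv, Ring.inverse_eq_inv', show 4 = 2 * 2 from rfl, pow_mul,
    Real.sq_sqrt (abs_nonneg _), sq_abs, ← mul_pow, inv_mul_cancel₀ hdet, one_pow]

theorem contDiffOn_volDensity (hg : ∀ i j, ContDiffOn ℝ ∞ (fun x => g x i j) U)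
    (hdet : ∀ x ∈ U, (g x).det ≠ 0) : ContDiffOn ℝ ∞ (volDensity g) U := by
  have h : ContDiffOn ℝ ∞ (fun x => √|((g x).det)⁻¹|) U :=
    (((contDiffOn_det hg).inv hdet).abs fun x hx => inv_ne_zero (hdet x hx)).sqrt
      fun x hx => (abs_pos.2 (inv_ne_zero (hdet x hx))).ne'
  refine h.congr fun x _ => ?_
  rw [volDensity, Matrix.det_nonsing_inv, Ring.inverse_eq_inv']

theorem pd_volDensity (hU : IsOpen U) {x : Coord m} (hx : x ∈ U)
    (hg : ∀ i j, ContDiffOn ℝ ∞ (fun x => g x i j) U) (hdet : ∀ x ∈ U, (g x).det ≠ 0)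
    (p : Fin m) :
    pd p (volDensity g) x =
      -(1 / 2) * volDensity g x * ∑ i, ∑ j, (g x)⁻¹ j i * pd p (fun x' => g x' i j) x := by
  have hd : DifferentiableAt ℝ (fun x => (g x).det) x :=
    (contDiffOn_det hg).differentiableAt_of_isOpen hU hx
  have hρ : DifferentiableAt ℝ (volDensity g) x :=
    (contDiffOn_volDensity hg hdet).differentiableAt_of_isOpen hU hx
  have h0 : pd p (fun x => volDensity g x ^ 4 * (g x).det ^ 2) x = 0 := by
    rw [pd_congr_of_eqOn (g := fun _ => 1) p hU hx fun x' hx' =>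
      volDensity_pow_four_mul (hdet x' hx'), pd_const]
  have h1 : pd p (fun x => volDensity g x ^ 4 * (g x).det ^ 2) x =
      2 * volDensity g x ^ 3 * (g x).det * (2 * pd p (volDensity g) x * (g x).det
        + volDensity g x * pd p (fun x => (g x).det) x) := by
    rw [pd_mul p (hρ.fun_pow 4) (hd.fun_pow 2), pd, pd, pd, pd, fderiv_fun_pow 4 hρ,
      fderiv_fun_pow 2 hd]
    simp
    ring
  have h2 : ∑ i, ∑ j, (g x)⁻¹ j i * pd p (fun x' => g x' i j) x =
      ((g x).det)⁻¹ * pd p (fun x => (g x).det) x := by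
    rw [pd_det p fun i j => (hg i j).differentiableAt_of_isOpen hU hx]
    simp only [Matrix.inv_def, Ring.inverse_eq_inv', Matrix.smul_apply, smul_eq_mul,
      Finset.mul_sum, mul_assoc]
  -- The differentiated identity contains this expression multiplied by factors that do not vanish.
  have h3 : 2 * pd p (volDensity g) x * (g x).det
      + volDensity g x * pd p (fun x => (g x).det) x = 0 := by
    rw [h1] at h0
    refine (mul_eq_zero.1 h0).resolve_left ?_
    exact mul_ne_zero (mul_ne_zero two_ne_zero (pow_ne_zero _ (volDensity_ne_zero (hdet x hx))))
      (hdet x hx)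
  have h4 := hdet x hx
  rw [h2]
  field_simp
  linarith

/-- The contracted Christoffel symbols of the metric with contravariant components `g`. -/
theorem sum_mul_leviCivita_inv (hU : IsOpen U) {x : Coord m} (hx : x ∈ U)
    (hg : ∀ i j, ContDiffOn ℝ ∞ (fun x => g x i j) U) (hs : ∀ x ∈ U, ∀ i j, g x i j = g x j i)
    (hdet : ∀ x ∈ U, (g x).det ≠ 0) (l : Fin m) :
    ∑ i, ∑ j, g x i j * leviCivita (fun x' => (g x')⁻¹) x l i j =
      -∑ p, pd p (fun x' => g x' l p) x
        + (1 / 2) * ∑ p, g x l p * ∑ i, ∑ j, (g x)⁻¹ j i * pd p (fun x' => g x' i j) x := by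
  have hsi : ∀ x ∈ U, ∀ i j, (g x)⁻¹ i j = (g x)⁻¹ j i := by
    intro x hx i j
    have : (g x).IsSymm := Matrix.IsSymm.ext fun i j => hs x hx j i
    exact (this.inv.apply j i)
  have e1 : ∑ i, ∑ j, ∑ p, g x i j * (g x l p * pd i (fun x' => (g x')⁻¹ p j) x) =
      -∑ p, pd p (fun x' => g x' l p) x := by
    -- The derivative is moved from the inverse matrix onto `g`; the remaining contraction of `g`
    -- with its inverse is then a Kronecker delta.
    have h1 : ∀ i j, ∑ p, g x i j * (g x l p * pd i (fun x' => (g x')⁻¹ p j) x) =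
        -∑ b, g x i j * (pd i (fun x' => g x' l b) x * (g x)⁻¹ b j) := by
      intro i j
      rw [← Finset.mul_sum, sum_mul_pd_inv hU hx hg hdet, mul_neg, Finset.mul_sum]
    simp only [h1, Finset.sum_neg_distrib]
    congr 1
    refine Finset.sum_congr rfl fun i _ => ?_
    rw [Finset.sum_comm]
    have h2 : ∀ b, ∑ j, g x i j * (pd i (fun x' => g x' l b) x * (g x)⁻¹ b j) =
        pd i (fun x' => g x' l b) x * if b = i then 1 else 0 := by
      intro b
      rw [← Matrix.one_apply, ← Matrix.nonsing_inv_mul _ (hdet x hx).isUnit, Matrix.mul_apply,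
        Finset.mul_sum]
      exact Finset.sum_congr rfl fun j _ => by rw [hs x hx j i]; ring
    simp [h2]
  have e2 : ∑ i, ∑ j, ∑ p, g x i j * (g x l p * pd j (fun x' => (g x')⁻¹ p i) x) =
      -∑ p, pd p (fun x' => g x' l p) x := by
    rw [← e1, Finset.sum_comm]
    exact Finset.sum_congr rfl fun i _ => Finset.sum_congr rfl fun j _ => by rw [hs x hx j i]
  have e3 : ∑ i, ∑ j, ∑ p, g x i j * (g x l p * pd p (fun x' => (g x')⁻¹ i j) x) =
      -∑ p, g x l p * ∑ i, ∑ j, (g x)⁻¹ j i * pd p (fun x' => g x' i j) x := by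
    rw [← Finset.sum_neg_distrib, Finset.sum_congr rfl fun i _ => Finset.sum_comm,
      Finset.sum_comm]
    refine Finset.sum_congr rfl fun p _ => ?_
    rw [← mul_neg, ← Finset.sum_neg_distrib, Finset.mul_sum]
    refine Finset.sum_congr rfl fun i _ => ?_
    -- Summed over `i`, the diagonal entries of the differentiated inverse relation give the trace
    -- identity `g^{ij} ∂_p g_{ij} = -g_{ij} ∂_p g^{ij}`.
    have h1 := sum_mul_pd_inv hU hx hg hdet p i i
    have h2 : ∀ j, pd p (fun x' => (g x')⁻¹ i j) x = pd p (fun x' => (g x')⁻¹ j i) x := fun j =>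
      pd_congr_of_eqOn p hU hx fun x' hx' => hsi x' hx' i j
    simp only [h2, mul_left_comm (g x i _), mul_comm ((g x)⁻¹ _ _)]
    rw [← Finset.mul_sum, h1]
  have e4 : ∑ i, ∑ j, g x i j * leviCivita (fun x' => (g x')⁻¹) x l i j =
      (1 / 2) * (∑ i, ∑ j, ∑ p, g x i j * (g x l p * pd i (fun x' => (g x')⁻¹ p j) x)
        + ∑ i, ∑ j, ∑ p, g x i j * (g x l p * pd j (fun x' => (g x')⁻¹ p i) x)
        - ∑ i, ∑ j, ∑ p, g x i j * (g x l p * pd p (fun x' => (g x')⁻¹ i j) x)) := by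
    simp only [leviCivita, Finset.mul_sum, ← Finset.sum_add_distrib, ← Finset.sum_sub_distrib,
      Matrix.nonsing_inv_nonsing_inv _ (hdet x hx).isUnit]
    exact Finset.sum_congr rfl fun i _ => Finset.sum_congr rfl fun j _ =>
      Finset.sum_congr rfl fun p _ => by ring
  rw [e4, e1, e2, e3]
  ring

/-- The derivative of the density supplies precisely the trace term of the contracted Christoffel
symbols. -/
theorem sum_pd_volDensity_mul (hU : IsOpen U) {x : Coord m} (hx : x ∈ U)
    (hg : ∀ i j, ContDiffOn ℝ ∞ (fun x => g x i j) U) (hs : ∀ x ∈ U, ∀ i j, g x i j = g x j i)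
    (hdet : ∀ x ∈ U, (g x).det ≠ 0) (l : Fin m) :
    ∑ p, pd p (fun x' => volDensity g x' * g x' l p) x =
      -(volDensity g x * ∑ i, ∑ j, g x i j * leviCivita (fun x' => (g x')⁻¹) x l i j) := by
  have hρ : DifferentiableAt ℝ (volDensity g) x :=
    (contDiffOn_volDensity hg hdet).differentiableAt_of_isOpen hU hx
  have hd : ∀ p, DifferentiableAt ℝ (fun x' => g x' l p) x := fun p =>
    (hg l p).differentiableAt_of_isOpen hU hx
  simp only [pd_mul _ hρ (hd _), pd_volDensity hU hx hg hdet, Finset.sum_add_distrib,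
    sum_mul_leviCivita_inv hU hx hg hs hdet, ← Finset.mul_sum]
  have e : ∑ p, -(1 / 2) * volDensity g x * (∑ i, ∑ j, (g x)⁻¹ j i * pd p (fun x' => g x' i j) x)
      * g x l p = -(1 / 2) * volDensity g x *
      ∑ p, g x l p * ∑ i, ∑ j, (g x)⁻¹ j i * pd p (fun x' => g x' i j) x := by
    rw [Finset.mul_sum]
    exact Finset.sum_congr rfl fun p _ => by ring
  rw [e]
  ring

end Volume


/-! ### Separated multipliers -/

section Separated

variable {m n : ℕ} {U : Set (Coord m)} {V : Set (Coord n)} {ΓM : Connection m} {ΓN : Connection n}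
  {g : Coord m → Matrix (Fin m) (Fin m) ℝ} {h : Coord m → Coord n → Matrix (Fin n) (Fin n) ℝ}

theorem tensorMult_isAdmissible (hg : ∀ i j, ContDiffOn ℝ ∞ (fun x => g x i j) U)
    (hgs : ∀ x ∈ U, ∀ i j, g x i j = g x j i)
    (hh : ∀ μ ν, ContDiffOn ℝ ∞ (fun q : Coord m × Coord n => h q.1 q.2 μ ν) (U ×ˢ V)) :
    (tensorMult g h).IsAdmissible U V :=
  ⟨fun i j σ ν => ((hg i j).comp contDiff_fst.contDiffOn fun _ hq => hq.1).mul (hh σ ν),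
    fun x hx y _ i j σ ν => by simp only [tensorMult, hgs x hx i j]⟩

/-- Positive size is essential, as the empty matrix has determinant one. The nonzero entry permits
cancelling `g` from pointwise conditions on `g ⊗ h`. -/
theorem exists_ne_zero_of_det_ne_zero {m : ℕ} (hm : 0 < m) {A : Matrix (Fin m) (Fin m) ℝ}
    (hA : A.det ≠ 0) : ∃ i j, A i j ≠ 0 := by
  by_contra! H
  have : Nonempty (Fin m) := ⟨⟨0, hm⟩⟩
  exact hA (by rw [show A = 0 from Matrix.ext H, Matrix.det_zero])

theorem lowerSymm_tensorMult_iff (hm : 0 < m) (hdet : ∀ x ∈ U, (g x).det ≠ 0) :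
    (tensorMult g h).LowerSymm U V ↔ ∀ x ∈ U, ∀ y ∈ V, ∀ μ ν, h x y μ ν = h x y ν μ := by
  refine ⟨fun H x hx y hy μ ν => ?_, fun H x hx y hy i j σ ν => ?_⟩
  · obtain ⟨i, j, hij⟩ := exists_ne_zero_of_det_ne_zero hm (hdet x hx)
    exact mul_left_cancel₀ hij (H x hx y hy i j μ ν)
  · simp only [tensorMult, H x hx y hy σ ν]

theorem isParallelAt_const_mul_iff {Γ : Connection n} {b : Coord n → Fin n → Fin n → ℝ}
    {y : Coord n} {c : ℝ} (hc : c ≠ 0) (hb : ∀ μ ν, DifferentiableAt ℝ (fun y' => b y' μ ν) y) :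
    IsParallelAt Γ (fun y μ ν => c * b y μ ν) y ↔ IsParallelAt Γ b y := by
  simp only [IsParallelAt, pd_const_mul _ c (hb _ _), mul_left_comm _ c, ← Finset.mul_sum,
    ← mul_add, mul_right_inj' hc]

/-- Along a fibre `g^{ij}(x)` is constant, so each pair `i`, `j` with nonzero entry gives the same
condition on `h`, and the other pairs give none. -/
theorem hp22_tensorMult_iff (hm : 0 < m) (hV : IsOpen V) (hdet : ∀ x ∈ U, (g x).det ≠ 0)
    (hh : ∀ μ ν, ContDiffOn ℝ ∞ (fun q : Coord m × Coord n => h q.1 q.2 μ ν) (U ×ˢ V)) :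
    HP22 U V (tensorMult g h) ΓN ↔ ∀ x ∈ U, ∀ y ∈ V, IsParallelAt ΓN (h x) y := by
  have hd : ∀ x ∈ U, ∀ y ∈ V, ∀ μ ν, DifferentiableAt ℝ (fun y' => h x y' μ ν) y :=
    fun x hx y hy μ ν => (contDiffOn_slice_right (f := fun x y => h x y μ ν) (hh μ ν)
      hx).differentiableAt_of_isOpen hV hy
  refine ⟨fun H x hx y hy => ?_, fun H x hx y hy i j => ?_⟩
  · obtain ⟨i, j, hij⟩ := exists_ne_zero_of_det_ne_zero hm (hdet x hx)
    exact (isParallelAt_const_mul_iff hij (hd x hx y hy)).1 (H x hx y hy i j)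
  · by_cases hij : g x i j = 0
    · intro μ ν lam
      simp [tensorMult, Multiplier.dφ, hij, pd_const]
    · exact (isParallelAt_const_mul_iff hij (hd x hx y hy)).2 (H x hx y hy)

theorem hp21_tensorMult_iff (hU : IsOpen U) (hg : ∀ i j, ContDiffOn ℝ ∞ (fun x => g x i j) U)
    (hh : ∀ μ ν, ContDiffOn ℝ ∞ (fun q : Coord m × Coord n => h q.1 q.2 μ ν) (U ×ˢ V)) :
    HP21 U V (tensorMult g h) ΓM ↔ ∀ x ∈ U, ∀ y ∈ V, ∀ μ ν l,
      h x y μ ν * (∑ i, ∑ j, g x i j * ΓM x l i j + ∑ p, pd p (fun x' => g x' l p) x) =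
        -∑ p, pd p (fun x' => h x' y μ ν) x * g x l p := by
  refine forall₂_congr fun x hx => forall₂_congr fun y hy => forall₃_congr fun μ ν l => ?_
  have hgd : ∀ p, DifferentiableAt ℝ (fun x' => g x' l p) x := fun p =>
    (hg l p).differentiableAt_of_isOpen hU hx
  have hhd : DifferentiableAt ℝ (fun x' => h x' y μ ν) x :=
    (contDiffOn_slice_left (f := fun x y => h x y μ ν) (hh μ ν) hy).differentiableAt_of_isOpen hU hx
  have e1 : ∑ p, (tensorMult g h).dx p x y l p μ ν =
      h x y μ ν * ∑ p, pd p (fun x' => g x' l p) x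
        + ∑ p, pd p (fun x' => h x' y μ ν) x * g x l p := by
    rw [Finset.mul_sum, ← Finset.sum_add_distrib]
    refine Finset.sum_congr rfl fun p _ => (pd_mul p (hgd p) hhd).trans ?_
    ring
  have e2 : ∑ i, ∑ j, tensorMult g h x y i j μ ν * ΓM x l i j =
      h x y μ ν * ∑ i, ∑ j, g x i j * ΓM x l i j := by
    simp only [Finset.mul_sum]
    exact Finset.sum_congr rfl fun i _ => Finset.sum_congr rfl fun j _ => by
      rw [tensorMult]; ring
  rw [e1, e2]
  constructor <;> intro H <;> linarith

theorem fibrewiseInduced_iff (hV : IsOpen V) (hΓN : ΓN.IsSmoothSymmetric V)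
    (hdet : ∀ x ∈ U, ∀ y ∈ V, (h x y).det ≠ 0) :
    FibrewiseInduced U V h ΓN ↔ (∀ x ∈ U, ∀ y ∈ V, ∀ μ ν, h x y μ ν = h x y ν μ) ∧
      ∀ x ∈ U, ∀ y ∈ V, IsParallelAt ΓN (h x) y := by
  constructor
  · intro H
    have hs := fun x hx y hy => (H x hx y hy).1
    exact ⟨hs, fun x hx y hy =>
      (isParallelAt_iff_leviCivita hV hy hΓN (hs x hx) (hdet x hx y hy)).2 (H x hx y hy).2⟩
  · rintro ⟨hs, hp⟩ x hx y hy
    exact ⟨hs x hx y hy,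
      (isParallelAt_iff_leviCivita hV hy hΓN (hs x hx) (hdet x hx y hy)).1 (hp x hx y hy)⟩

theorem isVariational_tensorMult_iff (hm : 0 < m) (hU : IsOpen U) (hV : IsOpen V)
    (hΓM : ΓM.IsSmoothSymmetric U) (hΓN : ΓN.IsSmoothSymmetric V)
    (hg : ∀ i j, ContDiffOn ℝ ∞ (fun x => g x i j) U)
    (hgs : ∀ x ∈ U, ∀ i j, g x i j = g x j i) (hgdet : ∀ x ∈ U, (g x).det ≠ 0)
    (hh : ∀ μ ν, ContDiffOn ℝ ∞ (fun q : Coord m × Coord n => h q.1 q.2 μ ν) (U ×ˢ V))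
    (hhdet : ∀ x ∈ U, ∀ y ∈ V, (h x y).det ≠ 0) :
    IsVariational (U ×ˢ V) (dynForm (fun _ => 1) (tensorMult g h) ΓM ΓN) ↔
      FibrewiseInduced U V h ΓN ∧ ∀ x ∈ U, ∀ y ∈ V, ∀ μ ν l,
        h x y μ ν * (∑ i, ∑ j, g x i j * ΓM x l i j + ∑ p, pd p (fun x' => g x' l p) x) =
          -∑ p, pd p (fun x' => h x' y μ ν) x * g x l p := by
  rw [isVariational_iff hU hV (tensorMult_isAdmissible hg hgs hh) hΓM hΓN,
    lowerSymm_tensorMult_iff hm hgdet, hp21_tensorMult_iff hU hg hh,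
    hp22_tensorMult_iff hm hV hgdet hh, fibrewiseInduced_iff hV hΓN hhdet]
  tauto

/-- A density depending only on `x` can be absorbed into `g`, reducing any volume element to the
coordinate one. -/
theorem dynForm_tensorMult (ρ : Coord m → ℝ) :
    dynForm ρ (tensorMult g h) ΓM ΓN =
      dynForm (fun _ => 1) (tensorMult (fun x => ρ x • g x) h) ΓM ΓN := by
  funext ν x y z w
  simp only [dynForm, tensorMult, Finset.mul_sum, Matrix.smul_apply, smul_eq_mul, one_mul, mul_assoc]

theorem isVariational_volDensity_iff (hm : 0 < m) (hU : IsOpen U) (hV : IsOpen V)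
    (hΓM : ΓM.IsSmoothSymmetric U) (hΓN : ΓN.IsSmoothSymmetric V)
    (hg : ∀ i j, ContDiffOn ℝ ∞ (fun x => g x i j) U)
    (hgs : ∀ x ∈ U, ∀ i j, g x i j = g x j i) (hgdet : ∀ x ∈ U, (g x).det ≠ 0)
    (hh : ∀ μ ν, ContDiffOn ℝ ∞ (fun q : Coord m × Coord n => h q.1 q.2 μ ν) (U ×ˢ V))
    (hhdet : ∀ x ∈ U, ∀ y ∈ V, (h x y).det ≠ 0) :
    IsVariational (U ×ˢ V) (dynForm (volDensity g) (tensorMult g h) ΓM ΓN) ↔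
      FibrewiseInduced U V h ΓN ∧ ∀ x ∈ U, ∀ y ∈ V, ∀ μ ν l,
        h x y μ ν * ∑ i, ∑ j, g x i j *
            (ΓM x l i j - leviCivita (fun x' => (g x')⁻¹) x l i j) =
          -∑ p, pd p (fun x' => h x' y μ ν) x * g x l p := by
  have hρ := contDiffOn_volDensity hg hgdet
  rw [dynForm_tensorMult, isVariational_tensorMult_iff (g := fun x => volDensity g x • g x) hm hU hV hΓM hΓN
    (fun i j => hρ.mul (hg i j)) (fun x hx i j => by simp [hgs x hx i j])
    (fun x hx => by
      rw [Matrix.det_smul]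
      exact mul_ne_zero (pow_ne_zero _ (volDensity_ne_zero (hgdet x hx))) (hgdet x hx)) hh hhdet]
  refine and_congr_right fun _ => forall₂_congr fun x hx => forall₂_congr fun y hy =>
    forall₃_congr fun μ ν l => ?_
  have e1 : ∑ i, ∑ j, (volDensity g x • g x) i j * ΓM x l i j =
      volDensity g x * ∑ i, ∑ j, g x i j * ΓM x l i j := by
    simp only [Finset.mul_sum, Matrix.smul_apply, smul_eq_mul, mul_assoc]
  have e2 : ∑ p, pd p (fun x' => (volDensity g x' • g x') l p) x = _ :=
    sum_pd_volDensity_mul hU hx hg hgs hgdet l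
  have e3 : -∑ p, pd p (fun x' => h x' y μ ν) x * (volDensity g x • g x) l p =
      volDensity g x * -∑ p, pd p (fun x' => h x' y μ ν) x * g x l p := by
    rw [mul_neg, Finset.mul_sum]
    exact congrArg _ (Finset.sum_congr rfl fun p _ => by
      simp only [Matrix.smul_apply, smul_eq_mul]; ring)
  rw [e1, e2, e3, ← sub_eq_add_neg, ← mul_sub, mul_left_comm,
    mul_right_inj' (volDensity_ne_zero (hgdet x hx))]
  simp only [mul_sub, Finset.sum_sub_distrib]

/-- Contraction with the inverse matrix, whose trace against `A` is `n`; division by `n` needs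
positive size. -/
theorem eq_neg_sum_inv_mul (hn : 0 < n) {A : Matrix (Fin n) (Fin n) ℝ} (hs : ∀ μ ν, A μ ν = A ν μ)
    (hA : A.det ≠ 0) {s : ℝ} {ι : Type*} [Fintype ι] {D : ι → Fin n → Fin n → ℝ} {c : ι → ℝ}
    (H : ∀ μ ν, A μ ν * s = -∑ p, D p μ ν * c p) :
    s = -(1 / (n : ℝ)) * ∑ p, ∑ μ, ∑ ν, A⁻¹ μ ν * D p μ ν * c p := by
  have h1 : ∑ μ, ∑ ν, A⁻¹ μ ν * A μ ν = n := by
    have h2 : ∀ μ, ∑ ν, A⁻¹ μ ν * A μ ν = 1 := by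
      intro μ
      simp only [hs μ, ← Matrix.mul_apply, Matrix.nonsing_inv_mul _ hA.isUnit, Matrix.one_apply_eq]
    simp [h2]
  have h3 : (n : ℝ) * s = -∑ p, ∑ μ, ∑ ν, A⁻¹ μ ν * D p μ ν * c p := by
    rw [← h1, sum_rotate (fun p μ ν => A⁻¹ μ ν * D p μ ν * c p)]
    simp only [Finset.sum_mul, mul_assoc, H, ← Finset.mul_sum, mul_neg, Finset.sum_neg_distrib]
  have hn' : (n : ℝ) ≠ 0 := Nat.cast_ne_zero.2 hn.ne'
  field_simp
  linarith

end Separated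

end GeodesicInverse

end

/-! ### The main theorem -/

open GeodesicInverse in
theorem mainTheorem1 {m n : ℕ} (hm : 0 < m) (hn : 0 < n)
    (U : Set (Coord m)) (V : Set (Coord n)) (hU : IsOpen U) (hV : IsOpen V)
    (ΓM : Connection m) (ΓN : Connection n)
    (hΓM : ΓM.IsSmoothSymmetric U) (hΓN : ΓN.IsSmoothSymmetric V) :
    -- General multipliers, in the coordinate volume element.
    (∀ B : Multiplier m n, B.IsAdmissible U V →
      (Helmholtz1 (U ×ˢ V) (dynForm (fun _ => 1) B ΓM ΓN) ↔ B.LowerSymm U V) ∧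
      (B.LowerSymm U V →
        (Helmholtz2 (U ×ˢ V) (dynForm (fun _ => 1) B ΓM ΓN) ↔
          HP21 U V B ΓM ∧ HP22 U V B ΓN)) ∧
      (Helmholtz3 (U ×ˢ V) (dynForm (fun _ => 1) B ΓM ΓN) ↔
        ∀ x ∈ U, ∀ y ∈ V,
          (∀ i j μ ν σ, coeff31 B ΓN x y i j μ ν σ = 0) ∧
          (∀ i j μ ν α lam, coeff32 B ΓN x y i j μ ν α lam = 0) ∧
          (∀ k μ ν σ, coeff33 B ΓM ΓN x y k μ ν σ = 0) ∧
          (∀ μ ν, coeff34 B ΓM x y μ ν = 0)) ∧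
      (B.LowerSymm U V →
        ((∀ x ∈ U, ∀ y ∈ V, ∀ i j μ ν σ, coeff31 B ΓN x y i j μ ν σ = 0) ↔ HP22 U V B ΓN)) ∧
      (HP21 U V B ΓM → ∀ x ∈ U, ∀ y ∈ V,
        (∀ k μ ν σ, coeff33 B ΓM ΓN x y k μ ν σ =
          -∑ i, ∑ j, ΓM x k i j * coeff31 B ΓN x y i j μ ν σ) ∧
        (∀ μ ν, coeff34 B ΓM x y μ ν = 0)) ∧
      (B.LowerSymm U V → HP22 U V B ΓN → ∀ x ∈ U, ∀ y ∈ V, ∀ i j μ ν α lam,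
        coeff32 B ΓN x y i j μ ν α lam =
          ∑ β, B x y i j β μ * curvature ΓN y β lam ν α
            - ∑ σ, B x y i j σ ν * curvature ΓN y σ α μ lam ∧
        ∑ β, B x y i j β μ * curvature ΓN y β lam ν α =
          ∑ σ, B x y i j σ ν * curvature ΓN y σ α μ lam) ∧
      (IsVariational (U ×ˢ V) (dynForm (fun _ => 1) B ΓM ΓN) ↔
        Helmholtz1 (U ×ˢ V) (dynForm (fun _ => 1) B ΓM ΓN) ∧
        Helmholtz2 (U ×ˢ V) (dynForm (fun _ => 1) B ΓM ΓN) ∧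
        Helmholtz3 (U ×ˢ V) (dynForm (fun _ => 1) B ΓM ΓN)) ∧
      (IsVariational (U ×ˢ V) (dynForm (fun _ => 1) B ΓM ΓN) ↔
        B.LowerSymm U V ∧ HP21 U V B ΓM ∧ HP22 U V B ΓN)) ∧
    -- Separated multipliers.
    (∀ (g : Coord m → Matrix (Fin m) (Fin m) ℝ)
        (h : Coord m → Coord n → Matrix (Fin n) (Fin n) ℝ),
      (∀ i j, ContDiffOn ℝ ∞ (fun x => g x i j) U) →
      (∀ x ∈ U, ∀ i j, g x i j = g x j i) →
      (∀ x ∈ U, (g x).det ≠ 0) →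
      (∀ μ ν, ContDiffOn ℝ ∞ (fun q : Coord m × Coord n => h q.1 q.2 μ ν) (U ×ˢ V)) →
      (∀ x ∈ U, ∀ y ∈ V, (h x y).det ≠ 0) →
      -- The coordinate volume element.
      (IsVariational (U ×ˢ V) (dynForm (fun _ => 1) (tensorMult g h) ΓM ΓN) ↔
        FibrewiseInduced U V h ΓN ∧
        ∀ x ∈ U, ∀ y ∈ V, ∀ μ ν l,
          h x y μ ν * (∑ i, ∑ j, g x i j * ΓM x l i j + ∑ p, pd p (fun x' => g x' l p) x) =
            -∑ p, pd p (fun x' => h x' y μ ν) x * g x l p) ∧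
      -- The volume element of `g`.
      (IsVariational (U ×ˢ V) (dynForm (volDensity g) (tensorMult g h) ΓM ΓN) ↔
        FibrewiseInduced U V h ΓN ∧
        ∃ S : Connection m,
          (∀ x ∈ U, ∀ l i j, ΓM x l i j = leviCivita (fun x' => (g x')⁻¹) x l i j + S x l i j) ∧
          (∀ x ∈ U, ∀ y ∈ V, ∀ μ ν l,
            h x y μ ν * ∑ i, ∑ j, g x i j * S x l i j =
              -∑ p, pd p (fun x' => h x' y μ ν) x * g x l p) ∧
          (∀ x ∈ U, ∀ y ∈ V, ∀ l,
            ∑ i, ∑ j, g x i j * S x l i j =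
              -(1 / (n : ℝ)) * ∑ p, ∑ μ, ∑ ν,
                (h x y)⁻¹ μ ν * pd p (fun x' => h x' y μ ν) x * g x l p)) ∧
      (FibrewiseInduced U V h ΓN → ∀ x ∈ U, ∀ y ∈ V, ∀ μ ν α lam,
        ∑ β, h x y β μ * curvature ΓN y β lam ν α =
          ∑ σ, h x y σ ν * curvature ΓN y σ α μ lam)) := by
  refine ⟨fun B hB => ⟨helmholtz1_iff hU hV hB, fun hs => helmholtz2_iff hU hV hB hΓN hs,
    helmholtz3_iff hU hV hB hΓM hΓN, fun hs => coeff31_iff hV hΓN hs,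
    fun h21 x hx y hy => ⟨fun k μ ν σ => coeff33_eq hU hV hB hΓN h21 hx hy k μ ν σ,
      fun μ ν => coeff34_eq_zero hU hV hB hΓM h21 hx hy μ ν⟩,
    fun hs h22 x hx y hy i j μ ν α lam => ⟨coeff32_eq hV hB hΓN hs h22 hx hy i j μ ν α lam,
      sum_multiplier_mul_curvature_symm hV hB hΓN hs h22 hx hy i j μ ν α lam⟩,
    isVariational_iff_helmholtz hU hV hB hΓM hΓN, isVariational_iff hU hV hB hΓM hΓN⟩,
    fun g h hg hgs hgdet hh hhdet =>
      ⟨isVariational_tensorMult_iff hm hU hV hΓM hΓN hg hgs hgdet hh hhdet, ?_, ?_⟩⟩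
  · rw [isVariational_volDensity_iff hm hU hV hΓM hΓN hg hgs hgdet hh hhdet]
    refine and_congr_right fun hind => ⟨fun H => ?_, ?_⟩
    -- The tensor `S` can only be the difference of the two connections. The contracted identity
    -- follows from the full one.
    · exact ⟨fun x l i j => ΓM x l i j - leviCivita (fun x' => (g x')⁻¹) x l i j,
        fun x _ l i j => by ring, H, fun x hx y hy l =>
          eq_neg_sum_inv_mul hn (hind x hx y hy).1 (hhdet x hx y hy) fun μ ν => H x hx y hy μ ν l⟩
    · rintro ⟨S, hS, H, -⟩ x hx y hy μ ν l
      rw [← H x hx y hy μ ν l]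
      simp only [hS x hx, add_sub_cancel_left]
  · intro hind x hx y hy μ ν α lam
    obtain ⟨hs, hp⟩ := (fibrewiseInduced_iff hV hΓN hhdet).1 hind
    exact sum_mul_curvature_symm hV hy
      (fun σ ν => contDiffOn_slice_right (f := fun x y => h x y σ ν) (hh σ ν) hx) hΓN
      (hs x hx) (hp x hx) μ lam ν α
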